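/- **Setting.** Let $n\ge 1$, let $\theta$ be a random vector in $\mathbb R^n$ with pdf $p_\theta$, let $\Theta=\{\theta: p_\theta(\theta)>0\}$ (open), and let the measurement $x$ have conditional pdf $p(x;\theta)$ for $\theta\in\Theta$, with respect to a $\sigma$-finite measure. Assume the regularity conditions of the Cramér–Rao bound: $p(x;\cdot)$ is continuously differentiable on $\Theta$; the Fisher information matrix $\mathbf J(\theta)_{ij}=E\{\partial_{\theta_i}\log p\;\partial_{\theta_j}\log p;\theta\}$ exists, is bounded on $\Theta$, and is positive definite at every $\theta\in\Theta$; and for every measurable scalar function $t$, if $t\,p(\cdot;\theta)$ and $t\,\partial_{\theta_i}p(\cdot;\theta)$ are integrable for all $\theta\in\Theta$, then $\partial_{\theta_i}\int t\,p(x;\theta)\,dx$ exists and equals $\int t\,\partial_{\theta_i}p(x;\theta)\,dx$. An estimator is a measurable $\hat\theta(x)\in\mathbb R^n$ for which $\|\partial_\theta p(x;\theta)\,\hat\theta(x)^T\|_F\le g(x)$ for almost every $x$ and all $\theta\in\Theta$, with some integrable $g$. Let $H^1$ be the space of $\mathbf b:\Theta\to\mathbb R^n$ in $L^2(p_\theta)$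 whose weak derivative $\partial\mathbf b/\partial\theta$ is a function in $L^2(p_\theta)$, let $$Z[\mathbf b]=\int_\Theta\Big[\|\mathbf b\|^2+\operatorname{Tr}\Big(\big(I+\tfrac{\partial \mathbf b}{\partial\theta}\big)\mathbf J^{-1}\big(I+\tfrac{\partial \mathbf b}{\partial\theta}\big)^T\Big)\Big]p_\theta(\theta)\,d\theta ,$$ and let the optimal-bias bound (OBB) be $\inf_{\mathbf b\in H^1}Z[\mathbf b]$. **Theorem.** Suppose that $\Theta=\{\theta:\|\theta\|<r\}$ with $r>0$, and that $p_\theta(\theta)=q(\|\theta\|)$ and $\mathbf J(\theta)=J(\|\theta\|)\,I$ on $\Theta$, with $q,J$ continuous on $[0,r)$ and locally absolutely continuous on $(0,r)$. Suppose that $J$ is bounded away from $0$ on $[0,r)$, and that there are $r_0\in(0,r)$ and $K$ with $q(t)\le K q(s)$ whenever $r_0\le s\le t<r$ (which holds, for instance, if $q$ has a positive limit at $r$ or is nonincreasing near $r$). Then the boundary value problem $$J(\rho)b(\rho)=b''(\rho)+(n-1)\Big(\frac{b'(\rho)}{\rho}-\frac{b(\rho)}{\rho^2}\Big)+(1+b'(\rho))\Big(\frac{d\log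 q}{d\rho}-\frac{d\log J}{d\rho}\Big),\qquad b(0)=0,\quad b'(r)=-1,$$ has a solution $b$, continuous on $[0,r]$ and differentiable on $(0,r)$, with $b'$ locally absolutely continuous on $(0,r)$, where the equation holds at every point of $(0,r)$ at which $q$ and $J$ are differentiable, and $b'(r)$ is the one-sided derivative. For every such solution $b$, the bias function $$\mathbf b(\theta)=b(\|\theta\|)\,\frac{\theta}{\|\theta\|}$$ belongs to $H^1$ and minimizes $Z$ over $H^1$; it is the only minimizer up to equality almost everywhere on $\Theta$. The OBB equals the one-dimensional (convergent) integral $$\frac{2\pi^{n/2}}{\Gamma(n/2)}\int_0^r\Big[b^2(\rho)+\frac{(1+b'(\rho))^2}{J(\rho)}+\frac{n-1}{J(\rho)}\Big(1+\frac{b(\rho)}{\rho}\Big)^2\Big]q(\rho)\rho^{n-1}\,d\rho ,$$ and $E\{\|\theta-\hat\theta\|^2\}$ is at least this number for every estimator $\hat\theta$. -/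

import Mathlib

open MeasureTheory Set Filter Topology
open scoped ENNReal ContDiff

noncomputable section

namespace OptimalBias

/-- The parameter space `ℝⁿ` with its Euclidean norm. -/
abbrev E (n : ℕ) : Type := EuclideanSpace ℝ (Fin n)

/-- The partial derivative `∂f/∂θ_i` at `θ`. -/
def pd {n : ℕ} (f : E n → ℝ) (i : Fin n) (θ : E n) : ℝ :=
  fderiv ℝ f θ (EuclideanSpace.single i 1)

/-! ### Weak derivatives and the first-order Sobolev space -/

/-- `D` is a weak (distributional) Jacobian of `b` on the open set `Ω`: the entry `D θ i j` is
the weak derivative of `b_i` with respect to `θ_j`. -/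
structure HasWeakJacobian {n : ℕ} (Ω : Set (E n)) (b : E n → E n)
    (D : E n → Matrix (Fin n) (Fin n) ℝ) : Prop where
  locallyIntegrable : ∀ i, LocallyIntegrableOn (fun θ => b θ i) Ω
  locallyIntegrable_deriv : ∀ i j, LocallyIntegrableOn (fun θ => D θ i j) Ω
  integral_eq : ∀ i j, ∀ φ : E n → ℝ, ContDiff ℝ ∞ φ → HasCompactSupport φ → tsupport φ ⊆ Ω →
    ∫ θ in Ω, b θ i * pd φ j θ = -∫ θ in Ω, D θ i j * φ θ

open Classical in
/-- The weak Jacobian `∂b/∂θ` on `Ω` (it is unique almost everywhere when it exists). -/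
def weakJacobian {n : ℕ} (Ω : Set (E n)) (b : E n → E n) : E n → Matrix (Fin n) (Fin n) ℝ :=
  if h : ∃ D, HasWeakJacobian Ω b D then h.choose else 0

/-- The set of feasible parameter values, `Θ = {θ : p_θ(θ) > 0}`. -/
def feasibleSet {n : ℕ} (prior : E n → ℝ) : Set (E n) := {θ | 0 < prior θ}

/-- The prior probability distribution, with density `prior`. -/
def priorMeasure {n : ℕ} (prior : E n → ℝ) : Measure (E n) :=
  volume.withDensity fun θ => ENNReal.ofReal (prior θ)

/-- `b` belongs to the Sobolev space `H¹`: `b` and its weak Jacobian on `Θ` are square integrable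
with respect to the prior. -/
def MemH1 {n : ℕ} (prior : E n → ℝ) (b : E n → E n) : Prop :=
  MemLp b 2 (priorMeasure prior) ∧
    ∃ D, HasWeakJacobian (feasibleSet prior) b D ∧
      ∀ i j, MemLp (fun θ => D θ i j) 2 (priorMeasure prior)

/-! ### Fisher information, the Cramér–Rao bound and the optimal-bias bound -/

section Model

variable {n : ℕ} {𝒳 : Type*} [MeasurableSpace 𝒳]

/-- The Fisher information matrix of the family of densities `lik θ` with respect to `ν`:
`J(θ)_{ij} = E{ ∂ log p(x;θ)/∂θ_i · ∂ log p(x;θ)/∂θ_j ; θ }`. -/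
def fisher (ν : Measure 𝒳) (lik : E n → 𝒳 → ℝ) (θ : E n) : Matrix (Fin n) (Fin n) ℝ :=
  Matrix.of fun i j =>
    ∫ x, pd (fun η => Real.log (lik η x)) i θ * pd (fun η => Real.log (lik η x)) j θ * lik θ x ∂ν

/-- The Cramér–Rao bound `Tr((I + ∂b/∂θ) J⁻¹ (I + ∂b/∂θ)ᵀ) + ‖b‖²` for a bias value `b`, a bias
gradient `D` and a Fisher information matrix `J`. -/
def crb (J : Matrix (Fin n) (Fin n) ℝ) (b : E n) (D : Matrix (Fin n) (Fin n) ℝ) : ℝ :=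
  ((1 + D) * J⁻¹ * (1 + D).transpose).trace + ‖b‖ ^ 2

/-- The functional `Z[b] = ∫_Θ CRB[b, θ] p_θ(θ) dθ`, with `∂b/∂θ` the weak derivative. -/
def Z (ν : Measure 𝒳) (prior : E n → ℝ) (lik : E n → 𝒳 → ℝ) (b : E n → E n) : ℝ≥0∞ :=
  ∫⁻ θ in feasibleSet prior, ENNReal.ofReal
    (crb (fisher ν lik θ) (b θ) (weakJacobian (feasibleSet prior) b θ) * prior θ)

/-- The optimal-bias bound: the infimum of `Z[b]` over all `b` in `H¹`. -/
def optimalBiasBound (ν : Measure 𝒳) (prior : E n → ℝ) (lik : E n → 𝒳 → ℝ) : ℝ≥0∞ :=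
  ⨅ b ∈ {b : E n → E n | MemH1 prior b}, Z ν prior lik b

/-- The estimation setting: a prior density `prior` on `ℝⁿ`, positive exactly on the open set `Θ`,
a conditional density `lik θ` of the measurement (with respect to `ν`) for every `θ ∈ Θ`, and the
regularity conditions of the Cramér–Rao bound. -/
structure IsRegularSetting (ν : Measure 𝒳) (prior : E n → ℝ) (lik : E n → 𝒳 → ℝ) : Prop where
  prior_measurable : Measurable prior
  prior_nonneg : ∀ θ, 0 ≤ prior θ
  prior_lintegral : ∫⁻ θ, ENNReal.ofReal (prior θ) = 1
  isOpen_feasibleSet : IsOpen (feasibleSet prior)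
  lik_measurable : Measurable fun z : E n × 𝒳 => lik z.1 z.2
  lik_nonneg : ∀ θ ∈ feasibleSet prior, ∀ x, 0 ≤ lik θ x
  lik_lintegral : ∀ θ ∈ feasibleSet prior, ∫⁻ x, ENNReal.ofReal (lik θ x) ∂ν = 1
  /-- The density is continuously differentiable in the parameter. -/
  lik_contDiffOn : ∀ x, ContDiffOn ℝ 1 (fun θ => lik θ x) (feasibleSet prior)
  /-- The Fisher information exists, is bounded and is positive definite. -/
  fisher_integrable : ∀ θ ∈ feasibleSet prior, ∀ i j, Integrable (fun x =>
    pd (fun η => Real.log (lik η x)) i θ * pd (fun η => Real.log (lik η x)) j θ * lik θ x) ν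
  fisher_bounded : ∃ K : ℝ, ∀ θ ∈ feasibleSet prior, ∀ i j, |fisher ν lik θ i j| ≤ K
  fisher_posDef : ∀ θ ∈ feasibleSet prior, (fisher ν lik θ).PosDef
  /-- Integration against a statistic `t` may be exchanged with differentiation in the parameter
  whenever both of the integrals exist on `Θ`. -/
  exchange : ∀ t : 𝒳 → ℝ, Measurable t → ∀ i : Fin n,
    (∀ θ ∈ feasibleSet prior, Integrable (fun x => t x * lik θ x) ν) →
    (∀ θ ∈ feasibleSet prior, Integrable (fun x => t x * pd (fun η => lik η x) i θ) ν) →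
    ∀ θ ∈ feasibleSet prior,
      HasLineDerivAt ℝ (fun η => ∫ x, t x * lik η x ∂ν)
        (∫ x, t x * pd (fun η => lik η x) i θ ∂ν) θ (EuclideanSpace.single i 1)

/-- An (admissible) estimator: a measurable function `est` of the measurement for which the
Frobenius norm of the matrix `(∂p(x;θ)/∂θ) est(x)ᵀ` is dominated, uniformly in `θ`, by an
integrable function of `x`. -/
structure IsEstimator (ν : Measure 𝒳) (prior : E n → ℝ) (lik : E n → 𝒳 → ℝ) (est : 𝒳 → E n) :
    Prop where
  measurable : Measurable est
  dominated : ∃ g : 𝒳 → ℝ, Integrable g ν ∧ ∀ᵐ x ∂ν, ∀ θ ∈ feasibleSet prior,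
    Real.sqrt (∑ i, ∑ j, (pd (fun η => lik η x) i θ * est x j) ^ 2) ≤ g x

/-- The Bayesian mean-squared error `E{‖est(x) - θ‖²}` (possibly infinite), the expectation being
over the joint density `p(x|θ) p_θ(θ)`. -/
def bayesMSE (ν : Measure 𝒳) (prior : E n → ℝ) (lik : E n → 𝒳 → ℝ) (est : 𝒳 → E n) : ℝ≥0∞ :=
  ∫⁻ z : E n × 𝒳, ENNReal.ofReal (‖est z.2 - z.1‖ ^ 2 * (lik z.1 z.2 * prior z.1))
    ∂((volume : Measure (E n)).prod ν)

end Model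

/-! ### The radial problem -/

/-- `f` is locally absolutely continuous on the open interval `(0, r)`. -/
def LocallyAC (f : ℝ → ℝ) (r : ℝ) : Prop :=
  ∀ s t, 0 < s → s ≤ t → t < r → AbsolutelyContinuousOnInterval f s t

/-- `b` solves the radial ODE
`J b = b'' + (n-1) (b'/ρ - b/ρ²) + (1 + b') (d log q/dρ - d log J/dρ)` on `(0, r)` with
`b(0) = 0` and `b'(r) = -1` (one-sided derivative). The derivative `b'` is locally absolutely
continuous and the equation holds at every point at which `q` and `J` are differentiable. -/
structure IsRadialSolution (n : ℕ) (r : ℝ) (q J b : ℝ → ℝ) : Prop where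
  continuousOn : ContinuousOn b (Icc 0 r)
  differentiableOn : DifferentiableOn ℝ b (Ioo 0 r)
  locallyAC_deriv : LocallyAC (deriv b) r
  ode : ∀ ρ ∈ Ioo 0 r, DifferentiableAt ℝ q ρ → DifferentiableAt ℝ J ρ →
    DifferentiableAt ℝ (deriv b) ρ ∧
    J ρ * b ρ = deriv (deriv b) ρ + ((n : ℝ) - 1) * (deriv b ρ / ρ - b ρ / ρ ^ 2) +
      (1 + deriv b ρ) *
        (deriv (fun s => Real.log (q s)) ρ - deriv (fun s => Real.log (J s)) ρ)
  at_zero : b 0 = 0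
  deriv_at_r : HasDerivWithinAt b (-1) (Icc 0 r) r

/-- The radial vector field `b(‖θ‖) θ/‖θ‖` (with value `0` at the origin). -/
def radialField {n : ℕ} (b : ℝ → ℝ) (θ : E n) : E n := (b ‖θ‖ / ‖θ‖) • θ

/-- The integrand
`[b² + (1 + b')²/J + ((n-1)/J) (1 + b/ρ)²] q(ρ) ρ^(n-1)`. -/
def radialIntegrand (n : ℕ) (q J b : ℝ → ℝ) (ρ : ℝ) : ℝ :=
  (b ρ ^ 2 + (1 + deriv b ρ) ^ 2 / J ρ + ((n : ℝ) - 1) / J ρ * (1 + b ρ / ρ) ^ 2) *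
    q ρ * ρ ^ (n - 1)

/-- The scalar `(2 π^{n/2}/Γ(n/2)) ∫₀^r [...] q(ρ) ρ^(n-1) dρ`. -/
def radialBound (n : ℕ) (r : ℝ) (q J b : ℝ → ℝ) : ℝ :=
  2 * Real.pi ^ ((n : ℝ) / 2) / Real.Gamma ((n : ℝ) / 2) *
    ∫ ρ in (0 : ℝ)..r, radialIntegrand n q J b ρ

end OptimalBias

end

open OptimalBias

/-!
With `u(ρ) = ρ + b(ρ)`, `P = (q/J) ρ^(n-1)` and `c = (n-1) P/ρ² + q ρ^(n-1)`, the radial boundary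
value problem is the self-adjoint equation `(P u')' = c u - q ρ^n` with `u(0) = 0` and vanishing
flux `P u'` at `r`; it is the Euler–Lagrange equation of `Z` on radial fields. The translation
(`RadialCoefficients.isRadialSolution`, `RadialCoefficients.isFluxSolution`) uses that the flux has
a continuous derivative, although `q` and `J` are only locally absolutely continuous.

*Existence* (`RadialCoefficients.exists_isFluxSolution`). The hypothesis `q t ≤ K q s` near `r`
makes the double integral `∫_ρ^r (∫_s^r c y) / P ds` converge, however `q` behaves at `r`, so that a
Volterra equation solved from `r` yields the line `u₀ + α φ` of all solutions with vanishing flux.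
At the singular endpoint `0`, solutions vanishing at `ε` are bounded, by the maximum principle, and
lie below a barrier comparable to `√ρ`; a limit point of the parameters `α` as `ε → 0` gives the
solution.

*Admissibility* (`RadialCoefficients.memH1_radialField`). Multiplying the equation by `u` bounds the
energy `∫ P u'² + c u²`, and the point singularity of the radial field at the origin does not
contribute to its weak derivative, as the field is continuous there.

*Optimality* (`RadialPrior.integral_energyPairing_eq_zero`). For a competitor `f` with weak Jacobian
`D`, the divergence theorem on balls and on spheres, obtained by testing `D` with `ψ(‖θ‖)` and
`g(‖θ‖) θ_i θ_j`, expresses the spherical means of `D` that enter the first variation through the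
flux of `f` over spheres. By the radial equation the first variation becomes the integral of a
derivative, whose boundary terms vanish because `1/(r - ρ)` and `1/ρ` are not integrable. As `Z` is
a positive quadratic functional, `Z[f] = Z[b] + energy of the difference`
(`RadialPrior.exists_Z_eq_add`), which contains `∫ ‖f - b‖² p_θ`: this gives both minimality and
uniqueness. Polar coordinates identify `Z[b]` with the radial integral.

*The estimation bound* (`IsEstimator.optimalBiasBound_le_bayesMSE`). An estimator with finite
mean-squared error has finite expectation at some, hence by domination at every, parameter. Its bias
may be differentiated under the integral sign and belongs to `H¹`, and Bessel's inequality for the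
scores is the Cramér–Rao inequality at every parameter, so that the error is at least `Z` of the
bias.
-/

namespace OptimalBias

/-! ### Functions on an interval that are bounded up to the right endpoint -/

/-- `h` is continuous on `(0, r)` and bounded on `[s, r)` for every `s ∈ (0, r)`; nothing is
assumed about the behaviour at `0`. -/
structure IsTailBounded (r : ℝ) (h : ℝ → ℝ) : Prop where
  continuousOn : ContinuousOn h (Ioo 0 r)
  bounded : ∀ s ∈ Ioo 0 r, ∃ C, ∀ t ∈ Ico s r, |h t| ≤ C

theorem intervalIntegrable_of_continuousOn_Ioo {h : ℝ → ℝ} {a b C : ℝ} (hab : a ≤ b)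
    (hc : ContinuousOn h (Ioo a b)) (hb : ∀ t ∈ Ioo a b, |h t| ≤ C) :
    IntervalIntegrable h volume a b := by
  rw [intervalIntegrable_iff_integrableOn_Ioo_of_le hab]
  refine ⟨hc.aestronglyMeasurable measurableSet_Ioo, ?_⟩
  refine HasFiniteIntegral.restrict_of_bounded (C := C) measure_Ioo_lt_top ?_
  exact (ae_restrict_mem measurableSet_Ioo).mono fun t ht => hb t ht

namespace IsTailBounded

variable {r : ℝ} {h k : ℝ → ℝ}

theorem mul (hh : IsTailBounded r h) (hk : IsTailBounded r k) :
    IsTailBounded r (fun t => h t * k t) := by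
  refine ⟨hh.continuousOn.mul hk.continuousOn, fun s hs => ?_⟩
  obtain ⟨C, hC⟩ := hh.bounded s hs
  obtain ⟨D, hD⟩ := hk.bounded s hs
  refine ⟨C * D, fun t ht => ?_⟩
  rw [abs_mul]
  exact mul_le_mul (hC t ht) (hD t ht) (abs_nonneg _) ((abs_nonneg _).trans (hC t ht))

theorem add (hh : IsTailBounded r h) (hk : IsTailBounded r k) :
    IsTailBounded r (fun t => h t + k t) := by
  refine ⟨hh.continuousOn.add hk.continuousOn, fun s hs => ?_⟩
  obtain ⟨C, hC⟩ := hh.bounded s hs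
  obtain ⟨D, hD⟩ := hk.bounded s hs
  exact ⟨C + D, fun t ht => (abs_add_le _ _).trans (add_le_add (hC t ht) (hD t ht))⟩

theorem sub (hh : IsTailBounded r h) (hk : IsTailBounded r k) :
    IsTailBounded r (fun t => h t - k t) := by
  refine ⟨hh.continuousOn.sub hk.continuousOn, fun s hs => ?_⟩
  obtain ⟨C, hC⟩ := hh.bounded s hs
  obtain ⟨D, hD⟩ := hk.bounded s hs
  exact ⟨C + D, fun t ht => (abs_sub _ _).trans (add_le_add (hC t ht) (hD t ht))⟩

theorem of_continuousOn_Ioc (hh : ContinuousOn h (Ioc 0 r)) : IsTailBounded r h := by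
  refine ⟨hh.mono Ioo_subset_Ioc_self, fun s hs => ?_⟩
  have hcont : ContinuousOn h (Icc s r) := hh.mono fun t ht => ⟨hs.1.trans_le ht.1, ht.2⟩
  obtain ⟨C, hC⟩ := isCompact_Icc.exists_bound_of_continuousOn hcont
  exact ⟨C, fun t ht => hC t ⟨ht.1, ht.2.le⟩⟩

theorem intervalIntegrable (hh : IsTailBounded r h) {s : ℝ} (hs : s ∈ Ioc 0 r) :
    IntervalIntegrable h volume s r := by
  rcases hs.2.eq_or_lt with rfl | hsr
  · simp
  obtain ⟨C, hC⟩ := hh.bounded s ⟨hs.1, hsr⟩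
  exact intervalIntegrable_of_continuousOn_Ioo hs.2
    (hh.continuousOn.mono fun t ht => ⟨hs.1.trans ht.1, ht.2⟩)
    fun t ht => hC t ⟨ht.1.le, ht.2⟩

theorem intervalIntegrable' (hh : IsTailBounded r h) {s t : ℝ} (hs : s ∈ Ioc 0 r)
    (ht : t ∈ Ioc 0 r) : IntervalIntegrable h volume s t :=
  (hh.intervalIntegrable hs).trans (hh.intervalIntegrable ht).symm

theorem hasDerivAt_integral (hh : IsTailBounded r h) {s : ℝ} (hs : s ∈ Ioo 0 r) :
    HasDerivAt (fun s => ∫ t in s..r, h t) (-h s) s :=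
  intervalIntegral.integral_hasDerivAt_left (hh.intervalIntegrable ⟨hs.1, hs.2.le⟩)
    (hh.continuousOn.stronglyMeasurableAtFilter isOpen_Ioo s hs)
    (hh.continuousOn.continuousAt (isOpen_Ioo.mem_nhds hs))

theorem continuousOn_integral (hh : IsTailBounded r h) :
    ContinuousOn (fun s => ∫ t in s..r, h t) (Ioc 0 r) := by
  intro s hs
  have hs2 : s / 2 ∈ Ioc 0 r := ⟨by linarith [hs.1], by linarith [hs.1, hs.2]⟩
  have hint : IntegrableOn h (uIcc (s / 2) r) := by
    rw [uIcc_of_le hs2.2, integrableOn_Icc_iff_integrableOn_Ioc]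
    exact (intervalIntegrable_iff_integrableOn_Ioc_of_le hs2.2).1 (hh.intervalIntegrable hs2)
  have hcont := intervalIntegral.continuousOn_primitive_interval_left hint
  rw [uIcc_of_le hs2.2] at hcont
  refine (hcont s ⟨by linarith [hs.1], hs.2⟩).mono_of_mem_nhdsWithin ?_
  filter_upwards [self_mem_nhdsWithin,
    nhdsWithin_le_nhds (Ioi_mem_nhds (show s / 2 < s by linarith [hs.1]))] with t ht ht'
  exact ⟨le_of_lt ht', ht.2⟩

theorem integral (hh : IsTailBounded r h) : IsTailBounded r (fun s => ∫ t in s..r, h t) :=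
  of_continuousOn_Ioc hh.continuousOn_integral

theorem tendsto_integral (hh : IsTailBounded r h) (hr : 0 < r) :
    Tendsto (fun s => ∫ t in s..r, h t) (𝓝[<] r) (𝓝 0) := by
  have := (hh.continuousOn_integral r ⟨hr, le_rfl⟩).mono_left
    (nhdsWithin_mono r (Ioo_subset_Ioc_self : Ioo 0 r ⊆ Ioc 0 r))
  simpa [nhdsWithin_Ioo_eq_nhdsLT hr] using this

end IsTailBounded

/-! ### Self-adjoint equations degenerating at both endpoints -/

/-- The coefficients of a self-adjoint equation `(P u')' = c u - f` on `(0, r)`: the flux weight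
`P` and the potential `c` are positive and continuous, and on every `[s₀, r)` the values of `c`
are controlled by the values of `P` further to the left.  The last condition allows `P` to
degenerate at `r`, and makes `r` a regular endpoint for the natural boundary condition. -/
structure IsFluxPair (r : ℝ) (P c : ℝ → ℝ) : Prop where
  pos : 0 < r
  continuousOn_weight : ContinuousOn P (Ioo 0 r)
  weight_pos : ∀ s ∈ Ioo 0 r, 0 < P s
  continuousOn_potential : ContinuousOn c (Ioo 0 r)
  potential_pos : ∀ s ∈ Ioo 0 r, 0 < c s
  potential_le : ∀ s₀ ∈ Ioo 0 r, ∃ C, ∀ s t, s₀ ≤ s → s ≤ t → t < r → c t ≤ C * P s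

/-- The iterated integral `ρ ↦ ∫_ρ^r (∫_s^r c y) / P(s) ds`, which inverts `u ↦ (P u')'` under the
boundary conditions `u(r) = 0` and `(P u')(r) = 0`. -/
noncomputable def fluxIntegral (r : ℝ) (P c y : ℝ → ℝ) (ρ : ℝ) : ℝ :=
  ∫ s in ρ..r, (∫ t in s..r, c t * y t) / P s

namespace IsFluxPair

variable {r : ℝ} {P c : ℝ → ℝ}

theorem isTailBounded_potential (hP : IsFluxPair r P c) : IsTailBounded r c := by
  refine ⟨hP.continuousOn_potential, fun s hs => ?_⟩
  obtain ⟨C, hC⟩ := hP.potential_le s hs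
  refine ⟨C * P s, fun t ht => ?_⟩
  rw [abs_of_pos (hP.potential_pos t ⟨hs.1.trans_le ht.1, ht.2⟩)]
  exact hC s t le_rfl ht.1 ht.2

/-- The flux `∫_s^r c y` is `O((r - s) P(s))` as `s → r`. -/
theorem abs_integral_le (hP : IsFluxPair r P c) {y : ℝ → ℝ} {s₀ B : ℝ} (hs₀ : s₀ ∈ Ioo 0 r)
    (hB : ∀ t ∈ Ico s₀ r, |y t| ≤ B) :
    ∃ C, ∀ s ∈ Ico s₀ r, |∫ t in s..r, c t * y t| ≤ C * (r - s) * P s := by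
  obtain ⟨C, hC⟩ := hP.potential_le s₀ hs₀
  refine ⟨C * B, fun s hs => ?_⟩
  have hb : ∀ t ∈ Ioc s r, t ≠ r → ‖c t * y t‖ ≤ C * P s * B := by
    intro t ht htr
    have htr' := lt_of_le_of_ne ht.2 htr
    have hc := hP.potential_pos t ⟨hs₀.1.trans_le (hs.1.trans ht.1.le), htr'⟩
    rw [Real.norm_eq_abs, abs_mul, abs_of_pos hc]
    have h1 := hC s t hs.1 ht.1.le htr'
    exact mul_le_mul h1 (hB t ⟨hs.1.trans ht.1.le, htr'⟩) (abs_nonneg _) (hc.le.trans h1)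
  have := intervalIntegral.norm_integral_le_of_norm_le_const_ae (a := s) (b := r)
    (f := fun t => c t * y t) (C := C * P s * B) (by
      have h0 : ∀ᵐ t : ℝ, t ≠ r := by simp [ae_iff, measure_singleton]
      filter_upwards [h0] with t ht hts
      rw [uIoc_of_le hs.2.le] at hts
      exact hb t hts ht)
  rw [Real.norm_eq_abs, abs_of_pos (sub_pos.2 hs.2)] at this
  linarith

theorem isTailBounded_flux (hP : IsFluxPair r P c) {y : ℝ → ℝ} (hy : IsTailBounded r y) :
    IsTailBounded r (fun s => (∫ t in s..r, c t * y t) / P s) := by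
  have hcy := hP.isTailBounded_potential.mul hy
  refine ⟨(hcy.integral.continuousOn).div hP.continuousOn_weight
    fun s hs => (hP.weight_pos s hs).ne', fun s hs => ?_⟩
  obtain ⟨B, hB⟩ := hy.bounded s hs
  obtain ⟨C, hC⟩ := hP.abs_integral_le hs hB
  refine ⟨|C| * r, fun t ht => ?_⟩
  have hPt := hP.weight_pos t ⟨hs.1.trans_le ht.1, ht.2⟩
  rw [abs_div, abs_of_pos hPt, div_le_iff₀ hPt]
  refine (hC t ht).trans ?_
  gcongr
  · exact sub_nonneg.2 ht.2.le
  · exact le_abs_self C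
  · linarith [hs.1, ht.1]

theorem isTailBounded_fluxIntegral (hP : IsFluxPair r P c) {y : ℝ → ℝ} (hy : IsTailBounded r y) :
    IsTailBounded r (fluxIntegral r P c y) :=
  (hP.isTailBounded_flux hy).integral

/-- The primitive of `(∫_s^r c) / P(s)` vanishing at `r`. -/
noncomputable def growthExponent (r : ℝ) (P c : ℝ → ℝ) (ρ : ℝ) : ℝ :=
  ∫ s in ρ..r, (∫ t in s..r, c t) / P s

theorem isTailBounded_growthRate (hP : IsFluxPair r P c) :
    IsTailBounded r (fun s => (∫ t in s..r, c t) / P s) := by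
  have := hP.isTailBounded_flux (y := fun _ => 1) (IsTailBounded.of_continuousOn_Ioc (by fun_prop))
  simpa using this

theorem integral_potential_nonneg (hP : IsFluxPair r P c) {s : ℝ} (hs : s ∈ Ioo 0 r) :
    0 ≤ ∫ t in s..r, c t := by
  refine intervalIntegral.integral_nonneg_of_ae_restrict hs.2.le ?_
  rw [← Measure.restrict_congr_set (Ioo_ae_eq_Icc (a := s) (b := r))]
  filter_upwards [ae_restrict_mem measurableSet_Ioo] with t ht
  exact (hP.potential_pos t ⟨hs.1.trans ht.1, ht.2⟩).le

/-- `E = exp(2 Λ)`, with `Λ` the growth exponent, dominates the effect of the iterated integral: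
`fluxIntegral` halves the norm weighted by `E`. -/
theorem abs_fluxIntegral_le (hP : IsFluxPair r P c) {y : ℝ → ℝ} {B : ℝ} (hy : IsTailBounded r y)
    (hB : ∀ t ∈ Ioo 0 r, |y t| ≤ B * Real.exp (2 * growthExponent r P c t)) {ρ : ℝ}
    (hρ : ρ ∈ Ioo 0 r) :
    |fluxIntegral r P c y ρ| ≤ B / 2 * Real.exp (2 * growthExponent r P c ρ) := by
  set m : ℝ → ℝ := fun s => (∫ t in s..r, c t) / P s with hm
  set E : ℝ → ℝ := fun s => Real.exp (2 * growthExponent r P c s) with hE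
  have hmT : IsTailBounded r m := hP.isTailBounded_growthRate
  have hΛd : ∀ s ∈ Ioo 0 r, HasDerivAt (growthExponent r P c) (-m s) s := fun s hs =>
    hmT.hasDerivAt_integral hs
  have hΛc : ContinuousOn (growthExponent r P c) (Ioc 0 r) := hmT.continuousOn_integral
  have hm0 : ∀ s ∈ Ioo 0 r, 0 ≤ m s := fun s hs =>
    div_nonneg (hP.integral_potential_nonneg hs) (hP.weight_pos s hs).le
  have hΛanti : AntitoneOn (growthExponent r P c) (Ioc 0 r) := by
    refine antitoneOn_of_deriv_nonpos (convex_Ioc 0 r) hΛc ?_ ?_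
    · rw [interior_Ioc]
      exact fun s hs => (hΛd s hs).differentiableAt.differentiableWithinAt
    · rw [interior_Ioc]
      intro s hs
      rw [(hΛd s hs).deriv]
      linarith [hm0 s hs]
  have hB0 : 0 ≤ B := by
    have := (abs_nonneg _).trans (hB ρ hρ)
    exact nonneg_of_mul_nonneg_left this (Real.exp_pos _)
  have hEc : ContinuousOn E (Ioc 0 r) := (hΛc.const_mul 2).rexp
  have hcT := hP.isTailBounded_potential
  have hinner : ∀ s ∈ Ioo 0 r, |∫ t in s..r, c t * y t| ≤ B * E s * ∫ t in s..r, c t := by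
    intro s hs
    have h1 : |∫ t in s..r, c t * y t| ≤ ∫ t in s..r, |c t * y t| :=
      intervalIntegral.abs_integral_le_integral_abs hs.2.le
    refine h1.trans ?_
    rw [← intervalIntegral.integral_const_mul]
    refine intervalIntegral.integral_mono_on_of_le_Ioo hs.2.le
      ((hcT.mul hy).intervalIntegrable ⟨hs.1, hs.2.le⟩).abs
      ((hcT.intervalIntegrable ⟨hs.1, hs.2.le⟩).const_mul _) fun t ht => ?_
    have ht' : t ∈ Ioo 0 r := ⟨hs.1.trans ht.1, ht.2⟩
    rw [abs_mul, abs_of_pos (hP.potential_pos t ht'), mul_comm]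
    refine mul_le_mul_of_nonneg_right ((hB t ht').trans ?_) (hP.potential_pos t ht').le
    refine mul_le_mul_of_nonneg_left (Real.exp_le_exp.2 ?_) hB0
    have := hΛanti ⟨hs.1, hs.2.le⟩ ⟨ht'.1, ht'.2.le⟩ ht.1.le
    linarith
  have hET : IsTailBounded r E := IsTailBounded.of_continuousOn_Ioc hEc
  have hmE := hmT.mul hET
  have hFTC : ∫ s in ρ..r, m s * E s = (E ρ - 1) / 2 := by
    have hd : ∀ s ∈ Ioo ρ r, HasDerivAt (fun s => -(E s) / 2) (m s * E s) s := by
      intro s hs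
      have := (((hΛd s ⟨hρ.1.trans hs.1, hs.2⟩).const_mul 2).exp.neg).div_const 2
      refine this.congr_deriv ?_
      simp only [hE]
      ring
    have hco : ContinuousOn (fun s => -(E s) / 2) (Icc ρ r) :=
      ((hEc.mono fun t ht => ⟨hρ.1.trans_le ht.1, ht.2⟩).neg).div_const 2
    rw [intervalIntegral.integral_eq_sub_of_hasDerivAt_of_le hρ.2.le hco hd
      (hmE.intervalIntegrable ⟨hρ.1, hρ.2.le⟩)]
    have : E r = 1 := by simp [hE, growthExponent]
    rw [this]; ring
  have h2 : |fluxIntegral r P c y ρ| ≤ ∫ s in ρ..r, |(∫ t in s..r, c t * y t) / P s| :=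
    intervalIntegral.abs_integral_le_integral_abs hρ.2.le
  have h3 : ∫ s in ρ..r, |(∫ t in s..r, c t * y t) / P s| ≤ ∫ s in ρ..r, B * (m s * E s) := by
    refine intervalIntegral.integral_mono_on_of_le_Ioo hρ.2.le
      ((hP.isTailBounded_flux hy).intervalIntegrable ⟨hρ.1, hρ.2.le⟩).abs
      ((hmE.intervalIntegrable ⟨hρ.1, hρ.2.le⟩).const_mul _) fun s hs => ?_
    have hs' : s ∈ Ioo 0 r := ⟨hρ.1.trans hs.1, hs.2⟩
    have hPs := hP.weight_pos s hs'
    rw [abs_div, abs_of_pos hPs, div_le_iff₀ hPs]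
    refine (hinner s hs').trans (le_of_eq ?_)
    simp only [hm]
    field_simp
  rw [intervalIntegral.integral_const_mul, hFTC] at h3
  have : B * ((E ρ - 1) / 2) ≤ B / 2 * E ρ := by nlinarith
  exact h2.trans (h3.trans this)

theorem fluxIntegral_sub (hP : IsFluxPair r P c) {y z : ℝ → ℝ} (hy : IsTailBounded r y)
    (hz : IsTailBounded r z) {ρ : ℝ} (hρ : ρ ∈ Ioo 0 r) :
    fluxIntegral r P c (fun t => y t - z t) ρ = fluxIntegral r P c y ρ - fluxIntegral r P c z ρ := by
  have hρ' : ρ ∈ Ioc 0 r := ⟨hρ.1, hρ.2.le⟩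
  unfold fluxIntegral
  rw [← intervalIntegral.integral_sub ((hP.isTailBounded_flux hy).intervalIntegrable hρ')
    ((hP.isTailBounded_flux hz).intervalIntegrable hρ')]
  refine intervalIntegral.integral_congr fun s hs => ?_
  rw [uIcc_of_le hρ.2.le] at hs
  have hs' : s ∈ Ioc 0 r := ⟨hρ.1.trans_le hs.1, hs.2⟩
  simp only [mul_sub]
  rw [intervalIntegral.integral_sub
    ((hP.isTailBounded_potential.mul hy).intervalIntegrable hs')
    ((hP.isTailBounded_potential.mul hz).intervalIntegrable hs'), sub_div]

open Classical in
/-- The Volterra equation `y = g + fluxIntegral y` has a solution, by the contraction principle in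
the space of continuous functions weighted by `exp(2 Λ)`. -/
theorem exists_eq_add_fluxIntegral (hP : IsFluxPair r P c) {g : ℝ → ℝ} {B : ℝ}
    (hg : ContinuousOn g (Ioo 0 r))
    (hB : ∀ t ∈ Ioo 0 r, |g t| ≤ B * Real.exp (2 * growthExponent r P c t)) :
    ∃ y, IsTailBounded r y ∧ ∀ ρ ∈ Ioo 0 r, y ρ = g ρ + fluxIntegral r P c y ρ := by
  set E : ℝ → ℝ := fun s => Real.exp (2 * growthExponent r P c s) with hE
  have hΛc : ContinuousOn (growthExponent r P c) (Ioc 0 r) :=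
    hP.isTailBounded_growthRate.continuousOn_integral
  have hEc : ContinuousOn E (Ioc 0 r) := (hΛc.const_mul 2).rexp
  have hET : IsTailBounded r E := IsTailBounded.of_continuousOn_Ioc hEc
  have hE0 : ∀ t, 0 < E t := fun t => Real.exp_pos _
  -- the weighted extension of a bounded continuous function on `(0, r)` to the line
  let ext : BoundedContinuousFunction (Ioo (0 : ℝ) r) ℝ → ℝ → ℝ := fun z t =>
    E t * if h : t ∈ Ioo 0 r then z ⟨t, h⟩ else 0
  have hext : ∀ z (t : Ioo (0 : ℝ) r), ext z t = E t * z t := fun z t => by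
    simp only [ext, dif_pos t.2]
  have hextb : ∀ z, ∀ t ∈ Ioo 0 r, |ext z t| ≤ ‖z‖ * E t := fun z t ht => by
    rw [show t = ((⟨t, ht⟩ : Ioo (0 : ℝ) r) : ℝ) from rfl, hext, abs_mul, abs_of_pos (hE0 _),
      mul_comm]
    exact mul_le_mul_of_nonneg_right (z.norm_coe_le_norm _) (hE0 _).le
  have hextT : ∀ z, IsTailBounded r (ext z) := fun z => by
    refine ⟨?_, fun s hs => ?_⟩
    · rw [continuousOn_iff_continuous_domRestrict]
      have h1 : (Ioo 0 r).domRestrict (ext z) = fun t : Ioo (0 : ℝ) r => E t * z t := funext fun t => hext z t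
      rw [h1]
      exact ((continuousOn_iff_continuous_domRestrict.1 hET.continuousOn)).mul z.continuous
    · obtain ⟨C, hC⟩ := hET.bounded s hs
      refine ⟨‖z‖ * C, fun t ht => (hextb z t ⟨hs.1.trans_le ht.1, ht.2⟩).trans ?_⟩
      exact mul_le_mul_of_nonneg_left ((le_abs_self _).trans (hC t ht)) (norm_nonneg z)
  have hFc : ∀ z, Continuous fun t : Ioo (0 : ℝ) r =>
      (E t)⁻¹ * (g t + fluxIntegral r P c (ext z) t) := fun z => by
    have h1 : ContinuousOn (fun t => (E t)⁻¹ * (g t + fluxIntegral r P c (ext z) t)) (Ioo 0 r) :=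
      (hET.continuousOn.inv₀ fun t _ => (hE0 t).ne').mul
        (hg.add (hP.isTailBounded_fluxIntegral (hextT z)).continuousOn)
    exact continuousOn_iff_continuous_domRestrict.1 h1
  have hFb : ∀ z (t : Ioo (0 : ℝ) r),
      ‖(E t)⁻¹ * (g t + fluxIntegral r P c (ext z) t)‖ ≤ B + ‖z‖ / 2 := fun z t => by
    rw [Real.norm_eq_abs, abs_mul, abs_of_pos (inv_pos.2 (hE0 _)), inv_mul_le_iff₀ (hE0 _)]
    refine (abs_add_le _ _).trans ?_
    have h1 := hB t t.2
    have h2 := hP.abs_fluxIntegral_le (hextT z) (hextb z) t.2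
    simp only [hE] at h1 h2 ⊢
    linarith
  let F : BoundedContinuousFunction (Ioo (0 : ℝ) r) ℝ →
      BoundedContinuousFunction (Ioo (0 : ℝ) r) ℝ := fun z =>
    BoundedContinuousFunction.ofNormedAddCommGroup _ (hFc z) _ (hFb z)
  have hFapp : ∀ z (t : Ioo (0 : ℝ) r),
      F z t = (E t)⁻¹ * (g t + fluxIntegral r P c (ext z) t) := fun z t => rfl
  have hcontr : ContractingWith (1 / 2) F := by
    refine ⟨by norm_num, LipschitzWith.of_dist_le_mul fun z w => ?_⟩
    rw [BoundedContinuousFunction.dist_le (by positivity)]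
    intro t
    have h1 : ext (z - w) = fun t => ext z t - ext w t := by
      funext t
      simp only [ext]
      split_ifs <;> simp [mul_sub]
    have h2 := hP.abs_fluxIntegral_le (hextT (z - w)) (hextb (z - w)) t.2
    rw [h1, hP.fluxIntegral_sub (hextT z) (hextT w) t.2] at h2
    rw [hFapp, hFapp, Real.dist_eq, ← mul_sub, add_sub_add_left_eq_sub, abs_mul,
      abs_of_pos (inv_pos.2 (hE0 _)), inv_mul_le_iff₀ (hE0 _), dist_eq_norm]
    refine h2.trans (le_of_eq ?_)
    simp only [hE, NNReal.coe_div, NNReal.coe_one, NNReal.coe_ofNat]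
    ring
  have : Nonempty (BoundedContinuousFunction (Ioo (0 : ℝ) r) ℝ) := ⟨0⟩
  let z := ContractingWith.fixedPoint F hcontr
  have hz : F z = z := hcontr.fixedPoint_isFixedPt
  refine ⟨ext z, hextT z, fun ρ hρ => ?_⟩
  have h1 := hext z ⟨ρ, hρ⟩
  rw [← hz, hFapp] at h1
  simp only at h1
  rw [hz] at h1
  rw [h1, mul_inv_cancel_left₀ (hE0 ρ).ne']

end IsFluxPair

/-- Comparison principle: a subsolution `d` of a self-adjoint equation with flux `V = P d'` and
positive potential is nonpositive if it is nonpositive at the left endpoint, and either its value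
or its flux is nonpositive at the right endpoint. -/
theorem nonpos_of_flux_deriv_pos {P d V V' : ℝ → ℝ} {a s : ℝ} (hdc : ContinuousOn d (Icc a s))
    (hVc : ContinuousOn V (Ioc a s)) (hP : ∀ x ∈ Ioo a s, 0 < P x)
    (hd : ∀ x ∈ Ioo a s, HasDerivAt d (V x / P x) x) (hV : ∀ x ∈ Ioo a s, HasDerivAt V (V' x) x)
    (hpos : ∀ x ∈ Ioo a s, 0 < d x → 0 < V' x) (ha : d a ≤ 0) (hs : d s ≤ 0 ∨ V s ≤ 0) :
    ∀ x ∈ Icc a s, d x ≤ 0 := by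
  intro x hx
  by_contra! hxpos
  obtain ⟨m, hm, hmax⟩ := isCompact_Icc.exists_isMaxOn ⟨x, hx⟩ hdc
  have hdm : 0 < d m := hxpos.trans_le (hmax hx)
  have ham : a < m := lt_of_le_of_ne hm.1 fun h => by rw [← h] at hdm; linarith
  have hVm : V m ≤ 0 := by
    rcases hm.2.eq_or_lt with rfl | hms
    · rcases hs with h | h
      · linarith
      · exact h
    · have hloc : IsLocalMax d m := hmax.isLocalMax (Icc_mem_nhds ham hms)
      have h0 := hloc.hasDerivAt_eq_zero (hd m ⟨ham, hms⟩)
      have := (div_eq_zero_iff.1 h0).resolve_right (hP m ⟨ham, hms⟩).ne'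
      exact this.le
  -- `d` stays positive on some `[e, m]`, so `V` increases there up to `V m ≤ 0`
  have hev : ∀ᶠ t in 𝓝[Icc a s] m, 0 < d t := (hdc m hm).eventually (lt_mem_nhds hdm)
  obtain ⟨δ, hδ, hball⟩ := Metric.mem_nhdsWithin_iff.1 hev
  obtain ⟨e, he1, he2⟩ := exists_between (show max a (m - δ) < m from max_lt ham (by linarith))
  have hae : a < e := (le_max_left _ _).trans_lt he1
  have hde : ∀ t ∈ Icc e m, 0 < d t := fun t ht => hball ⟨by
    rw [Metric.mem_ball, Real.dist_eq, abs_lt]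
    have := (le_max_right a (m - δ)).trans_lt he1
    constructor <;> linarith [ht.1, ht.2], hae.le.trans ht.1, ht.2.trans hm.2⟩
  have hsub : ∀ t ∈ Ioo e m, t ∈ Ioo a s := fun t ht => ⟨hae.trans ht.1, ht.2.trans_le hm.2⟩
  have hVmono : StrictMonoOn V (Icc e m) := by
    refine strictMonoOn_of_deriv_pos (convex_Icc e m)
      (hVc.mono fun t ht => ⟨hae.trans_le ht.1, ht.2.trans hm.2⟩) fun t ht => ?_
    rw [interior_Icc] at ht
    rw [(hV t (hsub t ht)).deriv]
    exact hpos t (hsub t ht) (hde t ⟨ht.1.le, ht.2.le⟩)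
  have hdanti : StrictAntiOn d (Icc e m) := by
    refine strictAntiOn_of_deriv_neg (convex_Icc e m)
      (hdc.mono fun t ht => ⟨hae.le.trans ht.1, ht.2.trans hm.2⟩) fun t ht => ?_
    rw [interior_Icc] at ht
    rw [(hd t (hsub t ht)).deriv]
    have := hVmono ⟨ht.1.le, ht.2.le⟩ ⟨he2.le, le_rfl⟩ ht.2
    exact div_neg_of_neg_of_pos (by linarith) (hP t (hsub t ht))
  have h1 := hdanti ⟨le_rfl, he2.le⟩ ⟨he2.le, le_rfl⟩ he2
  exact absurd (hmax (show e ∈ Icc a s from ⟨hae.le, he2.le.trans hm.2⟩)) (not_le.2 h1)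

/-- `u` solves `(P u')' = c (u - v)` on `(0, r)` with `u(0) = 0` and vanishing flux `W = P u'`
at `r`. -/
structure IsFluxSolution (r : ℝ) (P c v u W : ℝ → ℝ) : Prop where
  continuousOn : ContinuousOn u (Icc 0 r)
  at_zero : u 0 = 0
  hasDerivAt : ∀ ρ ∈ Ioo 0 r, HasDerivAt u (W ρ / P ρ) ρ
  continuousOn_flux : ContinuousOn W (Ioc 0 r)
  hasDerivAt_flux : ∀ ρ ∈ Ioo 0 r, HasDerivAt W (c ρ * (u ρ - v ρ)) ρ
  flux_at_r : W r = 0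

/-- A solution whose data satisfy `0 ≤ v ≤ M` takes values in `[0, M]`. -/
theorem IsFluxPair.mem_Icc_of_hasDerivAt {r : ℝ} {P c v u W : ℝ → ℝ} (hP : IsFluxPair r P c)
    {a M : ℝ} (ha : a ∈ Ico 0 r) (hM : 0 ≤ M) (hv : ∀ t ∈ Ioo 0 r, v t ∈ Icc 0 M)
    (huc : ContinuousOn u (Icc a r))
    (hWc : ContinuousOn W (Ioc 0 r)) (hu : ∀ ρ ∈ Ioo 0 r, HasDerivAt u (W ρ / P ρ) ρ)
    (hW : ∀ ρ ∈ Ioo 0 r, HasDerivAt W (c ρ * (u ρ - v ρ)) ρ) (hua : u a = 0) (hWr : W r = 0) :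
    ∀ x ∈ Icc a r, u x ∈ Icc 0 M := by
  have hsub : ∀ x ∈ Ioo a r, x ∈ Ioo 0 r := fun x hx => ⟨ha.1.trans_lt hx.1, hx.2⟩
  have hWc' : ContinuousOn W (Ioc a r) := hWc.mono (Ioc_subset_Ioc_left ha.1)
  have h1 := nonpos_of_flux_deriv_pos (P := P) (d := fun x => -u x) (V := fun x => -W x)
    (V' := fun x => -(c x * (u x - v x))) huc.neg hWc'.neg
    (fun x hx => hP.weight_pos x (hsub x hx))
    (fun x hx => ((hu x (hsub x hx)).neg).congr_deriv (by ring))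
    (fun x hx => (hW x (hsub x hx)).neg)
    (fun x hx hpos => by
      have := mul_pos (hP.potential_pos x (hsub x hx))
        (show 0 < v x - u x by linarith [(hv x (hsub x hx)).1])
      linarith)
    (by simp [hua]) (Or.inr (by simp [hWr]))
  have h2 := nonpos_of_flux_deriv_pos (P := P) (d := fun x => u x - M) (V := W)
    (V' := fun x => (c x * (u x - v x))) (huc.sub continuousOn_const) hWc'
    (fun x hx => hP.weight_pos x (hsub x hx))
    (fun x hx => (hu x (hsub x hx)).sub_const M)
    (fun x hx => (hW x (hsub x hx)))
    (fun x hx hpos => mul_pos (hP.potential_pos x (hsub x hx))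
        (by linarith [(hv x (hsub x hx)).2]))
    (by simp [hua, hM]) (Or.inr hWr.le)
  exact fun x hx => ⟨by linarith [h1 x hx], by linarith [h2 x hx]⟩

/-- Near the singular endpoint `0`, a supersolution bounds every solution that lies below it at
the right end of the interval of comparison. -/
theorem IsFluxPair.le_barrier {r : ℝ} {P c v u W U V V' : ℝ → ℝ} (hP : IsFluxPair r P c)
    {a ρ₀ : ℝ} (ha : 0 < a) (hρ₀ : ρ₀ < r)
    (huc : ContinuousOn u (Icc a ρ₀)) (hWc : ContinuousOn W (Ioc 0 r))
    (hu : ∀ ρ ∈ Ioo 0 r, HasDerivAt u (W ρ / P ρ) ρ)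
    (hW : ∀ ρ ∈ Ioo 0 r, HasDerivAt W (c ρ * (u ρ - v ρ)) ρ)
    (hUc : ContinuousOn U (Ioc 0 ρ₀)) (hVc : ContinuousOn V (Ioc 0 ρ₀))
    (hU : ∀ ρ ∈ Ioo 0 ρ₀, HasDerivAt U (V ρ / P ρ) ρ)
    (hV : ∀ ρ ∈ Ioo 0 ρ₀, HasDerivAt V (V' ρ) ρ)
    (hsup : ∀ ρ ∈ Ioo 0 ρ₀, V' ρ ≤ c ρ * (U ρ - v ρ))
    (h0 : u a ≤ U a) (h1 : u ρ₀ ≤ U ρ₀) : ∀ x ∈ Icc a ρ₀, u x ≤ U x := by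
  have hsub : ∀ x ∈ Ioo a ρ₀, x ∈ Ioo 0 ρ₀ := fun x hx => ⟨ha.trans hx.1, hx.2⟩
  have hsub' : ∀ x ∈ Ioo a ρ₀, x ∈ Ioo 0 r := fun x hx => ⟨ha.trans hx.1, hx.2.trans hρ₀⟩
  have := nonpos_of_flux_deriv_pos (P := P) (d := fun x => u x - U x) (V := fun x => W x - V x)
    (V' := fun x => c x * (u x - v x) - V' x) (a := a) (s := ρ₀)
    (huc.sub (hUc.mono fun t ht => ⟨ha.trans_le ht.1, ht.2⟩))
    ((hWc.mono fun t ht => ⟨ha.trans ht.1, ht.2.trans hρ₀.le⟩).sub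
      (hVc.mono fun t ht => ⟨ha.trans ht.1, ht.2⟩))
    (fun x hx => hP.weight_pos x (hsub' x hx))
    (fun x hx => ((hu x (hsub' x hx)).sub (hU x (hsub x hx))).congr_deriv (by ring))
    (fun x hx => (hW x (hsub' x hx)).sub (hV x (hsub x hx)))
    (fun x hx hpos => by
      have := mul_pos (hP.potential_pos x (hsub' x hx)) hpos
      nlinarith [hsup x (hsub x hx)])
    (by linarith) (Or.inl (by linarith))
  exact fun x hx => by linarith [this x hx]

namespace IsFluxPair

variable {r : ℝ} {P c : ℝ → ℝ}

theorem growthExponent_nonneg (hP : IsFluxPair r P c) {ρ : ℝ} (hρ : ρ ∈ Ioo 0 r) :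
    0 ≤ growthExponent r P c ρ := by
  refine intervalIntegral.integral_nonneg_of_ae_restrict hρ.2.le ?_
  rw [← Measure.restrict_congr_set (Ioo_ae_eq_Icc (a := ρ) (b := r))]
  filter_upwards [ae_restrict_mem measurableSet_Ioo] with t ht
  have ht' : t ∈ Ioo 0 r := ⟨hρ.1.trans ht.1, ht.2⟩
  exact div_nonneg (hP.integral_potential_nonneg ht') (hP.weight_pos t ht').le

theorem fluxIntegral_const_mul (a : ℝ) (y : ℝ → ℝ) (ρ : ℝ) :
    fluxIntegral r P c (fun t => a * y t) ρ = a * fluxIntegral r P c y ρ := by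
  unfold fluxIntegral
  rw [← intervalIntegral.integral_const_mul]
  refine intervalIntegral.integral_congr fun s _ => ?_
  simp only [mul_left_comm _ a]
  rw [intervalIntegral.integral_const_mul, mul_div_assoc]

theorem hasDerivAt_fluxIntegral (hP : IsFluxPair r P c) {w : ℝ → ℝ} (hw : IsTailBounded r w)
    (α : ℝ) {ρ : ℝ} (hρ : ρ ∈ Ioo 0 r) :
    HasDerivAt (fun ρ => α + fluxIntegral r P c w ρ) ((-∫ t in ρ..r, c t * w t) / P ρ) ρ := by
  have := ((hP.isTailBounded_flux hw).hasDerivAt_integral hρ).const_add α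
  exact this.congr_deriv (by rw [neg_div])

theorem hasDerivAt_neg_flux (hP : IsFluxPair r P c) {w : ℝ → ℝ} (hw : IsTailBounded r w)
    {ρ : ℝ} (hρ : ρ ∈ Ioo 0 r) :
    HasDerivAt (fun ρ => -∫ t in ρ..r, c t * w t) (c ρ * w ρ) ρ := by
  have := ((hP.isTailBounded_potential.mul hw).hasDerivAt_integral hρ).neg
  exact this.congr_deriv (by rw [neg_neg])

/-- Existence for the boundary value problem with a singular endpoint `0`, given a barrier at `0`.
The solutions with vanishing flux at `r` form a line `u₀ + α φ`; choosing `α` so that the solution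
vanishes at `ε` gives values of `α` in a compact interval, and the barrier passes to a limit point
as `ε → 0`. -/
theorem exists_isFluxSolution (hP : IsFluxPair r P c) {v : ℝ → ℝ} {M : ℝ} (hM : 0 ≤ M)
    (hvc : ContinuousOn v (Ioo 0 r)) (hv : ∀ t ∈ Ioo 0 r, v t ∈ Icc 0 M)
    {ρ₀ : ℝ} (hρ₀ : ρ₀ ∈ Ioo 0 r) {U V V' : ℝ → ℝ}
    (hUc : ContinuousOn U (Ioc 0 ρ₀)) (hVc : ContinuousOn V (Ioc 0 ρ₀))
    (hU : ∀ ρ ∈ Ioo 0 ρ₀, HasDerivAt U (V ρ / P ρ) ρ)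
    (hV : ∀ ρ ∈ Ioo 0 ρ₀, HasDerivAt V (V' ρ) ρ)
    (hsup : ∀ ρ ∈ Ioo 0 ρ₀, V' ρ ≤ c ρ * (U ρ - v ρ))
    (hU0 : ∀ ρ ∈ Ioo 0 ρ₀, 0 ≤ U ρ) (hUM : M ≤ U ρ₀) (hUlim : Tendsto U (𝓝[>] 0) (𝓝 0)) :
    ∃ u W, IsFluxSolution r P c v u W := by
  have hr := hP.pos
  have hvT : IsTailBounded r v := ⟨hvc, fun s hs => ⟨M, fun t ht => by
    have := hv t ⟨hs.1.trans_le ht.1, ht.2⟩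
    rw [abs_of_nonneg this.1]; exact this.2⟩⟩
  have hE1 : ∀ t ∈ Ioo 0 r, 1 ≤ Real.exp (2 * growthExponent r P c t) := fun t ht =>
    Real.one_le_exp (by linarith [hP.growthExponent_nonneg ht])
  -- the homogeneous solution
  obtain ⟨φ, hφT, hφ⟩ := hP.exists_eq_add_fluxIntegral (g := fun _ => 1) (B := 1)
    continuousOn_const fun t ht => by simpa using hE1 t ht
  -- a particular solution
  obtain ⟨y, hyT, hy⟩ := hP.exists_eq_add_fluxIntegral (g := fun t => -fluxIntegral r P c v t)
    (B := M / 2) (hP.isTailBounded_fluxIntegral hvT).continuousOn.neg fun t ht => by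
      rw [abs_neg]
      refine hP.abs_fluxIntegral_le hvT (fun s hs => ?_) ht
      have := hv s hs
      rw [abs_of_nonneg this.1]
      nlinarith [hE1 s hs, this.2]
  let w : ℝ → ℝ → ℝ := fun α t => (y t - v t) - (-α) * φ t
  have hαT : ∀ α : ℝ, IsTailBounded r fun t => (-α) * φ t := fun α =>
    (IsTailBounded.of_continuousOn_Ioc continuousOn_const).mul hφT
  have hwT : ∀ α, IsTailBounded r (w α) := fun α => (hyT.sub hvT).sub (hαT α)
  let u : ℝ → ℝ → ℝ := fun α ρ => α + fluxIntegral r P c (w α) ρ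
  let W : ℝ → ℝ → ℝ := fun α ρ => -∫ t in ρ..r, c t * w α t
  have hu_eq : ∀ α, ∀ ρ ∈ Ioo 0 r, u α ρ = y ρ + α * φ ρ := fun α ρ hρ => by
    simp only [u, w]
    rw [hP.fluxIntegral_sub (hyT.sub hvT) (hαT α) hρ, hP.fluxIntegral_sub hyT hvT hρ,
      fluxIntegral_const_mul, hy ρ hρ, hφ ρ hρ]
    ring
  have huc : ∀ α, ContinuousOn (u α) (Ioc 0 r) := fun α =>
    continuousOn_const.add (hP.isTailBounded_flux (hwT α)).continuousOn_integral
  have hWc : ∀ α, ContinuousOn (W α) (Ioc 0 r) := fun α =>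
    (hP.isTailBounded_potential.mul (hwT α)).continuousOn_integral.neg
  have hud : ∀ α, ∀ ρ ∈ Ioo 0 r, HasDerivAt (u α) (W α ρ / P ρ) ρ := fun α ρ hρ =>
    hP.hasDerivAt_fluxIntegral (hwT α) α hρ
  have hWd : ∀ α, ∀ ρ ∈ Ioo 0 r, HasDerivAt (W α) (c ρ * (u α ρ - v ρ)) ρ := fun α ρ hρ => by
    refine (hP.hasDerivAt_neg_flux (hwT α) hρ).congr_deriv ?_
    rw [hu_eq α ρ hρ]
    simp only [w]
    ring
  have hur : ∀ α, u α r = α := fun α => by simp [u, fluxIntegral]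
  have hWr : ∀ α, W α r = 0 := fun α => by simp [W]
  -- the homogeneous solution is positive, for otherwise comparison gives `φ(r) ≤ 0`
  have hφpos : ∀ ε ∈ Ioo 0 r, 0 < φ ε := by
    intro ε hε
    by_contra! hneg
    have hsub : ∀ x ∈ Ioo ε r, x ∈ Ioo 0 r := fun x hx => ⟨hε.1.trans hx.1, hx.2⟩
    have := nonpos_of_flux_deriv_pos (P := P) (d := fun ρ => 1 + fluxIntegral r P c φ ρ)
      (V := fun ρ => -∫ t in ρ..r, c t * φ t) (V' := fun ρ => c ρ * φ ρ) (a := ε) (s := r)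
      ((continuousOn_const.add (hP.isTailBounded_flux hφT).continuousOn_integral).mono
        fun t ht => ⟨hε.1.trans_le ht.1, ht.2⟩)
      ((hP.isTailBounded_potential.mul hφT).continuousOn_integral.neg.mono
        fun t ht => ⟨hε.1.trans ht.1, ht.2⟩)
      (fun x hx => hP.weight_pos x (hsub x hx))
      (fun x hx => hP.hasDerivAt_fluxIntegral hφT 1 (hsub x hx))
      (fun x hx => hP.hasDerivAt_neg_flux hφT (hsub x hx))
      (fun x hx hpos => by
        rw [← hφ x (hsub x hx)] at hpos
        exact mul_pos (hP.potential_pos x (hsub x hx)) hpos)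
      (by rw [← hφ ε hε]; exact hneg) (Or.inr (by simp)) r ⟨hε.2.le, le_rfl⟩
    simp only [fluxIntegral, intervalIntegral.integral_same] at this
    linarith
  -- solutions vanishing at `ε`
  have hbound : ∀ ε ∈ Ioo 0 ρ₀, ∀ α, α = -y ε / φ ε →
      α ∈ Icc 0 M ∧ ∀ x ∈ Icc ε ρ₀, 0 ≤ u α x ∧ u α x ≤ U x := by
    intro ε hε α hα
    have hεr : ε ∈ Ioo 0 r := ⟨hε.1, hε.2.trans hρ₀.2⟩
    have h0 : u α ε = 0 := by
      rw [hu_eq α ε hεr, hα, div_mul_cancel₀ _ (hφpos ε hεr).ne']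
      ring
    have huc' : ContinuousOn (u α) (Icc ε r) :=
      (huc α).mono fun t ht => ⟨hε.1.trans_le ht.1, ht.2⟩
    have h1 := hP.mem_Icc_of_hasDerivAt ⟨hεr.1.le, hεr.2⟩ hM hv huc' (hWc α) (hud α) (hWd α) h0
      (hWr α)
    refine ⟨?_, fun x hx => ⟨(h1 x ⟨hx.1, hx.2.trans hρ₀.2.le⟩).1, ?_⟩⟩
    · have := h1 r ⟨hεr.2.le, le_rfl⟩
      rwa [hur] at this
    · exact hP.le_barrier hε.1 hρ₀.2 (huc'.mono (Icc_subset_Icc_right hρ₀.2.le)) (hWc α)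
        (hud α) (hWd α) hUc hVc hU hV hsup (by rw [h0]; exact hU0 ε hε)
        ((h1 ρ₀ ⟨hε.2.le, hρ₀.2.le⟩).2.trans hUM) x hx
  let ε : ℕ → ℝ := fun k => ρ₀ / (k + 2)
  have hε : ∀ k, ε k ∈ Ioo 0 ρ₀ := fun k => by
    refine ⟨div_pos hρ₀.1 (by positivity), div_lt_self hρ₀.1 ?_⟩
    have : (0 : ℝ) ≤ k := Nat.cast_nonneg k
    linarith
  have hε0 : Tendsto ε atTop (𝓝 0) :=
    tendsto_const_nhds.div_atTop
      (tendsto_atTop_add_const_right _ _ tendsto_natCast_atTop_atTop)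
  let a : ℕ → ℝ := fun k => -y (ε k) / φ (ε k)
  obtain ⟨α, -, σ, hσ, hα⟩ := isCompact_Icc.tendsto_subseq fun k => (hbound (ε k) (hε k) (a k) rfl).1
  have hlim : ∀ x ∈ Ioo 0 ρ₀, 0 ≤ u α x ∧ u α x ≤ U x := by
    intro x hx
    have hxr : x ∈ Ioo 0 r := ⟨hx.1, hx.2.trans hρ₀.2⟩
    have h1 : Tendsto (fun k => u (a (σ k)) x) atTop (𝓝 (u α x)) := by
      simp only [hu_eq _ x hxr]
      exact (hα.mul_const _).const_add _
    have h2 : ∀ᶠ k in atTop, 0 ≤ u (a (σ k)) x ∧ u (a (σ k)) x ≤ U x := by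
      filter_upwards [(hε0.comp hσ.tendsto_atTop).eventually (gt_mem_nhds hx.1)] with k hk
      exact (hbound (ε (σ k)) (hε _) _ rfl).2 x ⟨hk.le, hx.2.le⟩
    exact ⟨ge_of_tendsto h1 (h2.mono fun k hk => hk.1), le_of_tendsto h1 (h2.mono fun k hk => hk.2)⟩
  have hu0 : Tendsto (u α) (𝓝[>] 0) (𝓝 0) := by
    refine tendsto_of_tendsto_of_tendsto_of_le_of_le' tendsto_const_nhds hUlim ?_ ?_ <;>
    filter_upwards [Ioo_mem_nhdsGT hρ₀.1] with x hx
    exacts [(hlim x hx).1, (hlim x hx).2]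
  let u' : ℝ → ℝ := fun ρ => if ρ ≤ 0 then 0 else u α ρ
  have hu'eq : ∀ ρ, 0 < ρ → u' ρ = u α ρ := fun ρ hρ => if_neg (not_le.2 hρ)
  have hu'nhds : ∀ ρ, 0 < ρ → u' =ᶠ[𝓝 ρ] u α := fun ρ hρ => by
    filter_upwards [lt_mem_nhds hρ] with t ht using hu'eq t ht
  refine ⟨u', W α, ?_, by simp [u'], fun ρ hρ => (hud α ρ hρ).congr_of_eventuallyEq
    (hu'nhds ρ hρ.1), hWc α, fun ρ hρ => by rw [hu'eq ρ hρ.1]; exact hWd α ρ hρ, hWr α⟩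
  intro ρ hρ
  rcases hρ.1.eq_or_lt with rfl | hρ0
  · have h0 : u' 0 = 0 := by simp [u']
    rw [ContinuousWithinAt, h0]
    have h1 : Tendsto u' (𝓝[>] 0) (𝓝 0) :=
      hu0.congr' (by filter_upwards [self_mem_nhdsWithin] with t ht using (hu'eq t ht).symm)
    have h2 : Tendsto u' (𝓝[≥] 0) (𝓝 0) := by
      rw [← Ioi_insert, nhdsWithin_insert]
      refine tendsto_sup.2 ⟨?_, h1⟩
      rw [tendsto_pure_left]
      intro s hs
      rw [h0]
      exact mem_of_mem_nhds hs
    exact h2.mono_left (nhdsWithin_mono _ fun t ht => ht.1)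
  · have h1 : ContinuousWithinAt (u α) (Icc 0 r) ρ :=
      ((huc α) ρ ⟨hρ0, hρ.2⟩).mono_of_mem_nhdsWithin (by
        filter_upwards [self_mem_nhdsWithin, nhdsWithin_le_nhds (Ioi_mem_nhds hρ0)] with t ht ht'
        exact ⟨ht', ht.2⟩)
    exact h1.congr_of_eventuallyEq (nhdsWithin_le_nhds (hu'nhds ρ hρ0)) (hu'eq ρ hρ0)

end IsFluxPair

namespace IsFluxSolution

variable {r : ℝ} {P c v u W : ℝ → ℝ}

theorem isTailBounded_sub (h : IsFluxSolution r P c v u W) (hv : IsTailBounded r v) :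
    IsTailBounded r fun t => u t - v t :=
  (IsTailBounded.of_continuousOn_Ioc (h.continuousOn.mono Ioc_subset_Icc_self)).sub hv

theorem flux_eq (h : IsFluxSolution r P c v u W) (hP : IsFluxPair r P c) (hv : IsTailBounded r v)
    {s : ℝ} (hs : s ∈ Ioc 0 r) : W s = -∫ t in s..r, c t * (u t - v t) := by
  rw [intervalIntegral.integral_eq_sub_of_hasDerivAt_of_le hs.2
    (h.continuousOn_flux.mono fun t ht => ⟨hs.1.trans_le ht.1, ht.2⟩)
    (fun t ht => h.hasDerivAt_flux t ⟨hs.1.trans ht.1, ht.2⟩)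
    ((hP.isTailBounded_potential.mul (h.isTailBounded_sub hv)).intervalIntegrable hs), h.flux_at_r]
  ring

/-- The derivative `u' = W / P` is `O(r - s)` at the right endpoint. -/
theorem abs_flux_le (h : IsFluxSolution r P c v u W) (hP : IsFluxPair r P c)
    (hv : IsTailBounded r v) {s₀ : ℝ} (hs₀ : s₀ ∈ Ioo 0 r) :
    ∃ C, ∀ s ∈ Ico s₀ r, |W s| ≤ C * (r - s) * P s := by
  obtain ⟨B, hB⟩ := (h.isTailBounded_sub hv).bounded s₀ hs₀
  obtain ⟨C, hC⟩ := hP.abs_integral_le hs₀ hB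
  refine ⟨C, fun s hs => ?_⟩
  rw [h.flux_eq hP hv ⟨hs₀.1.trans_le hs.1, hs.2.le⟩, abs_neg]
  exact hC s hs

theorem isTailBounded_deriv (h : IsFluxSolution r P c v u W) (hP : IsFluxPair r P c)
    (hv : IsTailBounded r v) : IsTailBounded r fun s => W s / P s := by
  refine ⟨(h.continuousOn_flux.mono Ioo_subset_Ioc_self).div hP.continuousOn_weight
    fun s hs => (hP.weight_pos s hs).ne', fun s hs => ?_⟩
  obtain ⟨C, hC⟩ := h.abs_flux_le hP hv hs
  refine ⟨|C| * r, fun t ht => ?_⟩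
  have hPt := hP.weight_pos t ⟨hs.1.trans_le ht.1, ht.2⟩
  rw [abs_div, abs_of_pos hPt, div_le_iff₀ hPt]
  refine (hC t ht).trans ?_
  gcongr
  · exact sub_nonneg.2 ht.2.le
  · exact le_abs_self C
  · linarith [hs.1, ht.1]

theorem tendsto_deriv (h : IsFluxSolution r P c v u W) (hP : IsFluxPair r P c)
    (hv : IsTailBounded r v) : Tendsto (fun s => W s / P s) (𝓝[<] r) (𝓝 0) := by
  have hr2 : r / 2 ∈ Ioo 0 r := ⟨half_pos hP.pos, half_lt_self hP.pos⟩
  obtain ⟨C, hC⟩ := h.abs_flux_le hP hv hr2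
  have h1 : Tendsto (fun s => C * (r - s)) (𝓝[<] r) (𝓝 0) := by
    have : Continuous fun s : ℝ => C * (r - s) := by fun_prop
    simpa using (this.tendsto r).mono_left nhdsWithin_le_nhds
  refine squeeze_zero_norm' ?_ h1
  filter_upwards [Ioo_mem_nhdsLT hr2.2] with s hs
  have hPs := hP.weight_pos s ⟨hr2.1.trans hs.1, hs.2⟩
  rw [Real.norm_eq_abs, abs_div, abs_of_pos hPs, div_le_iff₀ hPs]
  exact hC s ⟨hs.1.le, hs.2⟩

theorem hasDerivWithinAt_right (h : IsFluxSolution r P c v u W) (hP : IsFluxPair r P c)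
    (hv : IsTailBounded r v) : HasDerivWithinAt u 0 (Icc 0 r) r := by
  have h1 : HasDerivWithinAt u 0 (Iic r) r := by
    refine hasDerivWithinAt_Iic_of_tendsto_deriv (s := Ioo 0 r)
      (fun t ht => (h.hasDerivAt t ht).differentiableAt.differentiableWithinAt)
      ((h.continuousOn r ⟨hP.pos.le, le_rfl⟩).mono Ioo_subset_Icc_self)
      (Ioo_mem_nhdsLT hP.pos) ((h.tendsto_deriv hP hv).congr' ?_)
    filter_upwards [Ioo_mem_nhdsLT hP.pos] with t ht
    exact (h.hasDerivAt t ht).deriv.symm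
  exact h1.mono fun t ht => ht.2

/-- The energy of a solution is finite.  Multiplying the equation by `u` bounds the energy on
`(ξ, s)` by `u W` at `s` minus `u W` at `ξ`, and the latter is nonnegative for arbitrarily small
`ξ`, since `(u²)' = 2 u W / P` and `u²` is minimal at `0`. -/
theorem integrableOn_energy (h : IsFluxSolution r P c v u W) (hP : IsFluxPair r P c)
    (hv : IsTailBounded r v) {B : ℝ} (hB : ∀ t ∈ Ioo 0 r, |c t * v t| ≤ B) :
    IntegrableOn (fun s => W s ^ 2 / P s + c s * u s ^ 2) (Ioo 0 r) := by
  have hr := hP.pos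
  set s := r / 2 with hsdef
  have hs : s ∈ Ioo 0 r := ⟨half_pos hr, half_lt_self hr⟩
  have huT : IsTailBounded r u :=
    IsTailBounded.of_continuousOn_Ioc (h.continuousOn.mono Ioc_subset_Icc_self)
  have hWT : IsTailBounded r W := IsTailBounded.of_continuousOn_Ioc h.continuousOn_flux
  have heT : IsTailBounded r fun s => W s ^ 2 / P s + c s * u s ^ 2 := by
    convert ((h.isTailBounded_deriv hP hv).mul hWT).add
      ((hP.isTailBounded_potential.mul huT).mul huT) using 2 with t
    ring
  have hcvu : ∃ D, ∀ t ∈ Ioo 0 r, |c t * v t * u t| ≤ D := by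
    obtain ⟨A, hA⟩ := isCompact_Icc.exists_bound_of_continuousOn h.continuousOn
    refine ⟨B * A, fun t ht => ?_⟩
    rw [abs_mul]
    exact mul_le_mul (hB t ht) (hA t ⟨ht.1.le, ht.2.le⟩) (abs_nonneg _)
      ((abs_nonneg _).trans (hB t ht))
  obtain ⟨D, hD⟩ := hcvu
  have hF : ∀ t ∈ Ioo 0 r, HasDerivAt (fun t => u t * W t)
      ((W t ^ 2 / P t + c t * u t ^ 2) - c t * v t * u t) t := fun t ht =>
    ((h.hasDerivAt t ht).mul (h.hasDerivAt_flux t ht)).congr_deriv (by ring)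
  have hξ : ∀ a ∈ Ioo 0 r, ∃ ξ ∈ Ioo 0 a, 0 ≤ u ξ * W ξ := by
    intro a ha
    have hsub : ∀ t ∈ Ioo 0 a, t ∈ Ioo 0 r := fun t ht => ⟨ht.1, ht.2.trans ha.2⟩
    obtain ⟨ξ, hξ, hξe⟩ := exists_hasDerivAt_eq_slope (fun t => u t ^ 2)
      (fun t => 2 * (u t * W t) / P t) ha.1
      ((h.continuousOn.mono (Icc_subset_Icc_right ha.2.le)).pow 2)
      (fun t ht => ((h.hasDerivAt t (hsub t ht)).pow 2).congr_deriv (by push_cast; ring))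
    refine ⟨ξ, hξ, ?_⟩
    have hPξ := hP.weight_pos ξ (hsub ξ hξ)
    rw [h.at_zero] at hξe
    have h1 : 0 ≤ 2 * (u ξ * W ξ) / P ξ := by
      rw [hξe, sub_zero]
      have := ha.1
      simp only [ne_eq, OfNat.ofNat_ne_zero, not_false_eq_true, zero_pow, sub_zero]
      positivity
    have h2 := mul_nonneg h1 hPξ.le
    rw [div_mul_cancel₀ _ hPξ.ne'] at h2
    linarith
  choose! ξ hξmem hξF using hξ
  let a : ℕ → ℝ := fun k => s / (k + 2)
  have ha : ∀ k, a k ∈ Ioo 0 s := fun k => by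
    refine ⟨div_pos hs.1 (by positivity), div_lt_self hs.1 ?_⟩
    have : (0 : ℝ) ≤ k := Nat.cast_nonneg k
    linarith
  have ha' : ∀ k, a k ∈ Ioo 0 r := fun k => ⟨(ha k).1, (ha k).2.trans hs.2⟩
  have ha0 : Tendsto a atTop (𝓝 0) :=
    tendsto_const_nhds.div_atTop
      (tendsto_atTop_add_const_right _ _ tendsto_natCast_atTop_atTop)
  have hξlim : Tendsto (fun k => ξ (a k)) atTop (𝓝 0) :=
    squeeze_zero (fun k => (hξmem _ (ha' k)).1.le) (fun k => (hξmem _ (ha' k)).2.le) ha0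
  have hξs : ∀ k, ξ (a k) ∈ Ioo 0 s := fun k =>
    ⟨(hξmem _ (ha' k)).1, (hξmem _ (ha' k)).2.trans (ha k).2⟩
  have he0 : ∀ t ∈ Ioo 0 r, 0 ≤ W t ^ 2 / P t + c t * u t ^ 2 := fun t ht => by
    have h1 := hP.weight_pos t ht
    have h2 := hP.potential_pos t ht
    positivity
  have hleft : IntegrableOn (fun s => W s ^ 2 / P s + c s * u s ^ 2) (Ioc 0 s) := by
    refine integrableOn_Ioc_of_intervalIntegral_norm_bounded_left (l := atTop)
      (I := u s * W s + D * s) (a := fun k => ξ (a k)) (fun k => ?_) hξlim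
      (Eventually.of_forall fun k => ?_)
    · exact (heT.intervalIntegrable' ⟨(hξs k).1, ((hξs k).2.trans hs.2).le⟩
        ⟨hs.1, hs.2.le⟩).1
    · have hsub : ∀ t ∈ Icc (ξ (a k)) s, t ∈ Ioo 0 r := fun t ht =>
        ⟨(hξs k).1.trans_le ht.1, ht.2.trans_lt hs.2⟩
      have hint : IntervalIntegrable (fun s => W s ^ 2 / P s + c s * u s ^ 2) volume (ξ (a k)) s :=
        heT.intervalIntegrable' ⟨(hξs k).1, ((hξs k).2.trans hs.2).le⟩ ⟨hs.1, hs.2.le⟩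
      have hint2 : IntervalIntegrable (fun t => c t * v t * u t) volume (ξ (a k)) s :=
        ((hP.isTailBounded_potential.mul hv).mul huT).intervalIntegrable'
          ⟨(hξs k).1, ((hξs k).2.trans hs.2).le⟩ ⟨hs.1, hs.2.le⟩
      have h1 : ∫ x in Ioc (ξ (a k)) s, ‖W x ^ 2 / P x + c x * u x ^ 2‖ =
          ∫ x in (ξ (a k))..s, (W x ^ 2 / P x + c x * u x ^ 2) := by
        rw [intervalIntegral.integral_of_le (hξs k).2.le]
        refine setIntegral_congr_fun measurableSet_Ioc fun t ht => ?_
        exact Real.norm_of_nonneg (he0 t (hsub t ⟨ht.1.le, ht.2⟩))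
      have h2 := intervalIntegral.integral_eq_sub_of_hasDerivAt
        (a := ξ (a k)) (b := s) (f := fun t => u t * W t)
        (fun t ht => hF t (hsub t (by rwa [uIcc_of_le (hξs k).2.le] at ht))) (hint.sub hint2)
      rw [intervalIntegral.integral_sub hint hint2] at h2
      have h3 : |∫ t in (ξ (a k))..s, c t * v t * u t| ≤ D * |s - ξ (a k)| := by
        rw [← Real.norm_eq_abs]
        refine intervalIntegral.norm_integral_le_of_norm_le_const fun t ht => ?_
        rw [uIoc_of_le (hξs k).2.le] at ht
        exact hD t (hsub t ⟨ht.1.le, ht.2⟩)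
      have hD0 : 0 ≤ D := (abs_nonneg _).trans (hD s hs)
      have h4 : D * |s - ξ (a k)| ≤ D * s := by
        rw [abs_of_pos (sub_pos.2 (hξs k).2)]
        exact mul_le_mul_of_nonneg_left (by linarith [(hξs k).1]) hD0
      have h5 := hξF _ (ha' k)
      rw [h1]
      linarith [le_abs_self (∫ t in (ξ (a k))..s, c t * v t * u t)]
  have hright := (intervalIntegrable_iff_integrableOn_Ioc_of_le hs.2.le).1
    (heT.intervalIntegrable ⟨hs.1, hs.2.le⟩)
  have := hleft.union hright
  rw [Ioc_union_Ioc_eq_Ioc hs.1.le hs.2.le] at this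
  exact this.mono_set Ioo_subset_Ioc_self

end IsFluxSolution

/-! ### The coefficients of the radial problem -/

/-- The standing assumptions on the radial profiles `q` of the prior and `J` of the Fisher
information. -/
structure RadialCoefficients (n : ℕ) (r : ℝ) (q J : ℝ → ℝ) : Prop where
  one_le : 1 ≤ n
  r_pos : 0 < r
  q_cont : ContinuousOn q (Ico 0 r)
  J_cont : ContinuousOn J (Ico 0 r)
  q_pos : ∀ ρ ∈ Ico 0 r, 0 < q ρ
  J_lower : ∃ c > 0, ∀ ρ ∈ Ico 0 r, c ≤ J ρ
  J_upper : ∃ C, ∀ ρ ∈ Ico 0 r, J ρ ≤ C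
  q_ac : LocallyAC q r
  J_ac : LocallyAC J r
  q_edge : ∃ r₀ ∈ Ioo 0 r, ∃ K : ℝ, ∀ s t, r₀ ≤ s → s ≤ t → t < r → q t ≤ K * q s

/-- The weight `(q / J) ρ^(n-1)` of the derivative in the radial functional. -/
noncomputable def fluxWeight (n : ℕ) (q J : ℝ → ℝ) (ρ : ℝ) : ℝ := q ρ / J ρ * ρ ^ (n - 1)

/-- The coefficient `(n-1) (q / J) ρ^(n-3) + q ρ^(n-1)` of the function itself. -/
noncomputable def potential (n : ℕ) (q J : ℝ → ℝ) (ρ : ℝ) : ℝ :=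
  ((n : ℝ) - 1) * (fluxWeight n q J ρ / ρ ^ 2) + q ρ * ρ ^ (n - 1)

/-- The right-hand side of the equation for `ρ + b(ρ)`, divided by the potential. -/
noncomputable def target (n : ℕ) (q J : ℝ → ℝ) (ρ : ℝ) : ℝ :=
  q ρ * ρ ^ (n - 1) * ρ / potential n q J ρ

namespace RadialCoefficients

variable {n : ℕ} {r : ℝ} {q J : ℝ → ℝ}

theorem J_pos (h : RadialCoefficients n r q J) {ρ : ℝ} (hρ : ρ ∈ Ico 0 r) : 0 < J ρ := by
  obtain ⟨c, hc, hcJ⟩ := h.J_lower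
  exact hc.trans_le (hcJ ρ hρ)

theorem cast_sub_one_nonneg (h : RadialCoefficients n r q J) : 0 ≤ (n : ℝ) - 1 :=
  sub_nonneg.2 (by exact_mod_cast h.one_le)

theorem fluxWeight_pos (h : RadialCoefficients n r q J) {ρ : ℝ} (hρ : ρ ∈ Ioo 0 r) :
    0 < fluxWeight n q J ρ :=
  mul_pos (div_pos (h.q_pos ρ ⟨hρ.1.le, hρ.2⟩) (h.J_pos ⟨hρ.1.le, hρ.2⟩)) (pow_pos hρ.1 _)

theorem potential_pos (h : RadialCoefficients n r q J) {ρ : ℝ} (hρ : ρ ∈ Ioo 0 r) :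
    0 < potential n q J ρ := by
  have h1 := h.fluxWeight_pos hρ
  have h2 := h.q_pos ρ ⟨hρ.1.le, hρ.2⟩
  have h3 := hρ.1
  exact add_pos_of_nonneg_of_pos (mul_nonneg h.cast_sub_one_nonneg (by positivity)) (by positivity)

theorem potential_mul_target (h : RadialCoefficients n r q J) {ρ : ℝ} (hρ : ρ ∈ Ioo 0 r) :
    potential n q J ρ * target n q J ρ = q ρ * ρ ^ (n - 1) * ρ :=
  mul_div_cancel₀ _ (h.potential_pos hρ).ne'

theorem exists_q_le (h : RadialCoefficients n r q J) : ∃ Q > 0, ∀ t ∈ Ico 0 r, q t ≤ Q := by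
  obtain ⟨r₀, hr₀, K, hK⟩ := h.q_edge
  obtain ⟨A, hA⟩ := isCompact_Icc.exists_bound_of_continuousOn
    (h.q_cont.mono fun t (ht : t ∈ Icc 0 r₀) => ⟨ht.1, ht.2.trans_lt hr₀.2⟩)
  refine ⟨max (max A (K * q r₀)) 1, by positivity, fun t ht => ?_⟩
  rcases le_total t r₀ with htr | htr
  · exact ((le_abs_self _).trans (hA t ⟨ht.1, htr⟩)).trans
      ((le_max_left _ _).trans (le_max_left _ _))
  · exact (hK r₀ t le_rfl htr ht.2).trans ((le_max_right _ _).trans (le_max_left _ _))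

/-- The edge condition extends from a neighbourhood of `r` to every `[s₀, r)`. -/
theorem q_edge_of_pos (h : RadialCoefficients n r q J) {s₀ : ℝ} (hs₀ : s₀ ∈ Ioo 0 r) :
    ∃ K > 0, ∀ s t, s₀ ≤ s → s ≤ t → t < r → q t ≤ K * q s := by
  obtain ⟨Q, hQ0, hQ⟩ := h.exists_q_le
  obtain ⟨r₀, hr₀, K, hK⟩ := h.q_edge
  have hcont : ContinuousOn q (Icc s₀ (max s₀ r₀)) :=
    h.q_cont.mono fun t ht => ⟨hs₀.1.le.trans ht.1, ht.2.trans_lt (max_lt hs₀.2 hr₀.2)⟩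
  obtain ⟨m, hm, hmin⟩ := isCompact_Icc.exists_isMinOn (nonempty_Icc.2 (le_max_left s₀ r₀)) hcont
  have hqm : 0 < q m := h.q_pos m ⟨hs₀.1.le.trans hm.1, hm.2.trans_lt (max_lt hs₀.2 hr₀.2)⟩
  refine ⟨max K (Q / q m), lt_max_of_lt_right (div_pos hQ0 hqm), fun s t hs hst ht => ?_⟩
  have hqs : 0 < q s := h.q_pos s ⟨hs₀.1.le.trans hs, hst.trans_lt ht⟩
  rcases le_total s r₀ with hsr | hsr
  · have h1 : q m ≤ q s := hmin (show s ∈ Icc s₀ (max s₀ r₀) from ⟨hs, hsr.trans (le_max_right _ _)⟩)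
    calc q t ≤ Q := hQ t ⟨hs₀.1.le.trans (hs.trans hst), ht⟩
      _ = Q / q m * q m := (div_mul_cancel₀ _ hqm.ne').symm
      _ ≤ Q / q m * q s := by gcongr
      _ ≤ _ := by gcongr; exact le_max_right _ _
  · exact (hK s t hsr hst ht).trans (by gcongr; exact le_max_left _ _)

theorem continuousOn_fluxWeight (h : RadialCoefficients n r q J) :
    ContinuousOn (fluxWeight n q J) (Ico 0 r) :=
  (h.q_cont.div h.J_cont fun _ ht => (h.J_pos ht).ne').mul (continuousOn_id.pow _)

theorem continuousOn_potential (h : RadialCoefficients n r q J) :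
    ContinuousOn (potential n q J) (Ioo 0 r) :=
  (continuousOn_const.mul ((h.continuousOn_fluxWeight.mono Ioo_subset_Ico_self).div
    (continuousOn_id.pow 2) fun _ ht => pow_ne_zero _ ht.1.ne')).add
    ((h.q_cont.mono Ioo_subset_Ico_self).mul (continuousOn_id.pow _))

theorem isFluxPair (h : RadialCoefficients n r q J) :
    IsFluxPair r (fluxWeight n q J) (potential n q J) := by
  refine ⟨h.r_pos, h.continuousOn_fluxWeight.mono Ioo_subset_Ico_self,
    fun _ hs => h.fluxWeight_pos hs, h.continuousOn_potential, fun _ hs => h.potential_pos hs,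
    fun s₀ hs₀ => ?_⟩
  obtain ⟨K, hK0, hK⟩ := h.q_edge_of_pos hs₀
  obtain ⟨jl, hjl, hJl⟩ := h.J_lower
  obtain ⟨ju, hJu⟩ := h.J_upper
  have hs₀0 := hs₀.1
  have hr := h.r_pos
  have hju : 0 < ju := hjl.trans_le ((hJl s₀ ⟨hs₀.1.le, hs₀.2⟩).trans (hJu s₀ ⟨hs₀.1.le, hs₀.2⟩))
  have hn := h.cast_sub_one_nonneg
  set A : ℝ := ((n : ℝ) - 1) * (1 / jl * r ^ (n - 1) / s₀ ^ 2) + r ^ (n - 1) with hA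
  have hA0 : 0 < A := add_pos_of_nonneg_of_pos (mul_nonneg hn (by positivity)) (by positivity)
  refine ⟨A * K * ju / s₀ ^ (n - 1), fun s t hs hst ht => ?_⟩
  have ht0 : 0 < t := hs₀.1.trans_le (hs.trans hst)
  have hs0 : 0 < s := hs₀.1.trans_le hs
  have hqt := h.q_pos t ⟨ht0.le, ht⟩
  have hqs := h.q_pos s ⟨hs0.le, hst.trans_lt ht⟩
  have hJs := h.J_pos (ρ := s) ⟨hs0.le, hst.trans_lt ht⟩
  have h1 : potential n q J t ≤ A * q t := by
    unfold potential fluxWeight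
    have e1 : q t / J t * t ^ (n - 1) / t ^ 2 ≤ q t * (1 / jl * r ^ (n - 1) / s₀ ^ 2) := by
      have : q t / J t * t ^ (n - 1) / t ^ 2 ≤ q t / jl * r ^ (n - 1) / s₀ ^ 2 := by
        have hJt := hJl t ⟨ht0.le, ht⟩
        have := hs.trans hst
        gcongr
      refine this.trans (le_of_eq (by ring))
    have e2 : q t * t ^ (n - 1) ≤ q t * r ^ (n - 1) := by gcongr
    have := mul_le_mul_of_nonneg_left e1 hn
    rw [hA]
    linarith
  have h2 : q s ≤ ju / s₀ ^ (n - 1) * fluxWeight n q J s := by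
    unfold fluxWeight
    have e1 : q s / ju * s₀ ^ (n - 1) ≤ q s / J s * s ^ (n - 1) := by
      have hJs' := hJu s ⟨hs0.le, hst.trans_lt ht⟩
      gcongr
    calc q s = ju / s₀ ^ (n - 1) * (q s / ju * s₀ ^ (n - 1)) := by field_simp
      _ ≤ _ := by gcongr
  calc potential n q J t ≤ A * q t := h1
    _ ≤ A * (K * (ju / s₀ ^ (n - 1) * fluxWeight n q J s)) := by
      gcongr
      exact (hK s t hs hst ht).trans (by gcongr)
    _ = _ := by ring

theorem target_mem_Icc (h : RadialCoefficients n r q J) : ∀ t ∈ Ioo 0 r, target n q J t ∈ Icc 0 r := by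
  intro t ht
  have hc := h.potential_pos ht
  have hq := h.q_pos t ⟨ht.1.le, ht.2⟩
  have ht0 := ht.1
  have hw := h.fluxWeight_pos ht
  have hn := h.cast_sub_one_nonneg
  refine ⟨by unfold target; positivity, ?_⟩
  unfold target
  rw [div_le_iff₀ hc]
  have h1 : q t * t ^ (n - 1) ≤ potential n q J t :=
    le_add_of_nonneg_left (mul_nonneg hn (by positivity))
  have h2 : 0 ≤ q t * t ^ (n - 1) := by positivity
  nlinarith [ht.2]

theorem continuousOn_target (h : RadialCoefficients n r q J) :
    ContinuousOn (target n q J) (Ioo 0 r) :=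
  (((h.q_cont.mono Ioo_subset_Ico_self).mul (continuousOn_id.pow _)).mul continuousOn_id).div
    h.continuousOn_potential fun _ ht => (h.potential_pos ht).ne'

theorem isTailBounded_target (h : RadialCoefficients n r q J) :
    IsTailBounded r (target n q J) :=
  ⟨h.continuousOn_target, fun s hs => ⟨r, fun t ht => by
    have := h.target_mem_Icc t ⟨hs.1.trans_le ht.1, ht.2⟩
    rw [abs_of_nonneg this.1]; exact this.2⟩⟩

theorem exists_potential_mul_target_le (h : RadialCoefficients n r q J) :
    ∃ B, ∀ t ∈ Ioo 0 r, |potential n q J t * target n q J t| ≤ B := by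
  obtain ⟨Q, hQ0, hQ⟩ := h.exists_q_le
  refine ⟨Q * r ^ (n - 1) * r, fun t ht => ?_⟩
  have ht0 := ht.1
  have hq := h.q_pos t ⟨ht.1.le, ht.2⟩
  have hr := h.r_pos
  rw [h.potential_mul_target ht, abs_of_nonneg (by positivity)]
  have h1 := hQ t ⟨ht.1.le, ht.2⟩
  have h2 := ht.2.le
  gcongr

/-- The flux `ρ^(n-1) / (2 √ρ)` of the barrier: it corresponds to a function comparable to
`√ρ`. -/
theorem hasDerivAt_barrier_flux (hn : 1 ≤ n) {ρ : ℝ} (hρ : 0 < ρ) :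
    HasDerivAt (fun t => t ^ (n - 1) * (1 / (2 * √t)))
      ((n - 3 / 2) / 2 * (ρ ^ (n - 1) * √ρ / ρ ^ 2)) ρ := by
  obtain ⟨m, rfl⟩ : ∃ m, n = m + 1 := ⟨n - 1, by omega⟩
  have hs : 0 < √ρ := Real.sqrt_pos.2 hρ
  have hsq : √ρ ^ 2 = ρ := Real.sq_sqrt hρ.le
  have h1 : HasDerivAt (fun t => (2 * √t)⁻¹) (-(2 * (1 / (2 * √ρ))) / (2 * √ρ) ^ 2) ρ :=
    ((Real.hasDerivAt_sqrt hρ.ne').const_mul 2).inv (by positivity)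
  have h2 := (hasDerivAt_pow m ρ).mul h1
  simp only [Nat.add_sub_cancel, one_div]
  refine h2.congr_deriv ?_
  have h3 : (m : ℝ) * ρ ^ (m - 1) = m * ρ ^ m / ρ := by
    rcases m with _ | m
    · simp
    · simp only [Nat.add_sub_cancel, pow_succ]
      field_simp
  rw [h3]
  push_cast
  generalize √ρ = x at hs hsq ⊢
  subst hsq
  field_simp
  ring

/-- The radial boundary value problem, written for `u = ρ + b` and its flux, has a solution. -/
theorem exists_isFluxSolution (h : RadialCoefficients n r q J) :
    ∃ u W, IsFluxSolution r (fluxWeight n q J) (potential n q J) (target n q J) u W := by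
  have hr := h.r_pos
  have hn := h.cast_sub_one_nonneg
  set p : ℝ → ℝ := fun t => q t / J t with hp
  have hpc : ContinuousOn p (Ico 0 r) := h.q_cont.div h.J_cont fun _ ht => (h.J_pos ht).ne'
  have h0mem : (0 : ℝ) ∈ Ico 0 r := ⟨le_rfl, hr⟩
  have hp0 : 0 < p 0 := div_pos (h.q_pos 0 h0mem) (h.J_pos h0mem)
  -- near `0` the quotient `p = q / J` oscillates by at most a factor `2`, so that the barrier
  -- `∫ (√t)' / p dt` is comparable to `√ρ` with constants close enough to make it a supersolution
  obtain ⟨ρ₀, hρ₀, hpρ⟩ : ∃ ρ₀ ∈ Ioo 0 r, ∀ t ∈ Icc 0 ρ₀, 2 / 3 * p 0 < p t ∧ p t < 4 / 3 * p 0 := by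
    have h1 := (hpc 0 h0mem).eventually
      (Ioo_mem_nhds (show 2 / 3 * p 0 < p 0 by linarith) (show p 0 < 4 / 3 * p 0 by linarith))
    obtain ⟨δ, hδ, hball⟩ := Metric.mem_nhdsWithin_iff.1 h1
    refine ⟨min (δ / 2) (r / 2), ⟨by positivity, (min_le_right _ _).trans_lt (half_lt_self hr)⟩,
      fun t ht => hball ⟨?_, ht.1, ?_⟩⟩
    · rw [Metric.mem_ball, Real.dist_eq, sub_zero, abs_of_nonneg ht.1]
      linarith [ht.2.trans (min_le_left _ _)]
    · linarith [ht.2.trans (min_le_right _ _)]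
  have hsρ₀ : 0 < √ρ₀ := Real.sqrt_pos.2 hρ₀.1
  have hsqρ₀ : √ρ₀ * √ρ₀ = ρ₀ := Real.mul_self_sqrt hρ₀.1.le
  have hpc' : ContinuousOn p (Icc 0 ρ₀) := hpc.mono fun t ht => ⟨ht.1, ht.2.trans_lt hρ₀.2⟩
  have hppos : ∀ t ∈ Icc 0 ρ₀, 0 < p t := fun t ht => by linarith [(hpρ t ht).1]
  set k : ℝ → ℝ := fun t => 1 / (2 * √t) with hk
  have hkd : ∀ t, 0 < t → HasDerivAt Real.sqrt (k t) t := fun t ht => Real.hasDerivAt_sqrt ht.ne'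
  have hk0 : ∀ t, 0 ≤ k t := fun t => by simp only [hk]; positivity
  have hkint : IntervalIntegrable k volume 0 ρ₀ := by
    refine intervalIntegral.intervalIntegrable_deriv_of_nonneg (g := Real.sqrt)
      Real.continuous_sqrt.continuousOn (fun t ht => hkd t ?_) fun t _ => hk0 t
    rw [min_eq_left hρ₀.1.le] at ht
    exact ht.1
  have hkpint : IntervalIntegrable (fun t => k t * (p t)⁻¹) volume 0 ρ₀ :=
    hkint.mul_continuousOn (by
      rw [uIcc_of_le hρ₀.1.le]
      exact hpc'.inv₀ fun t ht => (hppos t ht).ne')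
  have hsub : ∀ ρ ∈ Icc 0 ρ₀, uIcc 0 ρ ⊆ uIcc 0 ρ₀ := fun ρ hρ => by
    rw [uIcc_of_le hρ.1, uIcc_of_le hρ₀.1.le]
    exact Icc_subset_Icc_right hρ.2
  have hksqrt : ∀ ρ ∈ Icc 0 ρ₀, ∫ t in 0..ρ, k t = √ρ := fun ρ hρ => by
    rw [intervalIntegral.integral_eq_sub_of_hasDerivAt_of_le hρ.1 Real.continuous_sqrt.continuousOn
      (fun t ht => hkd t ht.1) (hkint.mono_set (hsub ρ hρ))]
    simp
  set G : ℝ → ℝ := fun ρ => ∫ t in 0..ρ, k t * (p t)⁻¹ with hG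
  have hGle : ∀ ρ ∈ Icc 0 ρ₀, G ρ ≤ 3 / (2 * p 0) * √ρ := fun ρ hρ => by
    rw [← hksqrt ρ hρ, ← intervalIntegral.integral_const_mul]
    refine intervalIntegral.integral_mono_on hρ.1 (hkpint.mono_set (hsub ρ hρ))
      ((hkint.mono_set (hsub ρ hρ)).const_mul _) fun t ht => ?_
    have ht' : t ∈ Icc 0 ρ₀ := ⟨ht.1, ht.2.trans hρ.2⟩
    rw [mul_comm]
    refine mul_le_mul_of_nonneg_right ?_ (hk0 t)
    rw [inv_le_comm₀ (hppos t ht') (by positivity), inv_div]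
    linarith [(hpρ t ht').1]
  have hleG : ∀ ρ ∈ Icc 0 ρ₀, 3 / (4 * p 0) * √ρ ≤ G ρ := fun ρ hρ => by
    rw [← hksqrt ρ hρ, ← intervalIntegral.integral_const_mul]
    refine intervalIntegral.integral_mono_on hρ.1 ((hkint.mono_set (hsub ρ hρ)).const_mul _)
      (hkpint.mono_set (hsub ρ hρ)) fun t ht => ?_
    have ht' : t ∈ Icc 0 ρ₀ := ⟨ht.1, ht.2.trans hρ.2⟩
    rw [mul_comm (k t)]
    refine mul_le_mul_of_nonneg_right ?_ (hk0 t)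
    rw [le_inv_comm₀ (by positivity) (hppos t ht'), inv_div]
    linarith [(hpρ t ht').2]
  have hGd : ∀ ρ ∈ Ioo 0 ρ₀, HasDerivAt G (k ρ * (p ρ)⁻¹) ρ := fun ρ hρ => by
    have hcont : ContinuousOn (fun t => k t * (p t)⁻¹) (Ioo 0 ρ₀) := by
      refine ContinuousOn.mul ?_ ((hpc'.mono Ioo_subset_Icc_self).inv₀ fun t ht =>
        (hppos t (Ioo_subset_Icc_self ht)).ne')
      exact continuousOn_const.div (continuousOn_const.mul Real.continuous_sqrt.continuousOn)
        fun t ht => by have := Real.sqrt_pos.2 ht.1; positivity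
    exact intervalIntegral.integral_hasDerivAt_right
      (hkpint.mono_set (hsub ρ (Ioo_subset_Icc_self hρ)))
      (hcont.stronglyMeasurableAtFilter isOpen_Ioo ρ hρ)
      (hcont.continuousAt (isOpen_Ioo.mem_nhds hρ))
  have hGc : ContinuousOn G (Icc 0 ρ₀) := by
    have := intervalIntegral.continuousOn_primitive_interval
      (μ := volume) (f := fun t => k t * (p t)⁻¹) (a := 0) (b := ρ₀) (by
        rw [uIcc_of_le hρ₀.1.le, integrableOn_Icc_iff_integrableOn_Ioc]
        exact (intervalIntegrable_iff_integrableOn_Ioc_of_le hρ₀.1.le).1 hkpint)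
    rwa [uIcc_of_le hρ₀.1.le] at this
  -- the scaling that makes the barrier at least `r` at `ρ₀`
  set A : ℝ := 4 * p 0 / 3 * (r / √ρ₀) with hA
  have hA0 : 0 < A := by positivity
  have hAG : ∀ ρ ∈ Icc 0 ρ₀, r / √ρ₀ * √ρ ≤ A * G ρ := fun ρ hρ => by
    have := mul_le_mul_of_nonneg_left (hleG ρ hρ) hA0.le
    refine le_trans (le_of_eq ?_) this
    rw [hA]
    field_simp
  refine h.isFluxPair.exists_isFluxSolution hr.le h.continuousOn_target h.target_mem_Icc hρ₀
    (U := fun ρ => A * G ρ) (V := fun ρ => A * (ρ ^ (n - 1) * k ρ))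
    (V' := fun ρ => A * ((n - 3 / 2) / 2 * (ρ ^ (n - 1) * √ρ / ρ ^ 2)))
    ((hGc.mono Ioc_subset_Icc_self).const_mul _) ?_ ?_ ?_ ?_ ?_ ?_ ?_
  · intro ρ hρ
    exact ((hasDerivAt_barrier_flux h.one_le hρ.1).const_mul A).continuousAt.continuousWithinAt
  · intro ρ hρ
    refine ((hGd ρ hρ).const_mul A).congr_deriv ?_
    have hρ0 := hρ.1
    simp only [fluxWeight]
    change A * (k ρ * (p ρ)⁻¹) = A * (ρ ^ (n - 1) * k ρ) / (p ρ * ρ ^ (n - 1))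
    have := hppos ρ (Ioo_subset_Icc_self hρ)
    field_simp
  · intro ρ hρ
    exact (hasDerivAt_barrier_flux h.one_le hρ.1).const_mul A
  · intro ρ hρ
    have hρr : ρ ∈ Ioo 0 r := ⟨hρ.1, hρ.2.trans hρ₀.2⟩
    have hρI := Ioo_subset_Icc_self hρ
    have hρ0 := hρ.1
    have hq := h.q_pos ρ ⟨hρr.1.le, hρr.2⟩
    have hsρ : 0 < √ρ := Real.sqrt_pos.2 hρ0
    have hsq : √ρ * √ρ = ρ := Real.mul_self_sqrt hρ0.le
    rw [mul_sub, h.potential_mul_target hρr]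
    have h1 : ρ ≤ A * G ρ := by
      refine le_trans ?_ (hAG ρ hρI)
      rw [div_mul_eq_mul_div, le_div_iff₀ hsρ₀]
      have h2 : √ρ ≤ √ρ₀ := Real.sqrt_le_sqrt hρ.2.le
      calc ρ * √ρ₀ = √ρ * (√ρ * √ρ₀) := by rw [← mul_assoc, hsq]
        _ ≤ √ρ * (√ρ₀ * √ρ₀) := by gcongr
        _ = √ρ * ρ₀ := by rw [hsqρ₀]
        _ ≤ √ρ * r := by gcongr; exact hρ₀.2.le
        _ = r * √ρ := mul_comm _ _
    have h2 : q ρ * ρ ^ (n - 1) * ρ ≤ q ρ * ρ ^ (n - 1) * (A * G ρ) := by gcongr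
    have h3 : A * (1 / 2 * (√ρ * (ρ ^ (n - 1) / ρ ^ 2))) ≤ fluxWeight n q J ρ / ρ ^ 2 * (A * G ρ) := by
      have e1 : 2 / 3 * p 0 * (3 / (4 * p 0) * √ρ) ≤ p ρ * G ρ :=
        mul_le_mul (hpρ ρ hρI).1.le (hleG ρ hρI) (by positivity) (hppos ρ hρI).le
      have e2 : 2 / 3 * p 0 * (3 / (4 * p 0) * √ρ) = 1 / 2 * √ρ := by field_simp; norm_num
      rw [e2] at e1
      calc A * (1 / 2 * (√ρ * (ρ ^ (n - 1) / ρ ^ 2))) = A * (ρ ^ (n - 1) / ρ ^ 2) * (1 / 2 * √ρ) := by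
            ring
        _ ≤ A * (ρ ^ (n - 1) / ρ ^ 2) * (p ρ * G ρ) := by gcongr
        _ = _ := by simp only [fluxWeight, hp]; ring
    have h4 := mul_le_mul_of_nonneg_left h3 hn
    have h5 : A * ((n - 3 / 2) / 2 * (ρ ^ (n - 1) * √ρ / ρ ^ 2)) ≤
        ((n : ℝ) - 1) * (A * (1 / 2 * (√ρ * (ρ ^ (n - 1) / ρ ^ 2)))) := by
      have : 0 ≤ A * (√ρ * (ρ ^ (n - 1) / ρ ^ 2)) := by positivity
      have e : ρ ^ (n - 1) * √ρ / ρ ^ 2 = √ρ * (ρ ^ (n - 1) / ρ ^ 2) := by ring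
      rw [e]
      nlinarith
    unfold potential
    linarith
  · intro ρ hρ
    have := hAG ρ (Ioo_subset_Icc_self hρ)
    exact le_trans (by positivity) this
  · have := hAG ρ₀ ⟨hρ₀.1.le, le_rfl⟩
    rwa [div_mul_cancel₀ _ hsρ₀.ne'] at this
  · have h1 := (hGc 0 ⟨le_rfl, hρ₀.1.le⟩).const_mul A
    have h2 : A * G 0 = 0 := by simp [hG]
    rw [ContinuousWithinAt, h2] at h1
    refine h1.mono_left ?_
    rw [← nhdsWithin_Ioo_eq_nhdsGT hρ₀.1]
    exact nhdsWithin_mono _ Ioo_subset_Icc_self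

end RadialCoefficients

/-! ### Locally absolutely continuous functions -/

theorem absolutelyContinuousOnInterval_of_dist_le {f g : ℝ → ℝ} {a b K : ℝ}
    (hf : AbsolutelyContinuousOnInterval f a b)
    (h : ∀ x ∈ uIcc a b, ∀ y ∈ uIcc a b, dist (g x) (g y) ≤ K * dist (f x) (f y)) :
    AbsolutelyContinuousOnInterval g a b := by
  rw [absolutelyContinuousOnInterval_iff] at hf ⊢
  intro ε hε
  obtain ⟨δ, hδ, hfδ⟩ := hf (ε / (|K| + 1)) (by positivity)
  refine ⟨δ, hδ, fun E hE hEδ => ?_⟩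
  calc ∑ i ∈ Finset.range E.1, dist (g (E.2 i).1) (g (E.2 i).2)
      ≤ ∑ i ∈ Finset.range E.1, (|K| + 1) * dist (f (E.2 i).1) (f (E.2 i).2) := by
        refine Finset.sum_le_sum fun i hi => (h _ (hE.1 i hi).1 _ (hE.1 i hi).2).trans ?_
        gcongr
        linarith [le_abs_self K]
    _ = (|K| + 1) * ∑ i ∈ Finset.range E.1, dist (f (E.2 i).1) (f (E.2 i).2) := by
        rw [Finset.mul_sum]
    _ < (|K| + 1) * (ε / (|K| + 1)) := by
        have := hfδ E hE hEδ
        gcongr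
    _ = ε := by field_simp

namespace LocallyAC

variable {r : ℝ} {f g : ℝ → ℝ}

theorem congr (hf : LocallyAC f r) (h : ∀ t ∈ Ioo 0 r, g t = f t) : LocallyAC g r := by
  intro s t hs hst ht
  refine absolutelyContinuousOnInterval_of_dist_le (K := 1) (hf s t hs hst ht) fun x hx y hy => ?_
  rw [uIcc_of_le hst] at hx hy
  rw [h x ⟨hs.trans_le hx.1, hx.2.trans_lt ht⟩, h y ⟨hs.trans_le hy.1, hy.2.trans_lt ht⟩, one_mul]

theorem mul (hf : LocallyAC f r) (hg : LocallyAC g r) : LocallyAC (fun t => f t * g t) r :=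
  fun s t hs hst ht => (hf s t hs hst ht).fun_mul (hg s t hs hst ht)

theorem add (hf : LocallyAC f r) (hg : LocallyAC g r) : LocallyAC (fun t => f t + g t) r :=
  fun s t hs hst ht => (hf s t hs hst ht).fun_add (hg s t hs hst ht)

theorem inv (hf : LocallyAC f r) (hpos : ∀ t ∈ Ioo 0 r, 0 < f t) :
    LocallyAC (fun t => (f t)⁻¹) r := by
  intro s t hs hst ht
  have hac := hf s t hs hst ht
  have hsub : ∀ x ∈ uIcc s t, x ∈ Ioo 0 r := fun x hx => by
    rw [uIcc_of_le hst] at hx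
    exact ⟨hs.trans_le hx.1, hx.2.trans_lt ht⟩
  obtain ⟨m, hm, hmin⟩ := isCompact_uIcc.exists_isMinOn nonempty_uIcc hac.continuousOn
  have hfm := hpos m (hsub m hm)
  refine absolutelyContinuousOnInterval_of_dist_le (K := (f m * f m)⁻¹) hac fun x hx y hy => ?_
  have hfx := hpos x (hsub x hx)
  have hfy := hpos y (hsub y hy)
  rw [Real.dist_eq, Real.dist_eq, inv_sub_inv hfx.ne' hfy.ne', abs_div, abs_sub_comm,
    abs_of_pos (mul_pos hfx hfy), div_eq_inv_mul]
  gcongr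
  · exact hmin hx
  · exact hmin hy

theorem of_hasDerivAt {f' : ℝ → ℝ} (hf : ∀ t ∈ Ioo 0 r, HasDerivAt f (f' t) t)
    (hc : ContinuousOn f' (Ioo 0 r)) : LocallyAC f r := by
  intro s t hs hst ht
  have hsub : uIcc s t ⊆ Ioo 0 r := fun x hx => by
    rw [uIcc_of_le hst] at hx
    exact ⟨hs.trans_le hx.1, hx.2.trans_lt ht⟩
  obtain ⟨C, hC⟩ := isCompact_uIcc.exists_bound_of_continuousOn (hc.mono hsub)
  have hC0 : 0 ≤ C := (norm_nonneg _).trans (hC s left_mem_uIcc)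
  refine LipschitzOnWith.absolutelyContinuousOnInterval (K := ⟨C, hC0⟩) ?_
  refine (convex_uIcc s t).lipschitzOnWith_of_nnnorm_hasDerivWithin_le (f' := f')
    (fun x hx => (hf x (hsub hx)).hasDerivWithinAt) fun x hx => ?_
  exact hC x hx

theorem continuousOn (hf : LocallyAC f r) : ContinuousOn f (Ioo 0 r) := by
  intro x hx
  obtain ⟨s, hs⟩ := exists_between hx.1
  obtain ⟨t, ht⟩ := exists_between hx.2
  have h := (hf s t hs.1 (hs.2.trans ht.1).le ht.2).continuousOn
  rw [uIcc_of_le (hs.2.trans ht.1).le] at h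
  exact ((h x ⟨hs.2.le, ht.1.le⟩).continuousAt (Icc_mem_nhds hs.2 ht.1)).continuousWithinAt

theorem ae_differentiableAt (hf : LocallyAC f r) :
    ∀ᵐ x, x ∈ Ioo 0 r → DifferentiableAt ℝ f x := by
  have h : ∀ k : ℕ, ∀ᵐ x, x ∈ Icc (r / (k + 3)) (r - r / (k + 3)) → 0 < r →
      DifferentiableAt ℝ f x := by
    intro k
    by_cases hr : 0 < r
    · have h1 : r / (k + 3) ≤ r - r / (k + 3) := by
        have : r / (k + 3) ≤ r / 2 := by
          have : (2 : ℝ) ≤ k + 3 := by linarith [(Nat.cast_nonneg k : (0 : ℝ) ≤ k)]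
          gcongr
        linarith
      have h2 : 0 < r / ((k : ℝ) + 3) := by positivity
      filter_upwards [(hf _ _ h2 h1 (by linarith)).ae_differentiableAt] with x hx hx'
      rw [uIcc_of_le h1] at hx
      exact fun _ => hx hx'
    · exact Eventually.of_forall fun x _ h => absurd h hr
  filter_upwards [ae_all_iff.2 h] with x hx hxr
  have hr : 0 < r := hxr.1.trans hxr.2
  have hlim : Tendsto (fun k : ℕ => r / ((k : ℝ) + 3)) atTop (𝓝 0) :=
    tendsto_const_nhds.div_atTop
      (tendsto_atTop_add_const_right _ _ tendsto_natCast_atTop_atTop)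
  obtain ⟨k, hk⟩ := (hlim.eventually
    (gt_mem_nhds (lt_min hxr.1 (sub_pos.2 hxr.2)))).exists
  refine hx k ⟨(hk.trans_le (min_le_left _ _)).le, ?_⟩ hr
  linarith [hk.trans_le (min_le_right _ _)]

/-- A locally absolutely continuous function with an almost everywhere continuous derivative is
continuously differentiable. -/
theorem hasDerivAt_of_ae (hf : LocallyAC f r) (hg : ContinuousOn g (Ioo 0 r))
    (h : ∀ᵐ x, x ∈ Ioo 0 r → deriv f x = g x) : ∀ x ∈ Ioo 0 r, HasDerivAt f (g x) x := by
  intro x hx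
  obtain ⟨s, hs⟩ := exists_between hx.1
  have hint : ∀ t ∈ Ioo 0 r, IntervalIntegrable g volume s t := fun t ht =>
    (hg.mono fun y hy => by
      rcases le_total s t with hst | hst
      · rw [uIcc_of_le hst] at hy
        exact ⟨hs.1.trans_le hy.1, hy.2.trans_lt ht.2⟩
      · rw [uIcc_of_ge hst] at hy
        exact ⟨ht.1.trans_le hy.1, hy.2.trans_lt (hs.2.trans hx.2)⟩).intervalIntegrable
  have hFTC : ∀ t ∈ Ioo s r, f t = f s + ∫ y in s..t, g y := by
    intro t ht
    rw [← sub_eq_iff_eq_add', ← (hf s t hs.1 ht.1.le ht.2).integral_deriv_eq_sub]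
    refine intervalIntegral.integral_congr_ae ?_
    filter_upwards [h] with y hy hys
    rw [uIoc_of_le ht.1.le] at hys
    exact hy ⟨hs.1.trans hys.1, hys.2.trans_lt ht.2⟩
  have hd : HasDerivAt (fun t => f s + ∫ y in s..t, g y) (g x) x :=
    (intervalIntegral.integral_hasDerivAt_right (hint x hx)
      (hg.stronglyMeasurableAtFilter isOpen_Ioo x hx)
      (hg.continuousAt (isOpen_Ioo.mem_nhds hx))).const_add _
  refine hd.congr_of_eventuallyEq ?_
  filter_upwards [Ioo_mem_nhds hs.2 hx.2] with t ht using hFTC t ht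

end LocallyAC

/-! ### The radial boundary value problem in self-adjoint form -/

/-- The derivative of `q / J ρ^(n-1) (1 + b')`, when `b'` has derivative `b₂`. -/
theorem hasDerivAt_fluxWeight_mul {n : ℕ} {q J y : ℝ → ℝ} {ρ q' J' y' : ℝ} (hn : 1 ≤ n)
    (hρ : 0 < ρ) (hJρ : 0 < J ρ) (hq : HasDerivAt q q' ρ)
    (hJ : HasDerivAt J J' ρ) (hy : HasDerivAt y y' ρ) (hqρ : 0 < q ρ) :
    HasDerivAt (fun t => fluxWeight n q J t * y t)
      (fluxWeight n q J ρ * (y' + ((n : ℝ) - 1) / ρ * y ρ +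
        y ρ * (deriv (fun s => Real.log (q s)) ρ - deriv (fun s => Real.log (J s)) ρ))) ρ := by
  obtain ⟨m, rfl⟩ : ∃ m, n = m + 1 := ⟨n - 1, by omega⟩
  rw [(hq.log hqρ.ne').deriv, (hJ.log hJρ.ne').deriv]
  have h1 := (((hq.div hJ hJρ.ne').mul (hasDerivAt_pow m ρ)).mul hy)
  have h3 : (m : ℝ) * ρ ^ (m - 1) = m * ρ ^ m / ρ := by
    rcases m with _ | m
    · simp
    · simp only [Nat.add_sub_cancel, pow_succ]
      field_simp
  refine h1.congr_deriv ?_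
  simp only [fluxWeight, Nat.add_sub_cancel, Pi.mul_apply, Pi.div_apply, h3]
  push_cast
  field_simp
  ring

namespace RadialCoefficients

variable {n : ℕ} {r : ℝ} {q J : ℝ → ℝ}

theorem locallyAC_fluxWeight (h : RadialCoefficients n r q J) :
    LocallyAC (fluxWeight n q J) r := by
  have hpow : LocallyAC (fun t => t ^ (n - 1)) r :=
    LocallyAC.of_hasDerivAt (fun t _ => hasDerivAt_pow (n - 1) t) (by fun_prop)
  exact ((h.q_ac.mul (h.J_ac.inv fun t ht => h.J_pos ⟨ht.1.le, ht.2⟩)).mul hpow).congr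
    fun t _ => by rw [fluxWeight, div_eq_mul_inv]

/-- A solution in self-adjoint form yields a solution of the radial boundary value problem. -/
theorem isRadialSolution (h : RadialCoefficients n r q J) {u W : ℝ → ℝ}
    (hu : IsFluxSolution r (fluxWeight n q J) (potential n q J) (target n q J) u W) :
    IsRadialSolution n r q J fun ρ => u ρ - ρ := by
  have hd : ∀ ρ ∈ Ioo 0 r, HasDerivAt (fun ρ => u ρ - ρ) (W ρ / fluxWeight n q J ρ - 1) ρ :=
    fun ρ hρ => (hu.hasDerivAt ρ hρ).sub (hasDerivAt_id ρ)
  have hW : LocallyAC W r := LocallyAC.of_hasDerivAt hu.hasDerivAt_flux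
    (h.continuousOn_potential.mul ((hu.continuousOn.mono Ioo_subset_Icc_self).sub
      h.continuousOn_target))
  have hac : LocallyAC (fun ρ => W ρ * (fluxWeight n q J ρ)⁻¹ + -1) r :=
    (hW.mul (h.locallyAC_fluxWeight.inv fun t ht => h.fluxWeight_pos ht)).add
      (LocallyAC.of_hasDerivAt (f' := fun _ => 0) (fun t _ => hasDerivAt_const t _)
        continuousOn_const)
  refine ⟨hu.continuousOn.sub continuousOn_id,
    fun ρ hρ => (hd ρ hρ).differentiableAt.differentiableWithinAt,
    hac.congr fun t ht => by rw [(hd t ht).deriv, div_eq_mul_inv, sub_eq_add_neg], ?_,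
    by simp [hu.at_zero], ?_⟩
  · intro ρ hρ hqd hJd
    have hPρ := h.fluxWeight_pos hρ
    have hρ0 := hρ.1
    have hqρ := h.q_pos ρ ⟨hρ.1.le, hρ.2⟩
    have hJρ := h.J_pos (ρ := ρ) ⟨hρ.1.le, hρ.2⟩
    have hev : deriv (fun ρ => u ρ - ρ) =ᶠ[𝓝 ρ] fun t => W t / fluxWeight n q J t - 1 := by
      filter_upwards [isOpen_Ioo.mem_nhds hρ] with t ht using (hd t ht).deriv
    have hPd : DifferentiableAt ℝ (fluxWeight n q J) ρ :=
      (hqd.div hJd hJρ.ne').mul (differentiableAt_id.pow _)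
    have hdd : DifferentiableAt ℝ (deriv fun ρ => u ρ - ρ) ρ :=
      (((hu.hasDerivAt_flux ρ hρ).differentiableAt.div hPd hPρ.ne').sub_const 1).congr_of_eventuallyEq
        hev
    refine ⟨hdd, ?_⟩
    -- compare the derivative of `W = P (1 + b')` computed in two ways
    have h1 := hasDerivAt_fluxWeight_mul h.one_le hρ0 hJρ hqd.hasDerivAt hJd.hasDerivAt
      (hdd.hasDerivAt.const_add 1) hqρ
    have hW' : W =ᶠ[𝓝 ρ] fun t => fluxWeight n q J t * (1 + deriv (fun ρ => u ρ - ρ) t) := by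
      filter_upwards [isOpen_Ioo.mem_nhds hρ] with t ht
      have := h.fluxWeight_pos ht
      rw [(hd t ht).deriv]
      field_simp
      ring
    have h2 := (h1.congr_of_eventuallyEq hW').unique (hu.hasDerivAt_flux ρ hρ)
    rw [mul_sub (potential n q J ρ), h.potential_mul_target hρ] at h2
    have hpq : q ρ * ρ ^ (n - 1) = J ρ * fluxWeight n q J ρ := by
      simp only [fluxWeight]; field_simp
    rw [potential, hpq] at h2
    generalize deriv (fun s => Real.log (q s)) ρ - deriv (fun s => Real.log (J s)) ρ = L at h2 ⊢
    generalize deriv (deriv fun ρ => u ρ - ρ) ρ = b2 at h2 ⊢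
    generalize deriv (fun ρ => u ρ - ρ) ρ = b1 at h2 ⊢
    have h3 : fluxWeight n q J ρ * (b2 + ((n : ℝ) - 1) / ρ * (1 + b1) + (1 + b1) * L) =
        fluxWeight n q J ρ * (((n : ℝ) - 1) / ρ ^ 2 * u ρ + J ρ * (u ρ - ρ)) := by
      rw [h2]; ring
    have h4 := mul_left_cancel₀ hPρ.ne' h3
    have e : ((n : ℝ) - 1) / ρ * (1 + b1) - ((n : ℝ) - 1) / ρ ^ 2 * u ρ =
        ((n : ℝ) - 1) * (b1 / ρ - (u ρ - ρ) / ρ ^ 2) := by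
      field_simp
      ring
    linarith
  · have := (hu.hasDerivWithinAt_right h.isFluxPair h.isTailBounded_target).sub
      (hasDerivWithinAt_id r (Icc 0 r))
    simpa using! this

end RadialCoefficients

/-- A function with derivative `W / P` on `(0, r)`, where `P` is bounded near `r` and `W` tends to
`L`, can have vanishing one-sided derivative at `r` only if `L = 0`. -/
theorem eq_zero_of_hasDerivWithinAt_right {r L M : ℝ} {P u W : ℝ → ℝ} (hr : 0 < r)
    (hPpos : ∀ t ∈ Ioo 0 r, 0 < P t) (hPM : ∀ t ∈ Ico (r / 2) r, P t ≤ M)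
    (huc : ContinuousOn u (Icc 0 r)) (hu : ∀ t ∈ Ioo 0 r, HasDerivAt u (W t / P t) t)
    (hW : Tendsto W (𝓝[<] r) (𝓝 L)) (hur : HasDerivWithinAt u 0 (Icc 0 r) r) : L = 0 := by
  by_contra hL
  wlog hLpos : 0 < L generalizing u W L with H
  · refine H (u := fun t => -u t) (W := fun t => -W t) (L := -L) huc.neg
      (fun t ht => ((hu t ht).neg).congr_deriv (by ring)) hW.neg (by simpa using! hur.neg)
      (by simpa using hL) ?_
    rcases lt_or_gt_of_ne hL with h | h
    · linarith
    · exact absurd h hLpos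
  have hr2 : r / 2 ∈ Ioo 0 r := ⟨half_pos hr, half_lt_self hr⟩
  have hM : 0 < M := (hPpos _ hr2).trans_le (hPM _ ⟨le_rfl, hr2.2⟩)
  obtain ⟨s, hs, hsW⟩ : ∃ s ∈ Ioo (r / 2) r, ∀ t ∈ Ioo s r, L / 2 < W t := by
    have h1 := hW.eventually (lt_mem_nhds (half_lt_self hLpos))
    obtain ⟨s, hs, hsub⟩ := (mem_nhdsLT_iff_exists_mem_Ico_Ioo_subset hr2.2).1 h1
    refine ⟨(s + r) / 2, ⟨by linarith [hs.1, hs.2], by linarith [hs.2]⟩, fun t ht => hsub ⟨?_, ht.2⟩⟩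
    linarith [ht.1, hs.2]
  have hslope : ∀ t ∈ Ioo s r, L / (2 * M) ≤ slope u r t := by
    intro t ht
    have hsub : ∀ x ∈ Ioo t r, x ∈ Ioo 0 r := fun x hx =>
      ⟨hr2.1.trans (hs.1.trans (ht.1.trans hx.1)), hx.2⟩
    obtain ⟨ξ, hξ, hξe⟩ := exists_hasDerivAt_eq_slope u (fun x => W x / P x) ht.2
      (huc.mono fun x hx => ⟨(hr2.1.trans (hs.1.trans ht.1)).le.trans hx.1, hx.2⟩)
      (fun x hx => hu x (hsub x hx))
    rw [slope_comm, slope_def_field, ← hξe, div_le_div_iff₀ (by positivity) (hPpos ξ (hsub ξ hξ))]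
    have h1 := hsW ξ ⟨ht.1.trans hξ.1, hξ.2⟩
    have h2 := hPM ξ ⟨(hs.1.trans (ht.1.trans hξ.1)).le, hξ.2⟩
    nlinarith
  have h1 := hasDerivWithinAt_iff_tendsto_slope.1 hur
  have h2 : Tendsto (slope u r) (𝓝[<] r) (𝓝 0) := h1.mono_left (by
    refine le_inf (nhdsWithin_le_nhds) ?_
    rw [le_principal_iff]
    filter_upwards [Ioo_mem_nhdsLT hr] with t ht
    exact ⟨⟨ht.1.le, ht.2.le⟩, ht.2.ne⟩)
  have h3 := ge_of_tendsto h2 (by filter_upwards [Ioo_mem_nhdsLT hs.2] with t ht using hslope t ht)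
  have : 0 < L / (2 * M) := by positivity
  linarith

namespace RadialCoefficients

variable {n : ℕ} {r : ℝ} {q J : ℝ → ℝ}

theorem exists_fluxWeight_le (h : RadialCoefficients n r q J) :
    ∃ M > 0, ∀ t ∈ Ioo 0 r, fluxWeight n q J t ≤ M := by
  obtain ⟨Q, hQ0, hQ⟩ := h.exists_q_le
  obtain ⟨jl, hjl, hJl⟩ := h.J_lower
  have hr := h.r_pos
  refine ⟨Q / jl * r ^ (n - 1), by positivity, fun t ht => ?_⟩
  have ht' : t ∈ Ico 0 r := ⟨ht.1.le, ht.2⟩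
  have h1 := hQ t ht'
  have h2 := hJl t ht'
  have h3 := h.q_pos t ht'
  have h4 := ht.1.le
  have h5 := ht.2.le
  unfold fluxWeight
  gcongr

/-- Every solution of the radial boundary value problem solves it in self-adjoint form, with
`u = ρ + b` and flux `(q / J) ρ^(n-1) (1 + b')`.  The condition `b'(r) = -1` forces the flux to
vanish at `r`. -/
theorem isFluxSolution (h : RadialCoefficients n r q J) {b : ℝ → ℝ}
    (hb : IsRadialSolution n r q J b) :
    IsFluxSolution r (fluxWeight n q J) (potential n q J) (target n q J) (fun ρ => ρ + b ρ)
      (fun ρ => if ρ < r then fluxWeight n q J ρ * (1 + deriv b ρ) else 0) := by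
  have hr := h.r_pos
  set P := fluxWeight n q J with hP
  set u : ℝ → ℝ := fun ρ => ρ + b ρ with hu
  set V : ℝ → ℝ := fun ρ => P ρ * (1 + deriv b ρ) with hV
  have huc : ContinuousOn u (Icc 0 r) := continuousOn_id.add hb.continuousOn
  have hud : ∀ ρ ∈ Ioo 0 r, HasDerivAt u (V ρ / P ρ) ρ := fun ρ hρ => by
    have h1 := (hb.differentiableOn.differentiableAt (isOpen_Ioo.mem_nhds hρ)).hasDerivAt
    refine ((hasDerivAt_id ρ).add h1).congr_deriv ?_
    rw [hV, mul_div_cancel_left₀ _ (h.fluxWeight_pos hρ).ne']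
  have hVac : LocallyAC V r := h.locallyAC_fluxWeight.mul
    ((LocallyAC.of_hasDerivAt (f' := fun _ => 0) (fun t _ => hasDerivAt_const t (1 : ℝ))
      continuousOn_const).add hb.locallyAC_deriv)
  have hgT : IsTailBounded r fun t => potential n q J t * (u t - target n q J t) :=
    h.isFluxPair.isTailBounded_potential.mul ((IsTailBounded.of_continuousOn_Ioc
      (huc.mono Ioc_subset_Icc_self)).sub h.isTailBounded_target)
  have hVd : ∀ ρ ∈ Ioo 0 r, HasDerivAt V (potential n q J ρ * (u ρ - target n q J ρ)) ρ := by
    refine hVac.hasDerivAt_of_ae hgT.continuousOn ?_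
    filter_upwards [h.q_ac.ae_differentiableAt, h.J_ac.ae_differentiableAt] with ρ hq hJ hρ
    have hρ0 := hρ.1
    have hqρ := h.q_pos ρ ⟨hρ.1.le, hρ.2⟩
    have hJρ := h.J_pos (ρ := ρ) ⟨hρ.1.le, hρ.2⟩
    obtain ⟨hdd, hode⟩ := hb.ode ρ hρ (hq hρ) (hJ hρ)
    rw [(hasDerivAt_fluxWeight_mul h.one_le hρ0 hJρ (hq hρ).hasDerivAt (hJ hρ).hasDerivAt
      (hdd.hasDerivAt.const_add 1) hqρ).deriv, mul_sub (potential n q J ρ), h.potential_mul_target hρ, potential]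
    have hpq : q ρ * ρ ^ (n - 1) = J ρ * P ρ := by
      simp only [hP, fluxWeight]; field_simp
    rw [← hP, hpq]
    generalize deriv (fun s => Real.log (q s)) ρ - deriv (fun s => Real.log (J s)) ρ = L at hode ⊢
    have e : deriv (deriv b) ρ + ((n : ℝ) - 1) / ρ * (1 + deriv b ρ) + (1 + deriv b ρ) * L =
        ((n : ℝ) - 1) / ρ ^ 2 * u ρ + J ρ * b ρ := by
      rw [hode, hu]
      field_simp
      ring
    rw [e, hu]
    ring
  -- the flux has a limit at `r`
  have hr2 : r / 2 ∈ Ioo 0 r := ⟨half_pos hr, half_lt_self hr⟩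
  set L := V (r / 2) + ∫ t in (r / 2)..r, potential n q J t * (u t - target n q J t) with hL
  have hVeq : ∀ s ∈ Ioo 0 r,
      V s = L - ∫ t in s..r, potential n q J t * (u t - target n q J t) := by
    intro s hs
    have h1 := intervalIntegral.integral_eq_sub_of_hasDerivAt (a := r / 2) (b := s) (f := V)
      (fun t ht => hVd t ⟨(lt_min hr2.1 hs.1).trans_le ht.1, ht.2.trans_lt (max_lt hr2.2 hs.2)⟩)
      (hgT.intervalIntegrable' ⟨hr2.1, hr2.2.le⟩ ⟨hs.1, hs.2.le⟩)
    have h2 := intervalIntegral.integral_add_adjacent_intervals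
      (hgT.intervalIntegrable' ⟨hr2.1, hr2.2.le⟩ ⟨hs.1, hs.2.le⟩)
      (hgT.intervalIntegrable ⟨hs.1, hs.2.le⟩)
    rw [hL, ← h2, h1]
    ring
  have hVlim : Tendsto V (𝓝[<] r) (𝓝 L) := by
    have := (hgT.tendsto_integral hr).const_sub L
    rw [sub_zero] at this
    refine this.congr' ?_
    filter_upwards [Ioo_mem_nhdsLT hr] with t ht using (hVeq t ht).symm
  obtain ⟨M, -, hM⟩ := h.exists_fluxWeight_le
  have hL0 : L = 0 := by
    refine eq_zero_of_hasDerivWithinAt_right hr (fun t ht => h.fluxWeight_pos ht)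
      (fun t ht => hM t ⟨hr2.1.trans_le ht.1, ht.2⟩) huc hud hVlim ?_
    simpa using! (hasDerivWithinAt_id r (Icc 0 r)).add hb.deriv_at_r
  have hWV : ∀ ρ, ρ < r → (fun ρ => if ρ < r then V ρ else 0) ρ = V ρ := fun ρ hρ => if_pos hρ
  have hWVe : ∀ ρ, ρ < r → (fun ρ => if ρ < r then V ρ else 0) =ᶠ[𝓝 ρ] V := fun ρ hρ => by
    filter_upwards [gt_mem_nhds hρ] with t ht using hWV t ht
  refine ⟨huc, by simp [hu, hb.at_zero], fun ρ hρ => ?_, ?_, fun ρ hρ =>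
    (hVd ρ hρ).congr_of_eventuallyEq (hWVe ρ hρ.2), if_neg (lt_irrefl r)⟩
  · have := hud ρ hρ
    rwa [← hWV ρ hρ.2] at this
  · refine hgT.continuousOn_integral.neg.congr fun ρ hρ => ?_
    rcases hρ.2.eq_or_lt with rfl | hρr
    · simp
    · exact (if_pos hρr).trans ((hVeq ρ ⟨hρ.1, hρr⟩).trans (by rw [hL0, zero_sub]; rfl))

end RadialCoefficients

/-! ### Integration in polar coordinates -/

/-- The integral of `g` over the sphere of radius `ρ`, with respect to the surface measure of the
unit sphere. -/
noncomputable def sphereIntegral {n : ℕ} (g : E n → ℝ) (ρ : ℝ) : ℝ :=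
  ∫ ξ : Metric.sphere (0 : E n) 1, g (ρ • (ξ : E n)) ∂(volume : Measure (E n)).toSphere

section Polar

variable {n : ℕ} {r : ℝ} {g : E n → ℝ}

theorem sphereIntegral_mul_left (k : ℝ → ℝ) (g : E n → ℝ) {ρ : ℝ} (hρ : 0 < ρ) :
    sphereIntegral (fun θ => k ‖θ‖ * g θ) ρ = k ρ * sphereIntegral g ρ := by
  unfold sphereIntegral
  rw [← integral_const_mul]
  refine integral_congr_ae (Eventually.of_forall fun ξ => ?_)
  have : ‖ρ • (ξ : E n)‖ = ρ := by rw [norm_smul, norm_eq_of_mem_sphere, mul_one,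
    Real.norm_of_nonneg hρ.le]
  simp only [this]

theorem integrable_volumeIoiPow_iff {m : ℕ} {f : Ioi (0 : ℝ) → ℝ} :
    Integrable f (Measure.volumeIoiPow m) ↔
      Integrable (fun ρ : Ioi (0 : ℝ) => (ρ : ℝ) ^ m * f ρ) (Measure.comap Subtype.val volume) := by
  rw [Measure.volumeIoiPow, integrable_withDensity_iff_integrable_smul' (by fun_prop) (by simp)]
  refine integrable_congr (Eventually.of_forall fun ρ => ?_)
  simp [ENNReal.toReal_ofReal (pow_nonneg ρ.2.out.le m)]

theorem integral_volumeIoiPow {m : ℕ} (f : Ioi (0 : ℝ) → ℝ) :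
    ∫ ρ, f ρ ∂(Measure.volumeIoiPow m) =
      ∫ ρ : Ioi (0 : ℝ), (ρ : ℝ) ^ m * f ρ ∂(Measure.comap Subtype.val volume) := by
  simp only [Measure.volumeIoiPow, ENNReal.ofReal]
  rw [integral_withDensity_eq_integral_smul (by fun_prop)]
  refine integral_congr_ae (Eventually.of_forall fun ρ => ?_)
  simp only [NNReal.smul_def, Real.coe_toNNReal _ (pow_nonneg ρ.2.out.le m), smul_eq_mul]

theorem ae_volumeIoiPow {m : ℕ} {p : ℝ → Prop}
    (h : ∀ᵐ ρ : Ioi (0 : ℝ) ∂(Measure.volumeIoiPow m), p ρ) : ∀ᵐ ρ : ℝ, 0 < ρ → p ρ := by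
  rw [Measure.volumeIoiPow, ae_withDensity_iff (by fun_prop)] at h
  have h1 : ∀ᵐ ρ : Ioi (0 : ℝ) ∂(Measure.comap Subtype.val volume), p ρ := by
    filter_upwards [h] with ρ hρ
    refine hρ ?_
    simpa using pow_pos ρ.2.out m
  exact (ae_restrict_iff' measurableSet_Ioi).1
    ((ae_restrict_iff_subtype measurableSet_Ioi).2 h1)

theorem integrable_prod_of_integrable (hn : 1 ≤ n) (hg : Integrable g) :
    Integrable (fun z : Metric.sphere (0 : E n) 1 × Ioi (0 : ℝ) => g ((z.2 : ℝ) • (z.1 : E n)))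
      ((volume : Measure (E n)).toSphere.prod (Measure.volumeIoiPow (n - 1))) ∧
    ∫ θ, g θ = ∫ z : Metric.sphere (0 : E n) 1 × Ioi (0 : ℝ), g ((z.2 : ℝ) • (z.1 : E n))
      ∂((volume : Measure (E n)).toSphere.prod (Measure.volumeIoiPow (n - 1))) := by
  have : Nonempty (Fin n) := ⟨⟨0, hn⟩⟩
  have hmp := (volume : Measure (E n)).measurePreserving_homeomorphUnitSphereProd
  rw [finrank_euclideanSpace_fin] at hmp
  have hemb := (homeomorphUnitSphereProd (E n)).measurableEmbedding
  have hcomp : ∀ x : ({0}ᶜ : Set (E n)),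
      g (((homeomorphUnitSphereProd (E n) x).2 : ℝ) • ((homeomorphUnitSphereProd (E n) x).1 : E n))
        = g x := fun x => by
    have : ‖(x : E n)‖ ≠ 0 := norm_ne_zero_iff.2 x.2
    simp [smul_smul, mul_inv_cancel₀ this]
  have hms : MeasurableSet ({0}ᶜ : Set (E n)) := (measurableSet_singleton _).compl
  constructor
  · rw [← hmp.integrable_comp_emb hemb]
    have h1 : Integrable (fun x : ({0}ᶜ : Set (E n)) => g x) (Measure.comap Subtype.val volume) := by
      have := (integrableOn_iff_comap_subtypeVal hms).1 (hg.integrableOn (s := ({0}ᶜ : Set (E n))))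
      exact this
    refine h1.congr (Eventually.of_forall fun x => ?_)
    exact (hcomp x).symm
  · rw [← hmp.integral_comp hemb]
    simp only [hcomp]
    rw [integral_subtype_comap hms fun x => g x, restrict_compl_singleton]

/-- Polar coordinates: Fubini's theorem for spheres centred at the origin. -/
theorem integral_ball_eq_sphereIntegral (hn : 1 ≤ n)
    (hg : IntegrableOn g (Metric.ball 0 r)) :
    IntegrableOn (fun ρ => ρ ^ (n - 1) * sphereIntegral g ρ) (Ioo 0 r) ∧
    ∫ θ in Metric.ball 0 r, g θ = ∫ ρ in Ioo 0 r, ρ ^ (n - 1) * sphereIntegral g ρ ∧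
    ∀ᵐ ρ : ℝ, ρ ∈ Ioo 0 r → Integrable (fun ξ : Metric.sphere (0 : E n) 1 => g (ρ • (ξ : E n)))
      (volume : Measure (E n)).toSphere := by
  set G := (Metric.ball (0 : E n) r).indicator g with hG
  have hGint : Integrable G := (integrable_indicator_iff measurableSet_ball).2 hg
  obtain ⟨h1, h2⟩ := integrable_prod_of_integrable hn hGint
  have hnorm : ∀ {ρ : ℝ}, 0 < ρ → ∀ ξ : Metric.sphere (0 : E n) 1, ‖ρ • (ξ : E n)‖ = ρ :=
    fun hρ ξ => by rw [norm_smul, norm_eq_of_mem_sphere, mul_one, Real.norm_of_nonneg hρ.le]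
  have hGr : ∀ {ρ : ℝ}, ρ ∈ Ioo 0 r → ∀ ξ : Metric.sphere (0 : E n) 1,
      G (ρ • (ξ : E n)) = g (ρ • (ξ : E n)) := fun hρ ξ => by
    rw [hG, indicator_of_mem]
    rw [mem_ball_zero_iff, hnorm hρ.1]
    exact hρ.2
  have hGr' : ∀ {ρ : ℝ}, 0 < ρ → r ≤ ρ → ∀ ξ : Metric.sphere (0 : E n) 1,
      G (ρ • (ξ : E n)) = 0 := fun hρ hr ξ => by
    rw [hG, indicator_of_notMem]
    rw [mem_ball_zero_iff, hnorm hρ]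
    exact not_lt.2 hr
  have hind : EqOn (fun ρ : ℝ => ρ ^ (n - 1) * sphereIntegral G ρ)
      ((Ioo 0 r).indicator fun ρ => ρ ^ (n - 1) * sphereIntegral g ρ) (Ioi 0) := by
    intro ρ hρ
    by_cases hρr : ρ < r
    · rw [indicator_of_mem (show ρ ∈ Ioo 0 r from ⟨hρ, hρr⟩)]
      simp only [sphereIntegral, hGr ⟨hρ, hρr⟩]
    · rw [indicator_of_notMem fun h => hρr h.2]
      simp only [sphereIntegral, hGr' hρ (not_lt.1 hρr), integral_zero, mul_zero]
  have h3 := h1.integral_prod_right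
  rw [integrable_volumeIoiPow_iff] at h3
  have h3' : IntegrableOn (fun ρ : ℝ => ρ ^ (n - 1) * sphereIntegral G ρ) (Ioi 0) :=
    (integrableOn_iff_comap_subtypeVal measurableSet_Ioi).2 h3
  have hinter : Ioi (0 : ℝ) ∩ Ioo 0 r = Ioo 0 r := inter_eq_right.2 fun x hx => hx.1
  refine ⟨?_, ?_, ?_⟩
  · rw [integrableOn_congr_fun hind measurableSet_Ioi] at h3'
    have := (integrableOn_indicator_iff measurableSet_Ioo).1 h3'
    rwa [inter_comm, hinter] at this
  · rw [← integral_indicator measurableSet_ball, ← hG, h2, integral_prod_symm _ h1,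
      integral_volumeIoiPow]
    change ∫ ρ : Ioi (0 : ℝ), (fun ρ : ℝ => ρ ^ (n - 1) * sphereIntegral G ρ) ρ
      ∂(Measure.comap Subtype.val volume) = _
    rw [integral_subtype_comap measurableSet_Ioi fun ρ : ℝ => ρ ^ (n - 1) * sphereIntegral G ρ,
      setIntegral_congr_fun measurableSet_Ioi hind, setIntegral_indicator measurableSet_Ioo, hinter]
  · have h4 := ae_volumeIoiPow (p := fun ρ => Integrable
      (fun ξ : Metric.sphere (0 : E n) 1 => G (ρ • (ξ : E n)))
      (volume : Measure (E n)).toSphere) h1.prod_left_ae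
    filter_upwards [h4] with ρ hρ hρr
    refine (hρ hρr.1).congr (Eventually.of_forall fun ξ => ?_)
    exact hGr hρr ξ

end Polar

/-! ### Weak derivatives of functions that are differentiable off the origin -/

section WeakDerivative

variable {n : ℕ}

/-- The integral of a partial derivative of a compactly supported function vanishes, even if the
function is only continuous at the origin. -/
theorem integral_partial_eq_zero {Φ : E n → ℝ} {Φ' : E n → E n →L[ℝ] ℝ} (hc : Continuous Φ)
    (hcs : HasCompactSupport Φ) (hd : ∀ x, x ≠ 0 → HasFDerivAt Φ (Φ' x) x) (j : Fin n)
    (hint : Integrable fun x => Φ' x (EuclideanSpace.single j 1)) :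
    ∫ x, Φ' x (EuclideanSpace.single j 1) = 0 := by
  obtain ⟨m, rfl⟩ : ∃ m, n = m + 1 := ⟨n - 1, by have := j.2; omega⟩
  obtain ⟨R, hR0, hR⟩ := hcs.isCompact.isBounded.subset_ball_lt 0 0
  let L : (Fin (m + 1) → ℝ) ≃L[ℝ] E (m + 1) := (EuclideanSpace.equiv (Fin (m + 1)) ℝ).symm
  have hLapp : ∀ x, L x = WithLp.toLp 2 x := fun x => rfl
  have hmp : MeasurePreserving (WithLp.toLp 2 : (Fin (m + 1) → ℝ) → E (m + 1)) :=
    PiLp.volume_preserving_toLp _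
  have hemb : MeasurableEmbedding (WithLp.toLp 2 : (Fin (m + 1) → ℝ) → E (m + 1)) :=
    (MeasurableEquiv.toLp 2 (Fin (m + 1) → ℝ)).measurableEmbedding
  have hcoord : ∀ (x : Fin (m + 1) → ℝ) i, |x i| ≤ ‖(WithLp.toLp 2 x : E (m + 1))‖ := fun x i =>
    PiLp.norm_apply_le (WithLp.toLp 2 x : E (m + 1)) i
  have hzero : ∀ (x : Fin (m + 1) → ℝ) i, R ≤ |x i| → (WithLp.toLp 2 x : E (m + 1)) ∉ tsupport Φ := by
    intro x i hx hmem
    have h1 := mem_ball_zero_iff.1 (hR hmem)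
    linarith [hcoord x i]
  have hΦ0 : ∀ x i, R ≤ |x i| → Φ (WithLp.toLp 2 x) = 0 := fun x i hx =>
    image_eq_zero_of_notMem_tsupport (hzero x i hx)
  have hΦ'0 : ∀ x, x ≠ 0 → x ∉ tsupport Φ → Φ' x = 0 := fun x hx hxt => by
    have h1 : Φ =ᶠ[𝓝 x] fun _ => 0 := notMem_tsupport_iff_eventuallyEq.1 hxt
    exact (hd x hx).unique ((hasFDerivAt_const (0 : ℝ) x).congr_of_eventuallyEq h1)
  let a : Fin (m + 1) → ℝ := fun _ => -R
  let b : Fin (m + 1) → ℝ := fun _ => R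
  have hintL : Integrable fun x : Fin (m + 1) → ℝ =>
      Φ' (WithLp.toLp 2 x) (EuclideanSpace.single j 1) := (hmp.integrable_comp_emb hemb).2 hint
  have hsum : ∀ x, (∑ i, (if i = j then (Φ' (L x)).comp (L : (Fin (m + 1) → ℝ) →L[ℝ] E (m + 1))
      else 0) (Pi.single i 1)) = Φ' (WithLp.toLp 2 x) (EuclideanSpace.single j 1) := fun x => by
    rw [Finset.sum_eq_single j (fun i _ hij => by simp [hij]) (by simp)]
    simp [hLapp]
  have key := integral_divergence_of_hasFDerivAt_off_countable' a b
    (fun i => by simp only [a, b]; linarith)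
    (fun i x => if i = j then Φ (L x) else 0)
    (fun i x => if i = j then (Φ' (L x)).comp (L : (Fin (m + 1) → ℝ) →L[ℝ] E (m + 1)) else 0) {0}
    (countable_singleton 0)
    (fun i => by
      split_ifs
      · exact (hc.comp L.continuous).continuousOn
      · exact continuousOn_const)
    (fun x hx i => by
      split_ifs
      · refine (hd (L x) fun h => hx.2 ?_).comp x L.hasFDerivAt
        exact (map_eq_zero_iff L L.injective).1 h
      · exact hasFDerivAt_const _ _)
    (by simpa only [hsum] using hintL.integrableOn)
  simp only [hsum] at key
  rw [← hmp.integral_comp hemb, ← setIntegral_eq_integral_of_forall_compl_eq_zero (s := Icc a b), key]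
  · refine Finset.sum_eq_zero fun i _ => ?_
    have h1 : ∀ (c : ℝ) (x : Fin m → ℝ), R ≤ |c| →
        (if i = j then Φ (L (Fin.insertNth i c x)) else 0) = 0 := fun c x hcR => by
      split_ifs
      · exact hΦ0 _ i (by simpa using hcR)
      · rfl
    simp only [a, b]
    rw [setIntegral_eq_zero_of_forall_eq_zero fun x _ => h1 R x (le_abs_self R),
      setIntegral_eq_zero_of_forall_eq_zero fun x _ => h1 (-R) x (by rw [abs_neg]; exact le_abs_self R),
      sub_zero]
  · intro x hx
    obtain ⟨i, hi⟩ : ∃ i, R ≤ |x i| := by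
      by_contra! hcon
      exact hx ⟨fun i => (abs_lt.1 (hcon i)).1.le, fun i => (abs_lt.1 (hcon i)).2.le⟩
    rw [hΦ'0 _ ?_ (hzero x i hi)]
    · rfl
    · intro h0
      have := hcoord x i
      rw [h0, norm_zero] at this
      linarith

theorem integrable_mul_of_tsupport_subset {Ω : Set (E n)} {g φ : E n → ℝ}
    (hg : LocallyIntegrableOn g Ω) (hφ : Continuous φ) (hcs : HasCompactSupport φ)
    (hsub : tsupport φ ⊆ Ω) : Integrable fun x => g x * φ x := by
  have h1 : IntegrableOn (fun x => g x * φ x) (tsupport φ) :=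
    (hg.integrableOn_compact_subset hsub hcs.isCompact).mul_continuousOn hφ.continuousOn
      hcs.isCompact
  refine (integrableOn_iff_integrable_of_support_subset ?_).1 h1
  intro x hx
  exact subset_tsupport φ (right_ne_zero_of_mul hx)

theorem continuous_pd {φ : E n → ℝ} (hφ : ContDiff ℝ ∞ φ) (j : Fin n) : Continuous (pd φ j) :=
  (hφ.continuous_fderiv (by simp)).clm_apply continuous_const

theorem tsupport_pd_subset {φ : E n → ℝ} (j : Fin n) : tsupport (pd φ j) ⊆ tsupport φ := by
  refine closure_minimal (fun x hx => ?_) (isClosed_tsupport φ)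
  by_contra hxt
  refine hx ?_
  rw [pd, (notMem_tsupport_iff_eventuallyEq.1 hxt).fderiv_eq]
  simp

theorem hasCompactSupport_pd {φ : E n → ℝ} (hφ : HasCompactSupport φ) (j : Fin n) :
    HasCompactSupport (pd φ j) :=
  hφ.isCompact.of_isClosed_subset (isClosed_tsupport _) (tsupport_pd_subset j)

/-- A function that is continuous on `Ω` and differentiable off the origin has the classical
derivative as its weak derivative, provided that this is locally integrable. -/
theorem integral_mul_pd_of_hasFDerivAt {Ω : Set (E n)} (hΩ : IsOpen Ω) {F : E n → ℝ}
    {F' : E n → E n →L[ℝ] ℝ} (hFc : ContinuousOn F Ω)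
    (hFd : ∀ x ∈ Ω, x ≠ 0 → HasFDerivAt F (F' x) x) (j : Fin n)
    (hF' : LocallyIntegrableOn (fun x => F' x (EuclideanSpace.single j 1)) Ω) {φ : E n → ℝ}
    (hφ : ContDiff ℝ ∞ φ) (hcs : HasCompactSupport φ) (hsub : tsupport φ ⊆ Ω) :
    ∫ θ in Ω, F θ * pd φ j θ = -∫ θ in Ω, F' θ (EuclideanSpace.single j 1) * φ θ := by
  have hFloc : LocallyIntegrableOn F Ω := hFc.locallyIntegrableOn hΩ.measurableSet
  have h1 := integrable_mul_of_tsupport_subset hFloc (continuous_pd hφ j)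
    (hasCompactSupport_pd hcs j) ((tsupport_pd_subset j).trans hsub)
  have h2 := integrable_mul_of_tsupport_subset hF' hφ.continuous hcs hsub
  have hφ0 : ∀ x, x ∉ Ω → φ x = 0 := fun x hx =>
    image_eq_zero_of_notMem_tsupport fun h => hx (hsub h)
  have hpd0 : ∀ x, x ∉ Ω → pd φ j x = 0 := fun x hx =>
    image_eq_zero_of_notMem_tsupport fun h => hx (hsub (tsupport_pd_subset j h))
  have hnear : ∀ x, x ∉ tsupport φ → φ =ᶠ[𝓝 x] fun _ => 0 := fun x hx =>
    notMem_tsupport_iff_eventuallyEq.1 hx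
  have hΦc : Continuous fun x => F x * φ x := by
    rw [continuous_iff_continuousAt]
    intro x
    by_cases hx : x ∈ tsupport φ
    · exact (hFc.continuousAt (hΩ.mem_nhds (hsub hx))).mul hφ.continuous.continuousAt
    · refine (continuousAt_const (y := (0 : ℝ))).congr ?_
      filter_upwards [hnear x hx] with y hy
      rw [hy, mul_zero]
  have key := integral_partial_eq_zero (Φ := fun x => F x * φ x)
    (Φ' := fun x => F x • fderiv ℝ φ x + φ x • F' x) hΦc hcs.mul_left (fun x hx0 => by
      by_cases hx : x ∈ tsupport φ
      · exact (hFd x (hsub hx) hx0).mul (hφ.differentiable (by simp) x).hasFDerivAt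
      · have e1 : φ x = 0 := (hnear x hx).eq_of_nhds
        have e2 : fderiv ℝ φ x = 0 := by rw [(hnear x hx).fderiv_eq]; simp
        rw [e1, e2, smul_zero, zero_smul, add_zero]
        refine (hasFDerivAt_const (0 : ℝ) x).congr_of_eventuallyEq ?_
        filter_upwards [hnear x hx] with y hy
        rw [hy, mul_zero]) j (by
      refine (h1.add h2).congr (Eventually.of_forall fun x => ?_)
      simp [pd, mul_comm])
  have hpt : ∀ x, (F x • fderiv ℝ φ x + φ x • F' x) (EuclideanSpace.single j 1) =
      F x * pd φ j x + F' x (EuclideanSpace.single j 1) * φ x := fun x => by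
    simp [pd, mul_comm]
  simp only [hpt] at key
  rw [integral_add h1 h2] at key
  rw [setIntegral_eq_integral_of_forall_compl_eq_zero fun x hx => by rw [hpd0 x hx, mul_zero],
    setIntegral_eq_integral_of_forall_compl_eq_zero fun x hx => by rw [hφ0 x hx, mul_zero]]
  linarith

end WeakDerivative

/-! ### Square integrability with respect to a radial prior -/

/-- The prior is a probability density supported on the ball of radius `r`, with radial
profile `q`. -/
structure RadialPrior {n : ℕ} (r : ℝ) (q : ℝ → ℝ) (prior : E n → ℝ) : Prop where
  measurable : Measurable prior
  nonneg : ∀ θ, 0 ≤ prior θ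
  lintegral_eq : ∫⁻ θ, ENNReal.ofReal (prior θ) = 1
  feasibleSet_eq : feasibleSet prior = Metric.ball 0 r
  eq_profile : ∀ θ ∈ Metric.ball (0 : E n) r, prior θ = q ‖θ‖

theorem norm_mem_Ico {n : ℕ} {r : ℝ} {θ : E n} (hθ : θ ∈ Metric.ball (0 : E n) r) :
    ‖θ‖ ∈ Ico 0 r := ⟨norm_nonneg θ, mem_ball_zero_iff.1 hθ⟩

theorem norm_mem_Ioo {n : ℕ} {r : ℝ} {θ : E n} (hθ : θ ∈ Metric.ball (0 : E n) r) (h0 : θ ≠ 0) :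
    ‖θ‖ ∈ Ioo 0 r := ⟨norm_pos_iff.2 h0, mem_ball_zero_iff.1 hθ⟩

namespace RadialPrior

variable {n : ℕ} {r : ℝ} {q J : ℝ → ℝ} {prior : E n → ℝ} {g k : E n → ℝ}

theorem pos (hp : RadialPrior r q prior) {θ : E n} (hθ : θ ∈ Metric.ball (0 : E n) r) :
    0 < prior θ := by
  rw [← hp.feasibleSet_eq] at hθ
  exact hθ

theorem priorMeasure_eq (hp : RadialPrior r q prior) : priorMeasure prior =
    (volume.restrict (Metric.ball 0 r)).withDensity fun θ => ENNReal.ofReal (prior θ) := by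
  rw [← withDensity_indicator measurableSet_ball, priorMeasure]
  congr 1
  funext θ
  by_cases hθ : θ ∈ Metric.ball (0 : E n) r
  · rw [indicator_of_mem hθ]
  · rw [indicator_of_notMem hθ, ENNReal.ofReal_eq_zero]
    rw [← hp.feasibleSet_eq] at hθ
    exact not_lt.1 hθ

theorem priorMeasure_absolutelyContinuous (hp : RadialPrior r q prior) :
    priorMeasure prior ≪ volume.restrict (Metric.ball 0 r) := by
  rw [hp.priorMeasure_eq]
  exact withDensity_absolutelyContinuous _ _

theorem absolutelyContinuous_priorMeasure (hp : RadialPrior r q prior) :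
    volume.restrict (Metric.ball 0 r) ≪ priorMeasure prior := by
  rw [hp.priorMeasure_eq]
  refine withDensity_absolutelyContinuous' hp.measurable.ennreal_ofReal.aemeasurable ?_
  filter_upwards [ae_restrict_mem measurableSet_ball] with θ hθ
  exact (ENNReal.ofReal_pos.2 (hp.pos hθ)).ne'

theorem integrable_iff (hp : RadialPrior r q prior) : Integrable g (priorMeasure prior) ↔
    IntegrableOn (fun θ => prior θ * g θ) (Metric.ball 0 r) := by
  rw [hp.priorMeasure_eq, integrable_withDensity_iff_integrable_smul' hp.measurable.ennreal_ofReal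
    (by simp), IntegrableOn]
  refine integrable_congr (Eventually.of_forall fun θ => ?_)
  simp [ENNReal.toReal_ofReal (hp.nonneg θ)]

theorem isProbabilityMeasure (hp : RadialPrior r q prior) :
    IsProbabilityMeasure (priorMeasure prior) :=
  ⟨by rw [priorMeasure, withDensity_apply _ MeasurableSet.univ, Measure.restrict_univ,
    hp.lintegral_eq]⟩

theorem memLp_two_iff (hp : RadialPrior r q prior)
    (hg : AEStronglyMeasurable g (volume.restrict (Metric.ball 0 r))) :
    MemLp g 2 (priorMeasure prior) ↔ IntegrableOn (fun θ => prior θ * g θ ^ 2) (Metric.ball 0 r) := by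
  rw [memLp_two_iff_integrable_sq (hg.mono_ac hp.priorMeasure_absolutelyContinuous),
    hp.integrable_iff]

theorem integrableOn_mul (hp : RadialPrior r q prior) (hg : MemLp g 2 (priorMeasure prior))
    (hk : MemLp k 2 (priorMeasure prior)) :
    IntegrableOn (fun θ => prior θ * (g θ * k θ)) (Metric.ball 0 r) :=
  hp.integrable_iff.1 (hg.integrable_mul hk)

theorem aestronglyMeasurable (hp : RadialPrior r q prior) (hg : MemLp g 2 (priorMeasure prior)) :
    AEStronglyMeasurable g (volume.restrict (Metric.ball 0 r)) :=
  hg.1.mono_ac hp.absolutelyContinuous_priorMeasure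

theorem integrableOn_closedBall (hp : RadialPrior r q prior) (h : RadialCoefficients n r q J)
    (hg : MemLp g 2 (priorMeasure prior)) {s : ℝ} (hs : s < r) :
    IntegrableOn g (Metric.closedBall 0 s) := by
  have hsub : Metric.closedBall (0 : E n) s ⊆ Metric.ball 0 r := Metric.closedBall_subset_ball hs
  rcases lt_or_ge s 0 with hs0 | hs0
  · rw [Metric.closedBall_eq_empty.2 hs0]
    exact integrableOn_empty
  have hcont : ContinuousOn q (Icc 0 s) := h.q_cont.mono fun t ht => ⟨ht.1, ht.2.trans_lt hs⟩
  obtain ⟨m, hm, hmin⟩ := isCompact_Icc.exists_isMinOn (nonempty_Icc.2 hs0) hcont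
  have hqm : 0 < q m := h.q_pos m ⟨hm.1, hm.2.trans_lt hs⟩
  have h1 : IntegrableOn (fun θ => (q m)⁻¹ * (prior θ * g θ ^ 2) + 1) (Metric.closedBall 0 s) := by
    refine Integrable.add ?_ (integrableOn_const (measure_closedBall_lt_top.ne))
    exact (((hp.memLp_two_iff (hp.aestronglyMeasurable hg)).1 hg).mono_set hsub).const_mul _
  refine Integrable.mono' h1 ((hp.aestronglyMeasurable hg).mono_measure
    (Measure.restrict_mono hsub le_rfl)) ?_
  filter_upwards [ae_restrict_mem measurableSet_closedBall] with θ hθ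
  have hθ' : ‖θ‖ ≤ s := mem_closedBall_zero_iff.1 hθ
  have h2 : q m ≤ prior θ := by
    rw [hp.eq_profile θ (hsub hθ)]
    exact hmin (show ‖θ‖ ∈ Icc 0 s from ⟨norm_nonneg θ, hθ'⟩)
  have h3 : g θ ^ 2 ≤ (q m)⁻¹ * (prior θ * g θ ^ 2) := by
    rw [← mul_assoc]
    refine le_mul_of_one_le_left (sq_nonneg _) ?_
    rw [inv_mul_eq_div, one_le_div hqm]
    exact h2
  rw [Real.norm_eq_abs]
  nlinarith [sq_nonneg (|g θ| - 1), sq_abs (g θ), abs_nonneg (g θ)]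

theorem locallyIntegrableOn (hp : RadialPrior r q prior) (h : RadialCoefficients n r q J)
    (hg : MemLp g 2 (priorMeasure prior)) : LocallyIntegrableOn g (Metric.ball 0 r) := by
  intro x hx
  obtain ⟨s, hs, hsr⟩ := exists_between (mem_ball_zero_iff.1 hx)
  refine ⟨Metric.closedBall 0 s, ?_, hp.integrableOn_closedBall h hg hsr⟩
  refine mem_nhdsWithin_of_mem_nhds (mem_of_superset (Metric.isOpen_ball.mem_nhds
    (mem_ball_zero_iff.2 hs)) Metric.ball_subset_closedBall)

end RadialPrior

/-! ### Radial matrices and radial vector fields -/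

/-- The symmetric matrix with eigenvalue `α` in the direction of `θ` and `β` orthogonally to it. -/
noncomputable def radialMatrix {n : ℕ} (α β : ℝ) (θ : E n) : Matrix (Fin n) (Fin n) ℝ :=
  Matrix.of fun i j => (α - β) * (θ i * θ j / ‖θ‖ ^ 2) + β * (1 : Matrix (Fin n) (Fin n) ℝ) i j

section RadialMatrix

variable {n : ℕ} {θ : E n}

theorem sum_sq_eq_norm_sq (θ : E n) : ∑ i : Fin n, θ i ^ 2 = ‖θ‖ ^ 2 := by
  rw [EuclideanSpace.real_norm_sq_eq]

theorem one_add_radialMatrix (α β : ℝ) (θ : E n) :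
    1 + radialMatrix α β θ = radialMatrix (1 + α) (1 + β) θ := by
  ext i j
  simp only [radialMatrix, Matrix.add_apply, Matrix.of_apply]
  ring

theorem sum_radialMatrix_mul (α β : ℝ) (θ : E n) (D : Matrix (Fin n) (Fin n) ℝ) :
    ∑ i, ∑ j, radialMatrix α β θ i j * D i j =
      (α - β) * (∑ i, ∑ j, θ i * θ j * D i j) / ‖θ‖ ^ 2 + β * ∑ i, D i i := by
  have e : ∀ i j, radialMatrix α β θ i j * D i j = (α - β) / ‖θ‖ ^ 2 * (θ i * θ j * D i j) +
      β * ((1 : Matrix (Fin n) (Fin n) ℝ) i j * D i j) := fun i j => by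
    simp only [radialMatrix, Matrix.of_apply]; ring
  simp only [e, Finset.sum_add_distrib, ← Finset.mul_sum, Matrix.one_apply, ite_mul, one_mul,
    zero_mul, Finset.sum_ite_eq, Finset.mem_univ, if_true]
  ring

theorem sum_mul_radialMatrix (α β : ℝ) (hθ : θ ≠ 0) :
    ∑ i, ∑ j, θ i * θ j * radialMatrix α β θ i j = α * ‖θ‖ ^ 2 := by
  have hθ' : ‖θ‖ ^ 2 ≠ 0 := pow_ne_zero 2 (norm_ne_zero_iff.2 hθ)
  have e : ∀ i j, θ i * θ j * radialMatrix α β θ i j =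
      (α - β) / ‖θ‖ ^ 2 * (θ i ^ 2 * θ j ^ 2) +
        β * (θ i * θ j * (1 : Matrix (Fin n) (Fin n) ℝ) i j) := fun i j => by
    simp only [radialMatrix, Matrix.of_apply]; ring
  simp only [e, Finset.sum_add_distrib, ← Finset.mul_sum, sum_sq_eq_norm_sq, ← Finset.sum_mul,
    Matrix.one_apply, mul_ite, mul_one, mul_zero, Finset.sum_ite_eq, Finset.mem_univ, if_true,
    ← pow_two]
  field_simp
  ring

theorem sum_sq_radialMatrix (α β : ℝ) (hθ : θ ≠ 0) :
    ∑ i, ∑ j, radialMatrix α β θ i j ^ 2 = α ^ 2 + ((n : ℝ) - 1) * β ^ 2 := by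
  have hθ' : ‖θ‖ ^ 2 ≠ 0 := pow_ne_zero 2 (norm_ne_zero_iff.2 hθ)
  have h1 := sum_mul_radialMatrix α β hθ
  have h2 : ∑ i, radialMatrix α β θ i i = α - β + n * β := by
    simp only [radialMatrix, Matrix.of_apply, Finset.sum_add_distrib, ← Finset.mul_sum,
      ← Finset.sum_div, ← pow_two, sum_sq_eq_norm_sq, Matrix.one_apply_eq, div_self hθ']
    simp
    ring
  simp only [pow_two (radialMatrix α β θ _ _)]
  rw [sum_radialMatrix_mul, h1, h2]
  field_simp
  ring

theorem hasFDerivAt_comp_norm {k : ℝ → ℝ} {k' : ℝ} (hθ : θ ≠ 0) (hk : HasDerivAt k k' ‖θ‖) :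
    HasFDerivAt (fun x : E n => k ‖x‖) ((k' / ‖θ‖) • innerSL ℝ θ) θ := by
  have h0 : ‖θ‖ ≠ 0 := norm_ne_zero_iff.2 hθ
  have h1 : HasFDerivAt (fun x : E n => ‖x‖) ((1 / ‖θ‖) • innerSL ℝ θ) θ := by
    have h2 := ((hasStrictFDerivAt_norm_sq θ).hasFDerivAt).sqrt (pow_ne_zero 2 h0)
    simp only [Real.sqrt_sq (norm_nonneg _)] at h2
    refine h2.congr_fderiv ?_
    ext v
    simp
    field_simp
  refine (hk.comp_hasFDerivAt θ h1).congr_fderiv ?_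
  rw [smul_smul, mul_one_div]

theorem innerSL_single (θ : E n) (j : Fin n) :
    innerSL ℝ θ (EuclideanSpace.single j (1 : ℝ)) = θ j := by
  simp [EuclideanSpace.inner_single_right]

end RadialMatrix

/-- The classical Jacobian of the radial field of `b` off the origin. -/
noncomputable def radialJacobian {n : ℕ} (b : ℝ → ℝ) (θ : E n) : Matrix (Fin n) (Fin n) ℝ :=
  radialMatrix (deriv b ‖θ‖) (b ‖θ‖ / ‖θ‖) θ

section RadialField

variable {n : ℕ} {r : ℝ} {q J b : ℝ → ℝ}

theorem radialField_apply (b : ℝ → ℝ) (θ : E n) (i : Fin n) :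
    radialField b θ i = b ‖θ‖ / ‖θ‖ * θ i := by
  simp [radialField]

theorem norm_radialField (h0 : b 0 = 0) (θ : E n) : ‖radialField b θ‖ = |b ‖θ‖| := by
  rw [radialField, norm_smul, Real.norm_eq_abs, abs_div, abs_of_nonneg (norm_nonneg θ)]
  rcases eq_or_ne θ 0 with rfl | hθ
  · simp [h0]
  · rw [div_mul_cancel₀ _ (norm_ne_zero_iff.2 hθ)]

theorem hasFDerivAt_radialField {θ : E n} (hθ : θ ≠ 0) (hb : DifferentiableAt ℝ b ‖θ‖) (i : Fin n) :
    HasFDerivAt (fun x => radialField b x i)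
      (∑ j, radialJacobian b θ i j • (EuclideanSpace.proj j : E n →L[ℝ] ℝ)) θ := by
  have h0 : ‖θ‖ ≠ 0 := norm_ne_zero_iff.2 hθ
  have h1 := (hasFDerivAt_comp_norm hθ (hb.hasDerivAt.div (hasDerivAt_id ‖θ‖) h0)).mul
    ((EuclideanSpace.proj i : E n →L[ℝ] ℝ).hasFDerivAt (x := θ))
  have h2 : (fun x => radialField b x i) = fun x : E n => b ‖x‖ / ‖x‖ * x i :=
    funext fun x => radialField_apply b x i
  rw [h2]
  refine h1.congr_fderiv ?_
  ext v
  have h3 : ∑ j, radialJacobian b θ i j * v j =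
      (deriv b ‖θ‖ - b ‖θ‖ / ‖θ‖) / ‖θ‖ ^ 2 * θ i * (∑ j, θ j * v j) + b ‖θ‖ / ‖θ‖ * v i := by
    simp only [radialJacobian, radialMatrix, Matrix.of_apply, add_mul, Finset.sum_add_distrib,
      Matrix.one_apply, mul_ite, mul_one, mul_zero, ite_mul, zero_mul, Finset.sum_ite_eq,
      Finset.mem_univ, if_true, Finset.mul_sum]
    congr 1
    exact Finset.sum_congr rfl fun j _ => by ring
  have h4 : inner ℝ θ v = ∑ j, θ j * v j := by
    rw [PiLp.inner_apply]
    exact Finset.sum_congr rfl fun j _ => by simp [mul_comm]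
  simp only [add_apply, smul_apply, Pi.div_apply, innerSL_apply_apply,
    smul_eq_mul, sum_apply, PiLp.proj_apply, h3, h4, id]
  field_simp
  ring

theorem sum_proj_single (D : Matrix (Fin n) (Fin n) ℝ) (i j : Fin n) :
    (∑ k, D i k • (EuclideanSpace.proj k : E n →L[ℝ] ℝ))
      (EuclideanSpace.single j 1) = D i j := by
  simp [sum_apply, PiLp.single_apply]

theorem continuousOn_radialField (hbc : ContinuousOn b (Icc 0 r)) (h0 : b 0 = 0) :
    ContinuousOn (radialField (n := n) b) (Metric.ball 0 r) := by
  have hnorm : ContinuousOn (fun θ : E n => b ‖θ‖) (Metric.ball 0 r) :=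
    hbc.comp continuous_norm.continuousOn fun θ hθ => Ico_subset_Icc_self (norm_mem_Ico hθ)
  intro θ hθ
  rcases eq_or_ne θ 0 with rfl | hθ0
  · have h1 : Tendsto (fun θ : E n => |b ‖θ‖|) (𝓝[Metric.ball 0 r] 0) (𝓝 0) := by
      have := (hnorm 0 hθ).abs
      simpa [ContinuousWithinAt, h0] using this
    have h2 : radialField (n := n) b 0 = 0 := by simp [radialField]
    rw [ContinuousWithinAt, h2]
    exact squeeze_zero_norm (fun θ => (norm_radialField h0 θ).le) h1
  · exact ((hnorm θ hθ).div continuous_norm.continuousWithinAt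
      (norm_ne_zero_iff.2 hθ0)).smul continuousWithinAt_id

theorem ae_ne_zero (hn : 1 ≤ n) : ∀ᵐ θ : E n, θ ≠ 0 := by
  have : Nonempty (Fin n) := ⟨⟨0, hn⟩⟩
  simp [ae_iff, measure_singleton]

theorem restrict_ball_diff_zero (hn : 1 ≤ n) :
    volume.restrict (Metric.ball (0 : E n) r \ {0}) = volume.restrict (Metric.ball 0 r) := by
  refine Measure.restrict_congr_set ?_
  filter_upwards [ae_ne_zero hn] with θ hθ
  exact propext ⟨fun h => h.1, fun h => ⟨h, hθ⟩⟩

/-- Measurability of functions of the norm that are continuous on `(0, r)`. -/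
theorem aestronglyMeasurable_comp_norm (hn : 1 ≤ n) {k : ℝ → ℝ} (hk : ContinuousOn k (Ioo 0 r)) :
    AEStronglyMeasurable (fun θ : E n => k ‖θ‖) (volume.restrict (Metric.ball 0 r)) := by
  rw [← restrict_ball_diff_zero hn]
  refine ContinuousOn.aestronglyMeasurable (hk.comp continuous_norm.continuousOn fun θ hθ =>
    norm_mem_Ioo hθ.1 hθ.2) (measurableSet_ball.diff (measurableSet_singleton 0))

theorem aestronglyMeasurable_radialMatrix (hn : 1 ≤ n) {α β : ℝ → ℝ}
    (hα : ContinuousOn α (Ioo 0 r)) (hβ : ContinuousOn β (Ioo 0 r)) (i j : Fin n) :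
    AEStronglyMeasurable (fun θ : E n => radialMatrix (α ‖θ‖) (β ‖θ‖) θ i j)
      (volume.restrict (Metric.ball 0 r)) := by
  have h1 := aestronglyMeasurable_comp_norm hn hα
  have h2 := aestronglyMeasurable_comp_norm hn hβ
  have h3 : Measurable fun θ : E n => θ i * θ j / ‖θ‖ ^ 2 := by fun_prop
  exact ((h1.sub h2).mul h3.aestronglyMeasurable).add (h2.mul_const _)

end RadialField

/-! ### The radial solution belongs to the Sobolev space -/

/-- The density `((1 + b')² + (n - 1) (1 + b/ρ)²) / J` of the part of the radial functional that
involves derivatives. -/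
noncomputable def gradientDensity (n : ℕ) (J b : ℝ → ℝ) (ρ : ℝ) : ℝ :=
  ((1 + deriv b ρ) ^ 2 + ((n : ℝ) - 1) * (1 + b ρ / ρ) ^ 2) / J ρ

theorem radialIntegrand_eq (n : ℕ) (q J b : ℝ → ℝ) (ρ : ℝ) : radialIntegrand n q J b ρ =
    ρ ^ (n - 1) * (q ρ * (b ρ ^ 2 + gradientDensity n J b ρ)) := by
  simp only [radialIntegrand, gradientDensity]
  ring

theorem continuousOn_div_self {r : ℝ} {b : ℝ → ℝ} (hb : ContinuousOn b (Icc 0 r)) :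
    ContinuousOn (fun ρ => b ρ / ρ) (Ioo 0 r) :=
  (hb.mono Ioo_subset_Icc_self).div continuousOn_id fun _ h => h.1.ne'

namespace RadialCoefficients

variable {n : ℕ} {r : ℝ} {q J b : ℝ → ℝ}

theorem continuousOn_gradientDensity (h : RadialCoefficients n r q J)
    (hb : IsRadialSolution n r q J b) : ContinuousOn (gradientDensity n J b) (Ioo 0 r) :=
  (((continuousOn_const.add hb.locallyAC_deriv.continuousOn).pow 2).add
    (continuousOn_const.mul ((continuousOn_const.add
      (continuousOn_div_self hb.continuousOn)).pow 2))).div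
    (h.J_cont.mono Ioo_subset_Ico_self) fun _ ht => (h.J_pos ⟨ht.1.le, ht.2⟩).ne'

theorem gradientDensity_nonneg (h : RadialCoefficients n r q J) {ρ : ℝ} (hρ : ρ ∈ Ioo 0 r) :
    0 ≤ gradientDensity n J b ρ :=
  div_nonneg (add_nonneg (sq_nonneg _) (mul_nonneg h.cast_sub_one_nonneg (sq_nonneg _)))
    (h.J_pos ⟨hρ.1.le, hρ.2⟩).le

theorem integrableOn_gradientDensity (h : RadialCoefficients n r q J)
    (hb : IsRadialSolution n r q J b) :
    IntegrableOn (fun ρ => ρ ^ (n - 1) * (q ρ * gradientDensity n J b ρ)) (Ioo 0 r) := by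
  obtain ⟨B, hB⟩ := h.exists_potential_mul_target_le
  have hE := (h.isFluxSolution hb).integrableOn_energy h.isFluxPair h.isTailBounded_target hB
  refine Integrable.mono' hE (ContinuousOn.aestronglyMeasurable ?_ measurableSet_Ioo) ?_
  · exact (continuousOn_id.pow _).mul ((h.q_cont.mono Ioo_subset_Ico_self).mul
      (h.continuousOn_gradientDensity hb))
  · filter_upwards [ae_restrict_mem measurableSet_Ioo] with ρ hρ
    have hρ0 := hρ.1
    have hq := h.q_pos ρ ⟨hρ.1.le, hρ.2⟩
    have hJ := h.J_pos (ρ := ρ) ⟨hρ.1.le, hρ.2⟩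
    have hg := h.gradientDensity_nonneg (b := b) hρ
    rw [Real.norm_of_nonneg (by positivity), if_pos hρ.2]
    have e : ρ ^ (n - 1) * (q ρ * gradientDensity n J b ρ) + q ρ * ρ ^ (n - 1) * (ρ + b ρ) ^ 2 =
        (fluxWeight n q J ρ * (1 + deriv b ρ)) ^ 2 / fluxWeight n q J ρ +
          potential n q J ρ * (ρ + b ρ) ^ 2 := by
      simp only [gradientDensity, potential, fluxWeight]
      field_simp
      ring
    have e2 : 0 ≤ q ρ * ρ ^ (n - 1) * (ρ + b ρ) ^ 2 := by positivity
    linarith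

theorem exists_bound_of_isRadialSolution (hb : IsRadialSolution n r q J b) :
    ∃ B, ∀ ρ ∈ Icc 0 r, |b ρ| ≤ B :=
  isCompact_Icc.exists_bound_of_continuousOn hb.continuousOn

theorem integrableOn_radialIntegrand (h : RadialCoefficients n r q J)
    (hb : IsRadialSolution n r q J b) : IntegrableOn (radialIntegrand n q J b) (Ioo 0 r) := by
  obtain ⟨B, hB⟩ := exists_bound_of_isRadialSolution hb
  obtain ⟨Q, hQ0, hQ⟩ := h.exists_q_le
  have h1 : IntegrableOn (fun ρ => ρ ^ (n - 1) * (q ρ * b ρ ^ 2)) (Ioo 0 r) := by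
    refine IntegrableOn.of_bound (C := r ^ (n - 1) * (Q * B ^ 2)) measure_Ioo_lt_top
      (ContinuousOn.aestronglyMeasurable ?_ measurableSet_Ioo) ?_
    · exact (continuousOn_id.pow _).mul ((h.q_cont.mono Ioo_subset_Ico_self).mul
        ((hb.continuousOn.mono Ioo_subset_Icc_self).pow 2))
    · filter_upwards [ae_restrict_mem measurableSet_Ioo] with ρ hρ
      have hρ0 := hρ.1.le
      have hρr := hρ.2.le
      have hr := h.r_pos
      have hq := h.q_pos ρ ⟨hρ0, hρ.2⟩
      have hqQ := hQ ρ ⟨hρ0, hρ.2⟩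
      have hbB : b ρ ^ 2 ≤ B ^ 2 := sq_le_sq' (abs_le.1 (hB ρ ⟨hρ0, hρr⟩)).1
        (abs_le.1 (hB ρ ⟨hρ0, hρr⟩)).2
      rw [Real.norm_of_nonneg (by positivity)]
      gcongr
  refine (h1.add (h.integrableOn_gradientDensity hb)).congr_fun (fun ρ _ => ?_) measurableSet_Ioo
  simp only [radialIntegrand_eq, Pi.add_apply]
  ring

theorem integrableOn_ball_gradientDensity (h : RadialCoefficients n r q J)
    (hb : IsRadialSolution n r q J b) :
    IntegrableOn (fun θ : E n => q ‖θ‖ * gradientDensity n J b ‖θ‖) (Metric.ball 0 r) := by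
  have : Nonempty (Fin n) := ⟨⟨0, h.one_le⟩⟩
  have := (integrableOn_fun_norm_addHaar (volume : Measure (E n))
    (f := fun ρ => q ρ * gradientDensity n J b ρ) (r := r)).2 (by
      rw [finrank_euclideanSpace_fin]
      exact h.integrableOn_gradientDensity hb)
  exact this

/-- The sum of the squares of the entries of `I + ∂b/∂θ` for a radial field. -/
theorem sum_sq_one_add_radialJacobian (h : RadialCoefficients n r q J) {θ : E n}
    (hθ : θ ∈ Metric.ball (0 : E n) r) (h0 : θ ≠ 0) :
    ∑ i, ∑ j, (1 + radialJacobian b θ) i j ^ 2 = J ‖θ‖ * gradientDensity n J b ‖θ‖ := by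
  have hJ := h.J_pos (norm_mem_Ico hθ)
  rw [radialJacobian, one_add_radialMatrix, sum_sq_radialMatrix _ _ h0, gradientDensity]
  field_simp

theorem memLp_radialJacobian (h : RadialCoefficients n r q J) {prior : E n → ℝ}
    (hp : RadialPrior r q prior) (hb : IsRadialSolution n r q J b) (i j : Fin n) :
    MemLp (fun θ => radialJacobian b θ i j) 2 (priorMeasure prior) := by
  have := hp.isProbabilityMeasure
  have hmeas : AEStronglyMeasurable (fun θ : E n => (1 + radialJacobian b θ) i j)
      (volume.restrict (Metric.ball 0 r)) := by
    simp only [radialJacobian, one_add_radialMatrix]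
    exact aestronglyMeasurable_radialMatrix h.one_le
      (α := fun ρ => 1 + deriv b ρ) (β := fun ρ => 1 + b ρ / ρ)
      (continuousOn_const.add hb.locallyAC_deriv.continuousOn)
      (continuousOn_const.add (continuousOn_div_self hb.continuousOn)) i j
  obtain ⟨C, hC⟩ := h.J_upper
  have h1 : MemLp (fun θ : E n => (1 + radialJacobian b θ) i j) 2 (priorMeasure prior) := by
    rw [hp.memLp_two_iff hmeas]
    refine Integrable.mono' ((h.integrableOn_ball_gradientDensity hb).const_mul C)
      ((hp.measurable.aestronglyMeasurable).mul (hmeas.pow 2)) ?_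
    filter_upwards [ae_restrict_mem measurableSet_ball, ae_restrict_of_ae (ae_ne_zero h.one_le)]
      with θ hθ h0
    have hpos := hp.pos hθ
    rw [Real.norm_of_nonneg (by positivity)]
    have h2 : (1 + radialJacobian b θ) i j ^ 2 ≤ J ‖θ‖ * gradientDensity n J b ‖θ‖ := by
      rw [← h.sum_sq_one_add_radialJacobian hθ h0]
      have h3 : (1 + radialJacobian b θ) i j ^ 2 ≤ ∑ j, (1 + radialJacobian b θ) i j ^ 2 :=
        Finset.single_le_sum (f := fun j => (1 + radialJacobian b θ) i j ^ 2)
          (fun _ _ => sq_nonneg _) (Finset.mem_univ j)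
      exact h3.trans (Finset.single_le_sum
        (f := fun i => ∑ j, (1 + radialJacobian b θ) i j ^ 2)
        (fun _ _ => Finset.sum_nonneg fun _ _ => sq_nonneg _) (Finset.mem_univ i))
    have h4 := hC _ (norm_mem_Ico hθ)
    have h5 := h.gradientDensity_nonneg (b := b) (norm_mem_Ioo hθ h0)
    rw [hp.eq_profile θ hθ] at hpos ⊢
    calc q ‖θ‖ * (1 + radialJacobian b θ) i j ^ 2 ≤ q ‖θ‖ * (J ‖θ‖ * gradientDensity n J b ‖θ‖) := by
          gcongr
      _ ≤ q ‖θ‖ * (C * gradientDensity n J b ‖θ‖) := by gcongr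
      _ = _ := by ring
  have h2 : MemLp (fun _ : E n => (1 : Matrix (Fin n) (Fin n) ℝ) i j) 2 (priorMeasure prior) :=
    memLp_const _
  refine (h1.sub h2).ae_eq (Eventually.of_forall fun θ => ?_)
  simp [Matrix.add_apply]

theorem hasWeakJacobian_radialField (h : RadialCoefficients n r q J) {prior : E n → ℝ}
    (hp : RadialPrior r q prior) (hb : IsRadialSolution n r q J b) :
    HasWeakJacobian (feasibleSet prior) (radialField b) (radialJacobian (n := n) b) := by
  have hcont : ∀ i, ContinuousOn (fun θ : E n => radialField b θ i) (Metric.ball 0 r) := fun i =>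
    (EuclideanSpace.proj i : E n →L[ℝ] ℝ).continuous.comp_continuousOn
      (continuousOn_radialField hb.continuousOn hb.at_zero)
  rw [hp.feasibleSet_eq]
  have hloc : ∀ i j, LocallyIntegrableOn (fun θ => radialJacobian b θ i j) (Metric.ball (0 : E n) r) :=
    fun i j => hp.locallyIntegrableOn h (h.memLp_radialJacobian hp hb i j)
  refine ⟨fun i => (hcont i).locallyIntegrableOn measurableSet_ball, hloc,
    fun i j φ hφ hcs hsub => ?_⟩
  have := integral_mul_pd_of_hasFDerivAt Metric.isOpen_ball (hcont i)
    (F' := fun θ => ∑ k, radialJacobian b θ i k • (EuclideanSpace.proj k : E n →L[ℝ] ℝ))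
    (fun x hx hx0 => hasFDerivAt_radialField hx0
      (hb.differentiableOn.differentiableAt (isOpen_Ioo.mem_nhds (norm_mem_Ioo hx hx0))) i) j
    (by simpa only [sum_proj_single] using hloc i j) hφ hcs hsub
  simpa only [sum_proj_single] using this

theorem memLp_radialField {prior : E n → ℝ}
    (hp : RadialPrior r q prior) (hb : IsRadialSolution n r q J b) :
    MemLp (radialField (n := n) b) 2 (priorMeasure prior) := by
  have := hp.isProbabilityMeasure
  obtain ⟨B, hB⟩ := exists_bound_of_isRadialSolution hb
  have hmeas : AEStronglyMeasurable (radialField (n := n) b)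
      (volume.restrict (Metric.ball 0 r)) :=
    (continuousOn_radialField hb.continuousOn hb.at_zero).aestronglyMeasurable measurableSet_ball
  refine MemLp.of_bound (hmeas.mono_ac hp.priorMeasure_absolutelyContinuous) B ?_
  refine hp.priorMeasure_absolutelyContinuous.ae_le ?_
  filter_upwards [ae_restrict_mem measurableSet_ball] with θ hθ
  rw [norm_radialField hb.at_zero]
  exact hB _ (Ico_subset_Icc_self (norm_mem_Ico hθ))

theorem memH1_radialField (h : RadialCoefficients n r q J) {prior : E n → ℝ}
    (hp : RadialPrior r q prior) (hb : IsRadialSolution n r q J b) :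
    MemH1 prior (radialField (n := n) b) :=
  ⟨memLp_radialField hp hb, _, h.hasWeakJacobian_radialField hp hb,
    fun i j => h.memLp_radialJacobian hp hb i j⟩

end RadialCoefficients

/-- The surface area of the unit sphere. -/
theorem toSphere_real_univ {n : ℕ} (hn : 1 ≤ n) :
    (volume : Measure (E n)).toSphere.real univ =
      2 * Real.pi ^ ((n : ℝ) / 2) / Real.Gamma ((n : ℝ) / 2) := by
  have : Nonempty (Fin n) := ⟨⟨0, hn⟩⟩
  have hn0 : (0 : ℝ) < n := by exact_mod_cast hn
  have hG : 0 < Real.Gamma ((n : ℝ) / 2) := Real.Gamma_pos_of_pos (by positivity)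
  rw [Measure.toSphere_real_apply_univ, finrank_euclideanSpace_fin, Measure.real,
    EuclideanSpace.volume_ball, Fintype.card_fin, ENNReal.ofReal_one, one_pow, one_mul,
    Real.Gamma_add_one (by positivity), ENNReal.toReal_ofReal (by positivity)]
  have : √Real.pi ^ n = Real.pi ^ ((n : ℝ) / 2) := by
    rw [Real.sqrt_eq_rpow, ← Real.rpow_natCast, ← Real.rpow_mul Real.pi_pos.le]
    congr 1
    ring
  rw [this]
  field_simp

theorem integral_ball_comp_norm {n : ℕ} (hn : 1 ≤ n) {r : ℝ} {k : ℝ → ℝ}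
    (hk : IntegrableOn (fun θ : E n => k ‖θ‖) (Metric.ball 0 r)) :
    ∫ θ in Metric.ball (0 : E n) r, k ‖θ‖ =
      2 * Real.pi ^ ((n : ℝ) / 2) / Real.Gamma ((n : ℝ) / 2) *
        ∫ ρ in Ioo 0 r, ρ ^ (n - 1) * k ρ := by
  rw [(integral_ball_eq_sphereIntegral hn hk).2.1, ← toSphere_real_univ hn, ← integral_const_mul]
  refine setIntegral_congr_fun measurableSet_Ioo fun ρ hρ => ?_
  have h1 := sphereIntegral_mul_left k (fun _ : E n => 1) hρ.1
  simp only [mul_one] at h1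
  have h2 : sphereIntegral (fun _ : E n => 1) ρ = (volume : Measure (E n)).toSphere.real univ := by
    simp [sphereIntegral]
  rw [h1, h2]
  ring

/-! ### Weak derivatives on an interval -/

section Interval

/-- The product rule in integral form, for an absolutely continuous function and a primitive of an
integrable function. -/
theorem integral_mul_primitive_add {V V' k : ℝ → ℝ} {a T s t : ℝ}
    (hk : IntervalIntegrable k volume a T) (hs : s ∈ uIcc a T) (ht : t ∈ uIcc a T)
    (hV : AbsolutelyContinuousOnInterval V s t)
    (hV' : ∀ᵐ x, x ∈ uIoc s t → HasDerivAt V (V' x) x) :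
    ∫ x in s..t, (V' x * (∫ y in a..x, k y) + V x * k x) =
      V t * (∫ y in a..t, k y) - V s * ∫ y in a..s, k y := by
  have hsub : uIcc s t ⊆ uIcc a T := uIcc_subset_uIcc hs ht
  have hY : AbsolutelyContinuousOnInterval (fun x => ∫ y in a..x, k y) s t :=
    (hk.absolutelyContinuousOnInterval_intervalIntegral left_mem_uIcc).mono hsub
  rw [← hV.integral_deriv_mul_eq_sub hY]
  refine intervalIntegral.integral_congr_ae ?_
  filter_upwards [hk.ae_hasDerivAt_integral, hV'] with x h1 h2 hx
  rw [(h1 (hsub (uIoc_subset_uIcc hx)) a left_mem_uIcc).deriv, (h2 hx).deriv]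

theorem exists_eq_zero_of_tsupport_subset {r : ℝ} {g : ℝ → ℝ} (hcs : HasCompactSupport g)
    (hsub : tsupport g ⊆ Ioo 0 r) (hr : 0 < r) : ∃ s₀ s, 0 < s₀ ∧ s₀ < s ∧ s < r ∧
      (∀ t ≤ s₀, g t = 0) ∧ ∀ t, s ≤ t → g t = 0 := by
  rcases (tsupport g).eq_empty_or_nonempty with he | hne
  · have : g = 0 := by rwa [tsupport_eq_empty_iff] at he
    exact ⟨r / 3, r / 2, by linarith, by linarith, by linarith, by simp [this], by simp [this]⟩
  obtain ⟨a, ha, hmin⟩ := hcs.isCompact.exists_isMinOn hne continuousOn_id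
  obtain ⟨b, hb, hmax⟩ := hcs.isCompact.exists_isMaxOn hne continuousOn_id
  have ha' := hsub ha
  have hb' := hsub hb
  obtain ⟨s, hbs, hsr⟩ := exists_between hb'.2
  have hab : a ≤ b := hmin hb
  refine ⟨a / 2, s, half_pos ha'.1, by linarith [ha'.1], hsr, fun t ht => ?_, fun t ht => ?_⟩
  · refine image_eq_zero_of_notMem_tsupport fun hmem => ?_
    have : a ≤ t := hmin hmem
    linarith [ha'.1]
  · refine image_eq_zero_of_notMem_tsupport fun hmem => ?_
    have : t ≤ b := hmax hmem
    linarith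

/-- If `h` has the weak derivative `k` on `[0, r)`, tested against smooth functions that vanish near
`r` and are constant near `0`, then `h` is the primitive of `k` that vanishes at `0`. -/
theorem ae_eq_primitive {r : ℝ} {h k : ℝ → ℝ} (hr : 0 < r) (hh : ∀ s < r, IntegrableOn h (Ioo 0 s))
    (hk : ∀ s < r, IntegrableOn k (Ioo 0 s))
    (htest : ∀ ψ : ℝ → ℝ, ∀ s₀ s c : ℝ, ContDiff ℝ ∞ ψ → 0 < s₀ → s < r →
      (∀ t ≤ s₀, ψ t = c) → (∀ t, s ≤ t → ψ t = 0) →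
      ∫ ρ in Ioo 0 r, deriv ψ ρ * h ρ = -∫ ρ in Ioo 0 r, ψ ρ * k ρ) :
    ∀ᵐ ρ, ρ ∈ Ioo 0 r → h ρ = ∫ t in (0 : ℝ)..ρ, k t := by
  have hkI : ∀ s, 0 ≤ s → s < r → IntervalIntegrable k volume 0 s := fun s hs0 hsr =>
    (intervalIntegrable_iff_integrableOn_Ioo_of_le hs0).2 (hk s hsr)
  set K : ℝ → ℝ := fun ρ => ∫ t in (0 : ℝ)..ρ, k t with hK
  have hKc : ∀ s, 0 ≤ s → s < r → ContinuousOn K (Icc 0 s) := fun s hs0 hsr => by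
    have := intervalIntegral.continuousOn_primitive_interval' (hkI s hs0 hsr) left_mem_uIcc
    rwa [uIcc_of_le hs0] at this
  have hKi : ∀ s < r, IntegrableOn K (Ioo 0 s) := fun s hsr => by
    rcases le_or_gt s 0 with hs | hs
    · rw [Ioo_eq_empty (not_lt.2 hs)]; exact integrableOn_empty
    · exact ((hKc s hs.le hsr).integrableOn_compact isCompact_Icc).mono_set Ioo_subset_Icc_self
  have hloc : LocallyIntegrableOn (fun ρ => h ρ - K ρ) (Ioo 0 r) := by
    intro x hx
    obtain ⟨s, hs, hsr⟩ := exists_between hx.2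
    exact ⟨Ioo 0 s, mem_nhdsWithin_of_mem_nhds (isOpen_Ioo.mem_nhds ⟨hx.1, hs⟩),
      (hh s hsr).sub (hKi s hsr)⟩
  have key := isOpen_Ioo.ae_eq_zero_of_integral_contDiff_smul_eq_zero hloc (fun g hg hcs hsub => by
    obtain ⟨s₀, s', hs₀, hs', hs'r, hg₀, hgs'⟩ := exists_eq_zero_of_tsupport_subset hcs hsub hr
    have hgc : Continuous g := hg.continuous
    have hgi : ∀ a b, IntervalIntegrable g volume a b := fun a b => hgc.intervalIntegrable a b
    -- the primitive of `g` that vanishes near `r`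
    set ψ : ℝ → ℝ := fun t => ∫ y in r..t, g y with hψ
    have hψd : ∀ t, HasDerivAt ψ (g t) t := fun t =>
      intervalIntegral.integral_hasDerivAt_right (hgi _ _)
        (hgc.stronglyMeasurableAtFilter _ _) hgc.continuousAt
    have hψ' : deriv ψ = g := funext fun t => (hψd t).deriv
    have hψs : ContDiff ℝ ∞ ψ := contDiff_infty_iff_deriv.2
      ⟨fun t => (hψd t).differentiableAt, by rwa [hψ']⟩
    have hψ0 : ∀ t, s' ≤ t → ψ t = 0 := fun t ht => by
      refine (intervalIntegral.integral_congr (g := fun _ => 0) fun y hy => ?_).trans (by simp)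
      exact hgs' y ((le_min hs'r.le ht).trans hy.1)
    have hψc : ∀ t ≤ s₀, ψ t = ψ 0 := fun t ht => by
      have e : ψ t - ψ 0 = ∫ y in (0 : ℝ)..t, g y :=
        intervalIntegral.integral_interval_sub_left (hgi _ _) (hgi _ _)
      have e2 : ∫ y in (0 : ℝ)..t, g y = 0 := by
        refine (intervalIntegral.integral_congr (g := fun _ => 0) fun y hy => ?_).trans (by simp)
        exact hg₀ y (hy.2.trans (max_le hs₀.le ht))
      linarith
    have h1 := htest ψ s₀ s' (ψ 0) hψs hs₀ hs'r hψc hψ0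
    rw [hψ'] at h1
    have hs'0 : 0 < s' := hs₀.trans hs'
    have h2 := integral_mul_primitive_add (V := ψ) (V' := g) (hkI s' hs'0.le hs'r) left_mem_uIcc
      right_mem_uIcc ((hψs.of_le (by simp)).contDiffOn.absolutelyContinuousOnInterval)
      (Eventually.of_forall fun x _ => hψd x)
    rw [hψ0 s' le_rfl, intervalIntegral.integral_same, zero_mul, mul_zero, sub_zero,
      intervalIntegral.integral_of_le hs'0.le, integral_Ioc_eq_integral_Ioo] at h2
    have hmul : ∀ {u v : ℝ → ℝ}, Continuous u → IntegrableOn v (Ioo 0 s') →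
        IntegrableOn (fun x => u x * v x) (Ioo 0 s') := fun {u v} hu hv => by
      obtain ⟨C, hC⟩ := isCompact_Icc.exists_bound_of_continuousOn (s := Icc 0 s') hu.continuousOn
      refine Integrable.bdd_mul hv hu.aestronglyMeasurable (c := C) ?_
      filter_upwards [ae_restrict_mem measurableSet_Ioo] with x hx
      exact hC x (Ioo_subset_Icc_self hx)
    have hrestr : ∀ {u v : ℝ → ℝ}, (∀ t, s' ≤ t → u t = 0) →
        ∫ ρ in Ioo 0 r, u ρ * v ρ = ∫ ρ in Ioo 0 s', u ρ * v ρ := fun {u v} hu =>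
      setIntegral_eq_of_subset_of_forall_sdiff_eq_zero measurableSet_Ioo
        (Ioo_subset_Ioo_right hs'r.le) fun x hx => by
          rw [hu x (not_lt.1 fun h => hx.2 ⟨hx.1.1, h⟩), zero_mul]
    rw [hrestr hgs', hrestr hψ0] at h1
    rw [integral_add (hmul hgc (hKi s' hs'r)) (hmul hψs.continuous (hk s' hs'r))] at h2
    have h3 : ∫ x, g x • (h x - K x) = ∫ x in Ioo 0 s', (g x * h x - g x * K x) := by
      rw [← setIntegral_eq_integral_of_forall_compl_eq_zero (s := Ioo 0 s')]
      · refine integral_congr_ae (Eventually.of_forall fun x => ?_)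
        simp only [smul_eq_mul]; ring
      · intro x hx
        rcases le_or_gt x s₀ with h0 | h0
        · rw [hg₀ x h0, zero_smul]
        · rw [hgs' x (not_lt.1 fun h => hx ⟨hs₀.trans h0, h⟩), zero_smul]
    rw [h3, integral_sub (hmul hgc (hh s' hs'r)) (hmul hgc (hKi s' hs'r)), h1]
    linarith)
  filter_upwards [key] with ρ hρ hmem
  exact sub_eq_zero.1 (hρ hmem)

/-- Since `1/|x - c|` is not integrable near the endpoint `c` of an interval, an integrable `κ` cannot
satisfy `m ≤ |x - c| κ x` with a constant `m > 0`. -/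
theorem not_ae_le_abs_sub_mul_of_integrableOn {κ : ℝ → ℝ} {s t c m : ℝ} (hst : s < t)
    (hc : c = s ∨ c = t) (hm : 0 < m) (hκ : IntegrableOn κ (Ioo s t)) :
    ¬ ∀ᵐ x, x ∈ Ioo s t → m ≤ |x - c| * κ x := by
  intro hle
  have hcmem : c ∈ uIcc s t := by rcases hc with rfl | rfl <;> simp
  have hno : ¬ IntervalIntegrable (fun x => (x - c)⁻¹) volume s t := fun hint => by
    rcases intervalIntegrable_sub_inv_iff.1 hint with h | h
    · exact hst.ne h
    · exact h hcmem
  refine hno ((intervalIntegrable_iff_integrableOn_Ioo_of_le hst.le).2 ?_)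
  refine Integrable.mono' (hκ.const_mul m⁻¹) (by fun_prop) ?_
  filter_upwards [ae_restrict_of_ae hle, ae_restrict_mem measurableSet_Ioo] with x hx hxI
  have hx0 : 0 < |x - c| := abs_pos.2 (sub_ne_zero.2 (by
    rcases hc with rfl | rfl
    · exact hxI.1.ne'
    · exact hxI.2.ne))
  rw [norm_inv, Real.norm_eq_abs, inv_le_iff_one_le_mul₀ hx0]
  have := hx hxI
  calc 1 = m⁻¹ * m := (inv_mul_cancel₀ hm.ne').symm
    _ ≤ m⁻¹ * (|x - c| * κ x) := by gcongr
    _ = _ := by ring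

end Interval

/-! ### Spherical averages of a field and of its weak Jacobian -/

/-- The component of the field `f` in the direction of `θ`. -/
noncomputable def radialPart {n : ℕ} (f : E n → E n) (θ : E n) : ℝ := (∑ i, f θ i * θ i) / ‖θ‖

/-- The quadratic form `eᵀ D e` of the matrix field `D` in the direction `e = θ/‖θ‖`. -/
noncomputable def radialEntry {n : ℕ} (D : E n → Matrix (Fin n) (Fin n) ℝ) (θ : E n) : ℝ :=
  (∑ i, ∑ j, θ i * θ j * D θ i j) / ‖θ‖ ^ 2

section Test

variable {n : ℕ} {g : ℝ → ℝ} {s₀ s c : ℝ}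

theorem abs_coord_div_norm_le (θ : E n) (i : Fin n) : |θ i / ‖θ‖| ≤ 1 := by
  rw [abs_div, abs_norm]
  exact div_le_one_of_le₀ (PiLp.norm_apply_le θ i) (norm_nonneg θ)

theorem memLp_radialPart {f : E n → E n} {μ : Measure (E n)}
    (hf : ∀ i, MemLp (fun θ => f θ i) 2 μ) : MemLp (radialPart f) 2 μ := by
  have h1 : MemLp (fun θ : E n => ∑ i, f θ i * (θ i / ‖θ‖)) 2 μ := by
    refine memLp_finsetSum _ fun i _ => (hf i).of_le ((hf i).1.mul ?_) ?_
    · exact Measurable.aestronglyMeasurable (by fun_prop)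
    · refine Eventually.of_forall fun θ => ?_
      rw [norm_mul]
      exact mul_le_of_le_one_right (norm_nonneg _) (abs_coord_div_norm_le θ i)
  refine h1.ae_eq (Eventually.of_forall fun θ => ?_)
  simp only [radialPart, Finset.sum_div, mul_div_assoc]

theorem memLp_radialEntry {D : E n → Matrix (Fin n) (Fin n) ℝ} {μ : Measure (E n)}
    (hD : ∀ i j, MemLp (fun θ => D θ i j) 2 μ) : MemLp (radialEntry D) 2 μ := by
  have h1 : MemLp (fun θ : E n => ∑ i, ∑ j, D θ i j * (θ i / ‖θ‖ * (θ j / ‖θ‖))) 2 μ := by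
    refine memLp_finsetSum _ fun i _ => memLp_finsetSum _ fun j _ =>
      (hD i j).of_le ((hD i j).1.mul ?_) ?_
    · exact Measurable.aestronglyMeasurable (by fun_prop)
    · refine Eventually.of_forall fun θ => ?_
      rw [norm_mul, norm_mul]
      exact mul_le_of_le_one_right (norm_nonneg _) (mul_le_one₀ (abs_coord_div_norm_le θ i)
        (norm_nonneg _) (abs_coord_div_norm_le θ j))
  refine h1.ae_eq (Eventually.of_forall fun θ => ?_)
  simp only [radialEntry, Finset.sum_div]
  refine Finset.sum_congr rfl fun i _ => Finset.sum_congr rfl fun j _ => ?_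
  ring

theorem memLp_sum_diag {D : E n → Matrix (Fin n) (Fin n) ℝ} {μ : Measure (E n)}
    (hD : ∀ i j, MemLp (fun θ => D θ i j) 2 μ) : MemLp (fun θ => ∑ i, D θ i i) 2 μ :=
  memLp_finsetSum _ fun i _ => hD i i

theorem contDiff_comp_norm (hg : ContDiff ℝ ∞ g) (hs₀ : 0 < s₀) (hc : ∀ t ≤ s₀, g t = c) :
    ContDiff ℝ ∞ fun θ : E n => g ‖θ‖ := by
  rw [contDiff_iff_contDiffAt]
  intro θ
  rcases eq_or_ne θ 0 with rfl | h0
  · refine (contDiffAt_const (c := c)).congr_of_eventuallyEq ?_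
    filter_upwards [Metric.ball_mem_nhds (0 : E n) hs₀] with x hx
    exact hc _ (mem_ball_zero_iff.1 hx).le
  · exact hg.contDiffAt.comp θ (contDiffAt_norm ℝ h0)

theorem pd_comp_norm (hg : ContDiff ℝ ∞ g) (hs₀ : 0 < s₀) (hc : ∀ t ≤ s₀, g t = c) (j : Fin n)
    (θ : E n) : pd (fun θ : E n => g ‖θ‖) j θ = deriv g ‖θ‖ / ‖θ‖ * θ j := by
  rcases eq_or_ne θ 0 with rfl | h0
  · have h1 : (fun θ : E n => g ‖θ‖) =ᶠ[𝓝 0] fun _ => c := by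
      filter_upwards [Metric.ball_mem_nhds (0 : E n) hs₀] with x hx
      exact hc _ (mem_ball_zero_iff.1 hx).le
    simp [pd, h1.fderiv_eq]
  · have h1 := hasFDerivAt_comp_norm h0 (hg.differentiable (by simp) ‖θ‖).hasDerivAt
    rw [pd, h1.fderiv, smul_apply, innerSL_single, smul_eq_mul]

theorem tsupport_comp_norm_subset (hs : ∀ t, s ≤ t → g t = 0) (φ : E n → ℝ) :
    tsupport (fun θ : E n => g ‖θ‖ * φ θ) ⊆ Metric.closedBall 0 s := by
  refine closure_minimal (fun θ hθ => ?_) Metric.isClosed_closedBall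
  rw [mem_closedBall_zero_iff]
  by_contra! hcon
  exact hθ (by simp [hs _ hcon.le])

theorem pd_comp_norm_mul_coord (hg : ContDiff ℝ ∞ g) (hs₀ : 0 < s₀) (hc : ∀ t ≤ s₀, g t = c)
    (i j : Fin n) (θ : E n) : pd (fun θ : E n => g ‖θ‖ * (θ i * θ j)) j θ =
      deriv g ‖θ‖ / ‖θ‖ * θ j * (θ i * θ j) +
        g ‖θ‖ * ((1 : Matrix (Fin n) (Fin n) ℝ) i j * θ j + θ i) := by
  have h1 : HasFDerivAt (fun θ : E n => g ‖θ‖) (fderiv ℝ (fun θ : E n => g ‖θ‖) θ) θ :=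
    ((contDiff_comp_norm hg hs₀ hc).differentiable (by simp) θ).hasFDerivAt
  have h2 : ∀ i, HasFDerivAt (fun θ : E n => θ i) (EuclideanSpace.proj i : E n →L[ℝ] ℝ) θ :=
    fun i => (EuclideanSpace.proj i : E n →L[ℝ] ℝ).hasFDerivAt
  have h3 : HasFDerivAt (fun θ : E n => g ‖θ‖ * (θ i * θ j)) _ θ := h1.mul ((h2 i).mul (h2 j))
  have h4 := pd_comp_norm hg hs₀ hc j θ
  rw [pd] at h4 ⊢
  rw [h3.fderiv]
  simp only [add_apply, smul_apply, smul_eq_mul, h4, PiLp.proj_apply, PiLp.single_apply,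
    Matrix.one_apply]
  simp only [if_true]
  ring

theorem integrableOn_comp_norm_mul {k : ℝ → ℝ} {G : E n → ℝ} {r : ℝ} (hk : Continuous k)
    (hk0 : ∀ t, s ≤ t → k t = 0) (hG : IntegrableOn G (Metric.closedBall 0 s)) :
    IntegrableOn (fun θ => k ‖θ‖ * G θ) (Metric.ball 0 r) := by
  have h1 : IntegrableOn (fun θ => k ‖θ‖ * G θ) (Metric.closedBall 0 s) :=
    hG.continuousOn_mul (hk.comp continuous_norm).continuousOn (isCompact_closedBall 0 s)
  refine IntegrableOn.of_forall_sdiff_eq_zero h1 measurableSet_ball fun θ hθ => ?_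
  rw [hk0 _ (le_of_lt (not_le.1 fun h => hθ.2 (mem_closedBall_zero_iff.2 h))), zero_mul]

theorem integral_comp_norm_mul (hn : 1 ≤ n) {k : ℝ → ℝ} {G : E n → ℝ} {r : ℝ} (hk : Continuous k)
    (hk0 : ∀ t, s ≤ t → k t = 0) (hG : IntegrableOn G (Metric.closedBall 0 s)) :
    ∫ θ in Metric.ball 0 r, k ‖θ‖ * G θ =
      ∫ ρ in Ioo 0 r, k ρ * (ρ ^ (n - 1) * sphereIntegral G ρ) := by
  rw [(integral_ball_eq_sphereIntegral hn (integrableOn_comp_norm_mul hk hk0 hG)).2.1]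
  refine setIntegral_congr_fun measurableSet_Ioo fun ρ hρ => ?_
  simp only [sphereIntegral_mul_left k G hρ.1]
  ring

end Test

theorem deriv_eq_zero_of_le {g : ℝ → ℝ} {s : ℝ} (hs : ∀ t, s ≤ t → g t = 0) :
    ∀ t, s ≤ t → deriv g t = 0 := by
  intro t ht
  by_cases hd : DifferentiableAt ℝ g t
  · have h1 : HasDerivWithinAt g 0 (Ici t) t :=
      (hasDerivWithinAt_const t (Ici t) (0 : ℝ)).congr (fun x hx => hs x (ht.trans hx)) (hs t ht)
    exact (uniqueDiffWithinAt_Ici t).eq_deriv _ hd.hasDerivAt.hasDerivWithinAt h1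
  · exact deriv_zero_of_not_differentiableAt hd

section SphereIdentities

variable {n : ℕ} {r : ℝ} {f : E n → E n} {D : E n → Matrix (Fin n) (Fin n) ℝ}

/-- The divergence identity, tested with the function `ψ(‖θ‖)`. -/
theorem integral_deriv_comp_norm_mul_radialPart (hW : HasWeakJacobian (Metric.ball 0 r) f D)
    {ψ : ℝ → ℝ} {s₀ s c : ℝ} (hψ : ContDiff ℝ ∞ ψ) (hs₀ : 0 < s₀) (hsr : s < r)
    (hc : ∀ t ≤ s₀, ψ t = c) (hs : ∀ t, s ≤ t → ψ t = 0) :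
    ∫ θ in Metric.ball 0 r, deriv ψ ‖θ‖ * radialPart f θ =
      -∫ θ in Metric.ball 0 r, ψ ‖θ‖ * ∑ i, D θ i i := by
  have hφ : ContDiff ℝ ∞ fun θ : E n => ψ ‖θ‖ := contDiff_comp_norm hψ hs₀ hc
  have hts : tsupport (fun θ : E n => ψ ‖θ‖) ⊆ Metric.closedBall 0 s := by
    simpa using tsupport_comp_norm_subset hs fun _ : E n => 1
  have hcs : HasCompactSupport fun θ : E n => ψ ‖θ‖ :=
    (isCompact_closedBall 0 s).of_isClosed_subset (isClosed_tsupport _) hts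
  have hsub := hts.trans (Metric.closedBall_subset_ball hsr)
  have h1 : ∀ i, Integrable fun θ : E n => f θ i * pd (fun θ : E n => ψ ‖θ‖) i θ := fun i =>
    integrable_mul_of_tsupport_subset (hW.locallyIntegrable i) (continuous_pd hφ i)
      (hasCompactSupport_pd hcs i) ((tsupport_pd_subset i).trans hsub)
  have h2 : ∀ i, Integrable fun θ : E n => D θ i i * ψ ‖θ‖ := fun i =>
    integrable_mul_of_tsupport_subset (hW.locallyIntegrable_deriv i i) hφ.continuous hcs hsub
  have h3 := Finset.sum_congr rfl fun i (_ : i ∈ Finset.univ) =>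
    hW.integral_eq i i _ hφ hcs hsub
  rw [Finset.sum_neg_distrib, ← integral_finsetSum _ fun i _ => (h1 i).integrableOn,
    ← integral_finsetSum _ fun i _ => (h2 i).integrableOn] at h3
  refine Eq.trans (integral_congr_ae (Eventually.of_forall fun θ => ?_)) (h3.trans (congrArg _
    (integral_congr_ae (Eventually.of_forall fun θ => ?_))))
  · beta_reduce
    simp only [pd_comp_norm hψ hs₀ hc, radialPart, Finset.sum_div, Finset.mul_sum]
    exact Finset.sum_congr rfl fun i _ => by ring
  · beta_reduce
    rw [Finset.mul_sum]
    exact Finset.sum_congr rfl fun i _ => by ring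

/-- The weak derivatives, tested with the functions `g(‖θ‖) θ_i θ_j`. -/
theorem integral_comp_norm_mul_radialEntry (hW : HasWeakJacobian (Metric.ball 0 r) f D)
    {g : ℝ → ℝ} {s₀ s : ℝ} (hg : ContDiff ℝ ∞ g) (hs₀ : 0 < s₀) (hsr : s < r)
    (hc : ∀ t ≤ s₀, g t = 0) (hs : ∀ t, s ≤ t → g t = 0) :
    ∫ θ in Metric.ball 0 r, (deriv g ‖θ‖ * ‖θ‖ ^ 2 + (n + 1) * g ‖θ‖ * ‖θ‖) * radialPart f θ =
      -∫ θ in Metric.ball 0 r, g ‖θ‖ * ‖θ‖ ^ 2 * radialEntry D θ := by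
  have hφ : ∀ i j, ContDiff ℝ ∞ fun θ : E n => g ‖θ‖ * (θ i * θ j) := fun i j =>
    (contDiff_comp_norm hg hs₀ hc).mul (by fun_prop)
  have hts : ∀ i j, tsupport (fun θ : E n => g ‖θ‖ * (θ i * θ j)) ⊆ Metric.closedBall 0 s :=
    fun i j => tsupport_comp_norm_subset hs _
  have hcs : ∀ i j, HasCompactSupport fun θ : E n => g ‖θ‖ * (θ i * θ j) := fun i j =>
    (isCompact_closedBall 0 s).of_isClosed_subset (isClosed_tsupport _) (hts i j)
  have hsub := fun i j => (hts i j).trans (Metric.closedBall_subset_ball hsr)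
  have h1 : ∀ i j, Integrable fun θ : E n =>
      f θ i * pd (fun θ : E n => g ‖θ‖ * (θ i * θ j)) j θ := fun i j =>
    integrable_mul_of_tsupport_subset (hW.locallyIntegrable i) (continuous_pd (hφ i j) j)
      (hasCompactSupport_pd (hcs i j) j) ((tsupport_pd_subset j).trans (hsub i j))
  have h2 : ∀ i j, Integrable fun θ : E n => D θ i j * (g ‖θ‖ * (θ i * θ j)) := fun i j =>
    integrable_mul_of_tsupport_subset (hW.locallyIntegrable_deriv i j) (hφ i j).continuous
      (hcs i j) (hsub i j)
  have h3 := Finset.sum_congr rfl fun i (_ : i ∈ Finset.univ) =>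
    Finset.sum_congr rfl fun j (_ : j ∈ Finset.univ) =>
      hW.integral_eq i j _ (hφ i j) (hcs i j) (hsub i j)
  simp only [Finset.sum_neg_distrib] at h3
  have h1' := fun i => integral_finsetSum (μ := volume.restrict (Metric.ball (0 : E n) r))
    Finset.univ fun j _ => (h1 i j).integrableOn
  have h2' := fun i => integral_finsetSum (μ := volume.restrict (Metric.ball (0 : E n) r))
    Finset.univ fun j _ => (h2 i j).integrableOn
  simp only [← h1', ← h2'] at h3
  rw [← integral_finsetSum _ fun i _ => integrable_finsetSum _ fun j _ => (h1 i j).integrableOn,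
    ← integral_finsetSum _ fun i _ => integrable_finsetSum _ fun j _ => (h2 i j).integrableOn] at h3
  refine Eq.trans (integral_congr_ae (Eventually.of_forall fun θ => ?_)) (h3.trans (congrArg _
    (integral_congr_ae (Eventually.of_forall fun θ => ?_))))
  · beta_reduce
    have e : ∀ i, ∑ j, f θ i * pd (fun θ : E n => g ‖θ‖ * (θ i * θ j)) j θ =
        (deriv g ‖θ‖ / ‖θ‖ * ‖θ‖ ^ 2 + (n + 1) * g ‖θ‖) * (f θ i * θ i) := fun i => by
      have e1 : ∀ j, f θ i * pd (fun θ : E n => g ‖θ‖ * (θ i * θ j)) j θ =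
          deriv g ‖θ‖ / ‖θ‖ * (f θ i * θ i) * θ j ^ 2 +
          g ‖θ‖ * f θ i * ((1 : Matrix (Fin n) (Fin n) ℝ) i j * θ j) + g ‖θ‖ * f θ i * θ i :=
        fun j => by rw [pd_comp_norm_mul_coord hg hs₀ hc]; ring
      simp only [e1, Finset.sum_add_distrib, ← Finset.mul_sum, sum_sq_eq_norm_sq,
        Matrix.one_apply, ite_mul, one_mul, zero_mul, Finset.sum_ite_eq, Finset.mem_univ, if_true,
        Finset.sum_const, Finset.card_univ, Fintype.card_fin, nsmul_eq_mul]
      ring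
    simp only [e, ← Finset.mul_sum, radialPart]
    rcases eq_or_ne ‖θ‖ 0 with h0 | h0
    · have : θ = 0 := norm_eq_zero.1 h0
      simp [this]
    · field_simp
  · beta_reduce
    have e : ∀ i j, D θ i j * (g ‖θ‖ * (θ i * θ j)) = g ‖θ‖ * (θ i * θ j * D θ i j) :=
      fun i j => by ring
    simp only [e, ← Finset.mul_sum, radialEntry]
    rcases eq_or_ne ‖θ‖ 0 with h0 | h0
    · have : θ = 0 := norm_eq_zero.1 h0
      simp [this]
    · field_simp

theorem integrableOn_pow_mul_sphereIntegral (hn : 1 ≤ n) {G : E n → ℝ} {s : ℝ}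
    (hG : IntegrableOn G (Metric.closedBall 0 s)) :
    IntegrableOn (fun ρ => ρ ^ (n - 1) * sphereIntegral G ρ) (Ioo 0 s) :=
  (integral_ball_eq_sphereIntegral hn (hG.mono_set Metric.ball_subset_closedBall)).1

/-- The divergence theorem on balls: the flux of the field through the sphere of radius `ρ` is the
integral of the divergence over the ball. -/
theorem ae_sphereIntegral_radialPart_eq (hn : 1 ≤ n) (hr : 0 < r)
    (hW : HasWeakJacobian (Metric.ball 0 r) f D)
    (hR : ∀ s < r, IntegrableOn (radialPart f) (Metric.closedBall 0 s))
    (hd : ∀ s < r, IntegrableOn (fun θ => ∑ i, D θ i i) (Metric.closedBall 0 s)) :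
    ∀ᵐ ρ, ρ ∈ Ioo 0 r → ρ ^ (n - 1) * sphereIntegral (radialPart f) ρ =
      ∫ t in (0 : ℝ)..ρ, t ^ (n - 1) * sphereIntegral (fun θ => ∑ i, D θ i i) t := by
  refine ae_eq_primitive hr (fun s hs => integrableOn_pow_mul_sphereIntegral hn (hR s hs))
    (fun s hs => integrableOn_pow_mul_sphereIntegral hn (hd s hs)) fun ψ s₀ s c hψ hs₀ hsr hc hs => ?_
  have h1 := integral_deriv_comp_norm_mul_radialPart hW hψ hs₀ hsr hc hs
  rwa [integral_comp_norm_mul hn (hψ.continuous_deriv (by simp)) (deriv_eq_zero_of_le hs) (hR s hsr),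
    integral_comp_norm_mul hn hψ.continuous hs (hd s hsr)] at h1

/-- The divergence theorem on spheres: the tangential part of the field has spherical divergence of
mean zero, so that the mean of the tangential divergence comes from the curvature `(n - 1)/ρ`. -/
theorem ae_sub_one_mul_sphereIntegral_radialPart (hn : 1 ≤ n) (hr : 0 < r)
    (hW : HasWeakJacobian (Metric.ball 0 r) f D)
    (hR : ∀ s < r, IntegrableOn (radialPart f) (Metric.closedBall 0 s))
    (hd : ∀ s < r, IntegrableOn (fun θ => ∑ i, D θ i i) (Metric.closedBall 0 s))
    (he : ∀ s < r, IntegrableOn (radialEntry D) (Metric.closedBall 0 s)) :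
    ∀ᵐ ρ, ρ ∈ Ioo 0 r → ((n : ℝ) - 1) * sphereIntegral (radialPart f) ρ =
      ρ * (sphereIntegral (fun θ => ∑ i, D θ i i) ρ - sphereIntegral (radialEntry D) ρ) := by
  set H := fun ρ => ρ ^ (n - 1) * sphereIntegral (radialPart f) ρ with hH
  set δ := fun ρ => ρ ^ (n - 1) * sphereIntegral (fun θ => ∑ i, D θ i i) ρ with hδ
  set ε := fun ρ => ρ ^ (n - 1) * sphereIntegral (radialEntry D) ρ with hε
  have hHi : ∀ s < r, IntegrableOn H (Ioo 0 s) := fun s hs =>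
    integrableOn_pow_mul_sphereIntegral hn (hR s hs)
  have hδi : ∀ s < r, IntegrableOn δ (Ioo 0 s) := fun s hs =>
    integrableOn_pow_mul_sphereIntegral hn (hd s hs)
  have hεi : ∀ s < r, IntegrableOn ε (Ioo 0 s) := fun s hs =>
    integrableOn_pow_mul_sphereIntegral hn (he s hs)
  have hmul : ∀ {u v : ℝ → ℝ} {s : ℝ}, Continuous u → IntegrableOn v (Ioo 0 s) →
      IntegrableOn (fun x => u x * v x) (Ioo 0 s) := fun {u v s} hu hv => by
    obtain ⟨C, hC⟩ := isCompact_Icc.exists_bound_of_continuousOn (s := Icc 0 s) hu.continuousOn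
    refine Integrable.bdd_mul hv hu.aestronglyMeasurable (c := C) ?_
    filter_upwards [ae_restrict_mem measurableSet_Ioo] with x hx
    exact hC x (Ioo_subset_Icc_self hx)
  have hloc : LocallyIntegrableOn (fun ρ => ((n : ℝ) - 1) * ρ * H ρ + (ρ ^ 2 * ε ρ - ρ ^ 2 * δ ρ))
      (Ioo 0 r) := by
    intro x hx
    obtain ⟨s, hs, hsr⟩ := exists_between hx.2
    exact ⟨Ioo 0 s, mem_nhdsWithin_of_mem_nhds (isOpen_Ioo.mem_nhds ⟨hx.1, hs⟩),
      (hmul (by fun_prop) (hHi s hsr)).add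
        ((hmul (by fun_prop) (hεi s hsr)).sub (hmul (by fun_prop) (hδi s hsr)))⟩
  have key := isOpen_Ioo.ae_eq_zero_of_integral_contDiff_smul_eq_zero hloc (fun g hg hcs hsub => by
    obtain ⟨s₀, s, hs₀, hs, hsr, hg₀, hgs⟩ := exists_eq_zero_of_tsupport_subset hcs hsub hr
    have hgc := hg.continuous
    have hgc' : Continuous (deriv g) := hg.continuous_deriv (by simp)
    have hg' := deriv_eq_zero_of_le hgs
    have hdψ : ∀ t, deriv (fun t => t ^ 2 * g t) t = 2 * t * g t + t ^ 2 * deriv g t := fun t => by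
      have h1 := (hasDerivAt_pow 2 t).fun_mul (hg.differentiable (by simp) t).hasDerivAt
      rw [h1.deriv]
      simp
    -- the two test fields are `ρ² g θ` and `g (θᵀ · ) θ`
    have h1 := integral_deriv_comp_norm_mul_radialPart hW (ψ := fun t => t ^ 2 * g t) (c := 0)
      (by fun_prop) hs₀ hsr (fun t ht => by rw [hg₀ t ht, mul_zero])
      (fun t ht => by rw [hgs t ht, mul_zero])
    simp only [hdψ] at h1
    rw [integral_comp_norm_mul (s := s) hn (k := fun t => 2 * t * g t + t ^ 2 * deriv g t)
        (by fun_prop) (fun t ht => by rw [hgs t ht, hg' t ht]; ring) (hR s hsr),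
      integral_comp_norm_mul (s := s) hn (k := fun t => t ^ 2 * g t) (by fun_prop)
        (fun t ht => by rw [hgs t ht]; ring) (hd s hsr)] at h1
    have h2 := integral_comp_norm_mul_radialEntry hW hg hs₀ hsr hg₀ hgs
    rw [integral_comp_norm_mul (s := s) hn
        (k := fun t => deriv g t * t ^ 2 + (n + 1) * g t * t)
        (by fun_prop) (fun t ht => by rw [hgs t ht, hg' t ht]; ring) (hR s hsr),
      integral_comp_norm_mul (s := s) hn (k := fun t => g t * t ^ 2) (by fun_prop)
        (fun t ht => by rw [hgs t ht]; ring) (he s hsr)] at h2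
    have hrestr : ∀ {u v : ℝ → ℝ}, (∀ t, s ≤ t → u t = 0) →
        ∫ ρ in Ioo 0 r, u ρ * v ρ = ∫ ρ in Ioo 0 s, u ρ * v ρ := fun {u v} hu =>
      setIntegral_eq_of_subset_of_forall_sdiff_eq_zero measurableSet_Ioo
        (Ioo_subset_Ioo_right hsr.le) fun x hx => by
          rw [hu x (not_lt.1 fun h => hx.2 ⟨hx.1.1, h⟩), zero_mul]
    rw [hrestr (fun t ht => by rw [hgs t ht, hg' t ht]; ring),
      hrestr (fun t ht => by rw [hgs t ht]; ring)] at h1 h2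
    rw [← setIntegral_eq_integral_of_forall_compl_eq_zero (s := Ioo 0 s) fun x hx => by
      rcases le_or_gt x s₀ with h0 | h0
      · rw [hg₀ x h0, zero_smul]
      · rw [hgs x (not_lt.1 fun h => hx ⟨hs₀.trans h0, h⟩), zero_smul]]
    have e : ∀ x, g x • (((n : ℝ) - 1) * x * H x + (x ^ 2 * ε x - x ^ 2 * δ x)) =
        ((deriv g x * x ^ 2 + (n + 1) * g x * x) * H x -
          (2 * x * g x + x ^ 2 * deriv g x) * H x) +
        (g x * x ^ 2 * ε x - x ^ 2 * g x * δ x) := fun x => by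
      rw [smul_eq_mul]; ring
    simp only [e]
    rw [integral_add, integral_sub, integral_sub, h1, h2]
    · ring
    all_goals first
      | exact hmul (by fun_prop) (hHi s hsr)
      | exact hmul (by fun_prop) (hεi s hsr)
      | exact hmul (by fun_prop) (hδi s hsr)
      | exact (hmul (by fun_prop) (hHi s hsr)).sub (hmul (by fun_prop) (hHi s hsr))
      | exact (hmul (by fun_prop) (hεi s hsr)).sub (hmul (by fun_prop) (hδi s hsr)))
  filter_upwards [key] with ρ hρ hmem
  have h1 := hρ hmem
  have hρ0 := hmem.1
  simp only [hH, hδ, hε] at h1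
  have h2 : ρ ^ (n - 1) * ρ ≠ 0 := by positivity
  apply mul_left_cancel₀ h2
  linarith

end SphereIdentities

/-! ### The first variation of the radial functional -/

/-- The polarization `⟨f, g⟩ + Tr(A Bᵀ) / J` of the integrand of `Z`, for the Fisher information
matrix `J(‖θ‖) I`. -/
noncomputable def energyPairing {n : ℕ} (J : ℝ → ℝ) (θ f g : E n)
    (A B : Matrix (Fin n) (Fin n) ℝ) : ℝ :=
  ∑ i, f i * g i + (∑ i, ∑ j, A i j * B i j) / J ‖θ‖

section Pairing

variable {n : ℕ} {r : ℝ} {q J b : ℝ → ℝ} {prior : E n → ℝ} {f g : E n → E n}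
  {A B D : E n → Matrix (Fin n) (Fin n) ℝ}

theorem RadialPrior.integrableOn_energyPairing (hp : RadialPrior r q prior)
    (h : RadialCoefficients n r q J)
    (hf : ∀ i, MemLp (fun θ => f θ i) 2 (priorMeasure prior))
    (hg : ∀ i, MemLp (fun θ => g θ i) 2 (priorMeasure prior))
    (hA : ∀ i j, MemLp (fun θ => A θ i j) 2 (priorMeasure prior))
    (hB : ∀ i j, MemLp (fun θ => B θ i j) 2 (priorMeasure prior)) :
    IntegrableOn (fun θ => prior θ * energyPairing J θ (f θ) (g θ) (A θ) (B θ))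
      (Metric.ball 0 r) := by
  obtain ⟨c, hc, hcJ⟩ := h.J_lower
  have h1 : IntegrableOn (fun θ => ∑ i, prior θ * (f θ i * g θ i)) (Metric.ball 0 r) :=
    integrable_finsetSum _ fun i _ => hp.integrableOn_mul (hf i) (hg i)
  have h2 : IntegrableOn (fun θ => ∑ i, ∑ j, prior θ * (A θ i j * B θ i j)) (Metric.ball 0 r) :=
    integrable_finsetSum _ fun i _ => integrable_finsetSum _ fun j _ =>
      hp.integrableOn_mul (hA i j) (hB i j)
  have hJm : AEStronglyMeasurable (fun θ : E n => (J ‖θ‖)⁻¹)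
      (volume.restrict (Metric.ball 0 r)) :=
    aestronglyMeasurable_comp_norm h.one_le ((h.J_cont.mono Ioo_subset_Ico_self).inv₀
      fun t ht => (h.J_pos ⟨ht.1.le, ht.2⟩).ne')
  have h3 : IntegrableOn (fun θ => (J ‖θ‖)⁻¹ * ∑ i, ∑ j, prior θ * (A θ i j * B θ i j))
      (Metric.ball 0 r) := by
    refine Integrable.bdd_mul h2 hJm (c := c⁻¹) ?_
    filter_upwards [ae_restrict_mem measurableSet_ball] with θ hθ
    rw [norm_inv, Real.norm_of_nonneg (h.J_pos (norm_mem_Ico hθ)).le]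
    exact inv_anti₀ hc (hcJ _ (norm_mem_Ico hθ))
  refine (h1.add h3).congr (Eventually.of_forall fun θ => ?_)
  simp only [energyPairing, Pi.add_apply, ← Finset.mul_sum]
  ring

theorem energyPairing_radial (b J : ℝ → ℝ) (f : E n) (D : Matrix (Fin n) (Fin n) ℝ) (θ : E n) :
    energyPairing J θ (radialField b θ) f (1 + radialJacobian b θ) D =
      b ‖θ‖ * radialPart (fun _ => f) θ +
        ((deriv b ‖θ‖ - b ‖θ‖ / ‖θ‖) * radialEntry (fun _ => D) θ +
          (1 + b ‖θ‖ / ‖θ‖) * ∑ i, D i i) / J ‖θ‖ := by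
  rw [energyPairing, radialJacobian, one_add_radialMatrix, sum_radialMatrix_mul]
  simp only [radialField_apply, radialPart, radialEntry]
  have e : ∑ i, b ‖θ‖ / ‖θ‖ * θ i * f i = b ‖θ‖ * ((∑ i, f i * θ i) / ‖θ‖) := by
    rw [Finset.sum_div, Finset.mul_sum]
    exact Finset.sum_congr rfl fun i _ => by ring
  rw [e]
  ring

theorem RadialPrior.ae_integrable_sphere (hp : RadialPrior r q prior) (hn : 1 ≤ n) {G : E n → ℝ}
    (hG : MemLp G 2 (priorMeasure prior)) :
    ∀ᵐ ρ : ℝ, ρ ∈ Ioo 0 r → Integrable (fun ξ : Metric.sphere (0 : E n) 1 => G (ρ • (ξ : E n)))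
      (volume : Measure (E n)).toSphere := by
  have := hp.isProbabilityMeasure
  have h1 := hp.integrable_iff.1 (hG.integrable (by norm_num))
  filter_upwards [(integral_ball_eq_sphereIntegral hn h1).2.2] with ρ hρ hmem
  have hball : ∀ ξ : Metric.sphere (0 : E n) 1, ρ • (ξ : E n) ∈ Metric.ball (0 : E n) r ∧
      ‖ρ • (ξ : E n)‖ = ρ := fun ξ => by
    have : ‖ρ • (ξ : E n)‖ = ρ := by
      rw [norm_smul, norm_eq_of_mem_sphere, mul_one, Real.norm_of_nonneg hmem.1.le]
    exact ⟨by rw [mem_ball_zero_iff, this]; exact hmem.2, this⟩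
  have hn0 : Nonempty (Fin n) := ⟨⟨0, hn⟩⟩
  obtain ⟨ξ₀⟩ : Nonempty (Metric.sphere (0 : E n) 1) :=
    (NormedSpace.sphere_nonempty.2 zero_le_one).to_subtype
  have hq : 0 < q ρ := by
    have := hp.pos (hball ξ₀).1
    rwa [hp.eq_profile _ (hball ξ₀).1, (hball ξ₀).2] at this
  refine ((hρ hmem).const_mul (q ρ)⁻¹).congr (Eventually.of_forall fun ξ => ?_)
  simp only [hp.eq_profile _ (hball ξ).1, (hball ξ).2]
  field_simp

/-- The spherical integrals of a function against the prior density. -/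
theorem RadialPrior.integrableOn_sphereIntegral (hp : RadialPrior r q prior) (hn : 1 ≤ n)
    {G : E n → ℝ} (hG : Integrable G (priorMeasure prior)) :
    IntegrableOn (fun ρ => ρ ^ (n - 1) * (q ρ * sphereIntegral G ρ)) (Ioo 0 r) := by
  have h1 := hp.integrable_iff.1 hG
  have h2 : IntegrableOn (fun θ => q ‖θ‖ * G θ) (Metric.ball 0 r) :=
    h1.congr_fun (fun θ hθ => by simp only [hp.eq_profile θ hθ]) measurableSet_ball
  refine (integral_ball_eq_sphereIntegral hn h2).1.congr_fun (fun ρ hρ => ?_) measurableSet_Ioo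
  simp only [sphereIntegral_mul_left q G hρ.1]

theorem RadialPrior.memLp_one_add_radialJacobian (hp : RadialPrior r q prior)
    (h : RadialCoefficients n r q J) (hb : IsRadialSolution n r q J b) (i j : Fin n) :
    MemLp (fun θ => (1 + radialJacobian b θ) i j) 2 (priorMeasure prior) := by
  have := hp.isProbabilityMeasure
  exact (memLp_const ((1 : Matrix (Fin n) (Fin n) ℝ) i j)).add (h.memLp_radialJacobian hp hb i j)

theorem RadialPrior.memLp_one_add_deriv (hp : RadialPrior r q prior)
    (h : RadialCoefficients n r q J) (hb : IsRadialSolution n r q J b) :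
    MemLp (fun θ : E n => 1 + deriv b ‖θ‖) 2 (priorMeasure prior) := by
  refine (memLp_radialEntry (hp.memLp_one_add_radialJacobian h hb)).ae_eq ?_
  refine hp.priorMeasure_absolutelyContinuous.ae_le ?_
  filter_upwards [ae_restrict_of_ae (ae_ne_zero h.one_le)] with θ hθ
  have h1 : ‖θ‖ ≠ 0 := norm_ne_zero_iff.2 hθ
  rw [radialEntry, radialJacobian, one_add_radialMatrix, sum_mul_radialMatrix _ _ hθ]
  field_simp

theorem RadialPrior.integral_energyPairing_radial (hp : RadialPrior r q prior)
    (h : RadialCoefficients n r q J) (hb : IsRadialSolution n r q J b)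
    (hf : ∀ i, MemLp (fun θ => f θ i) 2 (priorMeasure prior))
    (hD : ∀ i j, MemLp (fun θ => D θ i j) 2 (priorMeasure prior)) :
    ∃ G : ℝ → ℝ, IntegrableOn G (Ioo 0 r) ∧
      ∫ θ in Metric.ball 0 r, prior θ *
        energyPairing J θ (radialField b θ) (f θ) (1 + radialJacobian b θ) (D θ) =
          ∫ ρ in Ioo 0 r, G ρ ∧
      ∀ᵐ ρ, ρ ∈ Ioo 0 r → G ρ = ρ ^ (n - 1) * (q ρ * (b ρ * sphereIntegral (radialPart f) ρ +
        ((deriv b ρ - b ρ / ρ) * sphereIntegral (radialEntry D) ρ +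
          (1 + b ρ / ρ) * sphereIntegral (fun θ => ∑ i, D θ i i) ρ) / J ρ)) := by
  have := hp.isProbabilityMeasure
  set I : E n → ℝ := fun θ => q ‖θ‖ * (b ‖θ‖ * radialPart f θ +
    ((deriv b ‖θ‖ - b ‖θ‖ / ‖θ‖) * radialEntry D θ +
      (1 + b ‖θ‖ / ‖θ‖) * ∑ i, D θ i i) / J ‖θ‖) with hI
  have hIeq : EqOn (fun θ => prior θ *
      energyPairing J θ (radialField b θ) (f θ) (1 + radialJacobian b θ) (D θ)) I
      (Metric.ball 0 r) := fun θ hθ => by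
    simp only [hI, energyPairing_radial, hp.eq_profile θ hθ]
    rfl
  have hint : IntegrableOn I (Metric.ball 0 r) := by
    refine (hp.integrableOn_energyPairing h (f := radialField b) (A := fun θ =>
      1 + radialJacobian b θ) ((h.memH1_radialField hp hb).1.eval_piLp) hf
      (hp.memLp_one_add_radialJacobian h hb) hD).congr_fun hIeq measurableSet_ball
  obtain ⟨h1, h2, -⟩ := integral_ball_eq_sphereIntegral h.one_le hint
  refine ⟨_, h1, by rw [← h2]; exact setIntegral_congr_fun measurableSet_ball hIeq, ?_⟩
  filter_upwards [hp.ae_integrable_sphere h.one_le (memLp_radialPart hf),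
    hp.ae_integrable_sphere h.one_le (memLp_radialEntry hD),
    hp.ae_integrable_sphere h.one_le (memLp_sum_diag hD)] with ρ hR he hd hρ
  have hnorm : ∀ ξ : Metric.sphere (0 : E n) 1, ‖ρ • (ξ : E n)‖ = ρ := fun ξ => by
    rw [norm_smul, norm_eq_of_mem_sphere, mul_one, Real.norm_of_nonneg hρ.1.le]
  congr 1
  simp only [hI, sphereIntegral, hnorm, integral_const_mul]
  congr 1
  have hed := ((he hρ).const_mul (deriv b ρ - b ρ / ρ)).fun_add
    ((hd hρ).const_mul (1 + b ρ / ρ))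
  rw [integral_add ((hR hρ).const_mul _) (hed.div_const _), integral_div,
    integral_add ((he hρ).const_mul _) ((hd hρ).const_mul _)]
  simp only [integral_const_mul]

theorem eq_zero_of_tendsto_right {F κ : ℝ → ℝ} {s t L : ℝ} (hst : s < t)
    (hF : Tendsto F (𝓝[<] t) (𝓝 L)) (hκ : IntegrableOn κ (Ioo s t))
    (hle : ∀ᵐ x, x ∈ Ioo s t → |F x| ≤ |x - t| * κ x) : L = 0 := by
  by_contra hL
  have h1 : ∀ᶠ x in 𝓝[<] t, |L| / 2 < |F x| :=
    hF.abs.eventually (lt_mem_nhds (half_lt_self (abs_pos.2 hL)))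
  obtain ⟨a, hat, ha⟩ := (mem_nhdsLT_iff_exists_Ioo_subset' hst).1 h1
  have hmax : max s a < t := max_lt hst hat
  refine not_ae_le_abs_sub_mul_of_integrableOn hmax (Or.inr rfl) (half_pos (abs_pos.2 hL))
    (hκ.mono_set (Ioo_subset_Ioo_left (le_max_left s a))) ?_
  filter_upwards [hle] with x hx hmem
  have h2 : |L| / 2 < |F x| := ha ⟨(le_max_right s a).trans_lt hmem.1, hmem.2⟩
  exact h2.le.trans (hx ⟨(le_max_left s a).trans_lt hmem.1, hmem.2⟩)

theorem eq_zero_of_tendsto_left {F κ : ℝ → ℝ} {s t L : ℝ} (hst : s < t)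
    (hF : Tendsto F (𝓝[>] s) (𝓝 L)) (hκ : IntegrableOn κ (Ioo s t))
    (hle : ∀ᵐ x, x ∈ Ioo s t → |F x| ≤ |x - s| * κ x) : L = 0 := by
  by_contra hL
  have h1 : ∀ᶠ x in 𝓝[>] s, |L| / 2 < |F x| :=
    hF.abs.eventually (lt_mem_nhds (half_lt_self (abs_pos.2 hL)))
  obtain ⟨a, hat, ha⟩ := (mem_nhdsGT_iff_exists_Ioo_subset' hst).1 h1
  have hmin : s < min t a := lt_min hst hat
  refine not_ae_le_abs_sub_mul_of_integrableOn hmin (Or.inl rfl) (half_pos (abs_pos.2 hL))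
    (hκ.mono_set (Ioo_subset_Ioo_right (min_le_left t a))) ?_
  filter_upwards [hle] with x hx hmem
  have h2 : |L| / 2 < |F x| := ha ⟨hmem.1, hmem.2.trans_le (min_le_right t a)⟩
  exact h2.le.trans (hx ⟨hmem.1, hmem.2.trans_le (min_le_left t a)⟩)

/-- The flux per unit area `(q / J) (1 + b')` of a solution and its derivative. -/
theorem RadialCoefficients.hasDerivAt_surfaceFlux (h : RadialCoefficients n r q J)
    (hb : IsRadialSolution n r q J b) {ρ : ℝ} (hρ : ρ ∈ Ioo 0 r) :
    HasDerivAt (fun t => q t / J t * (1 + deriv b t))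
      (q ρ * b ρ + ((n : ℝ) - 1) * (q ρ / J ρ) * (b ρ / ρ - deriv b ρ) / ρ) ρ := by
  have hW := (h.isFluxSolution hb).hasDerivAt_flux ρ hρ
  have hρ0 := hρ.1
  have hpow : HasDerivAt (fun t : ℝ => t ^ (n - 1)) (((n : ℝ) - 1) * ρ ^ (n - 1) / ρ) ρ := by
    refine (hasDerivAt_pow (n - 1) ρ).congr_deriv ?_
    rcases Nat.eq_or_lt_of_le h.one_le with h1 | h1
    · simp [← h1]
    · obtain ⟨m, rfl⟩ : ∃ m, n = m + 2 := ⟨n - 2, by omega⟩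
      rw [show m + 2 - 1 = m + 1 from rfl, Nat.add_sub_cancel, pow_succ]
      push_cast
      field_simp
      ring
  have h1 := hW.div hpow (pow_pos hρ0 _).ne'
  have e : (fun t => q t / J t * (1 + deriv b t)) =ᶠ[𝓝 ρ]
      (fun ρ => if ρ < r then fluxWeight n q J ρ * (1 + deriv b ρ) else 0) / fun t => t ^ (n - 1) := by
    filter_upwards [isOpen_Ioo.mem_nhds hρ] with t ht
    have := pow_pos ht.1 (n - 1)
    simp only [Pi.div_apply, if_pos ht.2, fluxWeight]
    field_simp
  refine (h1.congr_of_eventuallyEq e).congr_deriv ?_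
  have hJ := h.J_pos (ρ := ρ) ⟨hρ0.le, hρ.2⟩
  rw [mul_sub (potential n q J ρ), h.potential_mul_target hρ, if_pos hρ.2, potential, fluxWeight]
  field_simp
  ring

end Pairing

section FirstVariation

variable {n : ℕ} {r : ℝ} {q J b : ℝ → ℝ} {prior : E n → ℝ} {f : E n → E n}
  {D : E n → Matrix (Fin n) (Fin n) ℝ}

/-- The flux is bounded near `0` in dimension one. -/
theorem RadialCoefficients.exists_abs_surfaceFlux_le (h : RadialCoefficients 1 r q J)
    (hb : IsRadialSolution 1 r q J b) :
    ∃ C, ∀ ρ ∈ Ioo 0 r, |q ρ / J ρ * (1 + deriv b ρ)| ≤ C := by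
  obtain ⟨B, hB⟩ := exists_bound_of_isRadialSolution hb
  obtain ⟨Q, hQ0, hQ⟩ := h.exists_q_le
  refine ⟨Q * B * r, fun ρ hρ => ?_⟩
  have hB0 : 0 ≤ B := (abs_nonneg _).trans (hB r ⟨h.r_pos.le, le_rfl⟩)
  have h1 := (h.isFluxSolution hb).flux_eq h.isFluxPair h.isTailBounded_target ⟨hρ.1, hρ.2.le⟩
  simp only [if_pos hρ.2, fluxWeight, Nat.sub_self, pow_zero, mul_one] at h1
  rw [h1, abs_neg]
  have h2 : ∀ t ∈ uIoc ρ r, t ≠ r → ‖potential 1 q J t * (t + b t - target 1 q J t)‖ ≤ Q * B := by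
    intro t ht htr
    rw [uIoc_of_le hρ.2.le] at ht
    have htI : t ∈ Ioo 0 r := ⟨hρ.1.trans ht.1, lt_of_le_of_ne ht.2 htr⟩
    have hq := h.q_pos t ⟨htI.1.le, htI.2⟩
    have e : potential 1 q J t * (t + b t - target 1 q J t) = q t * b t := by
      rw [mul_sub, h.potential_mul_target htI, potential]
      simp
      ring
    rw [e, norm_mul, Real.norm_of_nonneg hq.le]
    exact mul_le_mul (hQ t ⟨htI.1.le, htI.2⟩) (hB t ⟨htI.1.le, htI.2.le⟩) (abs_nonneg _) hQ0.le
  have h3 := intervalIntegral.norm_integral_le_of_norm_le_const_ae (C := Q * B) (a := ρ) (b := r)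
    (f := fun t => potential 1 q J t * (t + b t - target 1 q J t)) (by
      filter_upwards [Measure.ae_ne volume r] with t ht hmem using h2 t hmem ht)
  refine h3.trans ?_
  rw [abs_of_nonneg (sub_nonneg.2 hρ.2.le)]
  have := hρ.1.le
  gcongr
  linarith

/-- The first variation of the radial functional at the field of a solution vanishes.  By the
divergence theorem on spheres and balls it is the integral over `(0, r)` of the derivative of the
flux `V` times the flux of the variation; the boundary terms vanish since they would otherwise
make an integrable function as large as `1/(r - ρ)` or `1/ρ`. -/
theorem RadialPrior.integral_energyPairing_eq_zero (hp : RadialPrior r q prior)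
    (h : RadialCoefficients n r q J) (hb : IsRadialSolution n r q J b)
    (hf : ∀ i, MemLp (fun θ => f θ i) 2 (priorMeasure prior))
    (hD : ∀ i j, MemLp (fun θ => D θ i j) 2 (priorMeasure prior))
    (hW : HasWeakJacobian (Metric.ball 0 r) f D) :
    ∫ θ in Metric.ball 0 r, prior θ *
      energyPairing J θ (radialField b θ) (f θ) (1 + radialJacobian b θ) (D θ) = 0 := by
  have hn := h.one_le
  have hr := h.r_pos
  have hprob := hp.isProbabilityMeasure
  obtain ⟨jl, hjl, hjJ⟩ := h.J_lower
  obtain ⟨G, hG, hGint, hGeq⟩ := hp.integral_energyPairing_radial h hb hf hD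
  set H := sphereIntegral (radialPart f) with hH
  set δ := sphereIntegral (fun θ => ∑ i, D θ i i) with hδ
  set ε := sphereIntegral (radialEntry D) with hε
  set V : ℝ → ℝ := fun t => q t / J t * (1 + deriv b t) with hV
  set Y : ℝ → ℝ := fun ρ => ∫ t in (0 : ℝ)..ρ, t ^ (n - 1) * δ t with hY
  have hRi : ∀ s < r, IntegrableOn (radialPart f) (Metric.closedBall 0 s) := fun s hs =>
    hp.integrableOn_closedBall h (memLp_radialPart hf) hs
  have hdi : ∀ s < r, IntegrableOn (fun θ => ∑ i, D θ i i) (Metric.closedBall 0 s) := fun s hs =>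
    hp.integrableOn_closedBall h (memLp_sum_diag hD) hs
  have hei : ∀ s < r, IntegrableOn (radialEntry D) (Metric.closedBall 0 s) := fun s hs =>
    hp.integrableOn_closedBall h (memLp_radialEntry hD) hs
  have hYeq : ∀ᵐ ρ, ρ ∈ Ioo 0 r → ρ ^ (n - 1) * H ρ = Y ρ :=
    ae_sphereIntegral_radialPart_eq hn hr hW hRi hdi
  have hHeq : ∀ᵐ ρ, ρ ∈ Ioo 0 r → ((n : ℝ) - 1) * H ρ = ρ * (δ ρ - ε ρ) :=
    ae_sub_one_mul_sphereIntegral_radialPart hn hr hW hRi hdi hei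
  have hki : ∀ t, 0 ≤ t → t < r → IntervalIntegrable (fun t => t ^ (n - 1) * δ t) volume 0 t :=
    fun t ht htr => (intervalIntegrable_iff_integrableOn_Ioo_of_le ht).2
      (integrableOn_pow_mul_sphereIntegral hn (hdi t htr))
  have hVac : LocallyAC V r := by
    refine LocallyAC.of_hasDerivAt (fun t ht => h.hasDerivAt_surfaceFlux hb ht) ?_
    have hqc := h.q_cont.mono (Ioo_subset_Ico_self (a := 0) (b := r))
    have hJc := h.J_cont.mono (Ioo_subset_Ico_self (a := 0) (b := r))
    have hbc := hb.continuousOn.mono (Ioo_subset_Icc_self (a := 0) (b := r))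
    exact (hqc.mul hbc).add (((continuousOn_const.mul (hqc.div hJc fun t ht =>
      (h.J_pos ⟨ht.1.le, ht.2⟩).ne')).mul ((continuousOn_div_self hb.continuousOn).sub
        hb.locallyAC_deriv.continuousOn)).div continuousOn_id fun t ht => ht.1.ne')
  -- the fundamental theorem of calculus for `V Y`
  have hftc : ∀ s t, 0 < s → s ≤ t → t < r → ∫ ρ in s..t, G ρ = V t * Y t - V s * Y s := by
    intro s t hs hst ht
    have ht0 : 0 ≤ t := hs.le.trans hst
    rw [← integral_mul_primitive_add (hki t ht0 ht) (by rw [uIcc_of_le ht0]; exact ⟨hs.le, hst⟩)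
      right_mem_uIcc (hVac s t hs hst ht) (Eventually.of_forall fun x hx => by
        rw [uIoc_of_le hst] at hx
        exact h.hasDerivAt_surfaceFlux hb ⟨hs.trans hx.1, hx.2.trans_lt ht⟩)]
    refine intervalIntegral.integral_congr_ae ?_
    filter_upwards [hGeq, hYeq, hHeq] with ρ h1 h2 h3 hmem
    rw [uIoc_of_le hst] at hmem
    have hρ : ρ ∈ Ioo 0 r := ⟨hs.trans hmem.1, hmem.2.trans_lt ht⟩
    have hρ0 := hρ.1
    have hJρ := h.J_pos (ρ := ρ) ⟨hρ0.le, hρ.2⟩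
    rw [h1 hρ]
    change _ = _ * Y ρ + _
    rw [← h2 hρ]
    have e : ((n : ℝ) - 1) * (q ρ / J ρ) * (b ρ / ρ - deriv b ρ) / ρ * (ρ ^ (n - 1) * H ρ) =
        (q ρ / J ρ) * (b ρ / ρ - deriv b ρ) / ρ * ρ ^ (n - 1) * (ρ * (δ ρ - ε ρ)) := by
      rw [← h3 hρ]; ring
    rw [add_mul (q ρ * b ρ), e]
    simp only [hV]
    field_simp
    ring
  set A : ℝ → ℝ := fun x => ∫ ρ in (0 : ℝ)..x, G ρ with hA
  have hGI : IntervalIntegrable G volume 0 r :=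
    (intervalIntegrable_iff_integrableOn_Ioo_of_le hr.le).2 hG
  have hAc : ContinuousOn A (Icc 0 r) := by
    have := intervalIntegral.continuousOn_primitive_interval' hGI left_mem_uIcc
    rwa [uIcc_of_le hr.le] at this
  have hGI' : ∀ t ∈ Icc 0 r, IntervalIntegrable G volume 0 t := fun t ht =>
    hGI.mono_set (uIcc_subset_uIcc left_mem_uIcc (by rwa [uIcc_of_le hr.le]))
  have hr2 : r / 2 ∈ Ioo 0 r := ⟨half_pos hr, half_lt_self hr⟩
  set C := V (r / 2) * Y (r / 2) - A (r / 2) with hC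
  have hVY : ∀ t ∈ Ioo 0 r, A t + C = V t * Y t := by
    have key : ∀ s t, 0 < s → s ≤ t → t < r → A t - A s = V t * Y t - V s * Y s := by
      intro s t hs hst ht
      rw [← hftc s t hs hst ht]
      exact intervalIntegral.integral_interval_sub_left (hGI' t ⟨hs.le.trans hst, ht.le⟩)
        (hGI' s ⟨hs.le, (hst.trans_lt ht).le⟩)
    intro t ht
    rcases le_total t (r / 2) with h1 | h1
    · have := key t (r / 2) ht.1 h1 hr2.2
      linarith
    · have := key (r / 2) t hr2.1 h1 ht.2
      linarith
  have hlim_r : Tendsto (fun t => V t * Y t) (𝓝[<] r) (𝓝 (A r + C)) := by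
    have h1 : Tendsto A (𝓝[<] r) (𝓝 (A r)) := by
      rw [← nhdsWithin_Ioo_eq_nhdsLT hr]
      exact ((hAc r ⟨hr.le, le_rfl⟩).mono Ioo_subset_Icc_self)
    refine (h1.add_const C).congr' ?_
    filter_upwards [Ioo_mem_nhdsLT hr] with t ht using hVY t ht
  have hlim_0 : Tendsto (fun t => V t * Y t) (𝓝[>] 0) (𝓝 C) := by
    have h1 : Tendsto A (𝓝[>] 0) (𝓝 (A 0)) := by
      rw [← nhdsWithin_Ioo_eq_nhdsGT hr]
      exact ((hAc 0 ⟨le_rfl, hr.le⟩).mono Ioo_subset_Icc_self)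
    have h2 := h1.add_const C
    rw [show A 0 = 0 from intervalIntegral.integral_same, zero_add] at h2
    refine h2.congr' ?_
    filter_upwards [Ioo_mem_nhdsGT hr] with t ht using hVY t ht
  have hWH := (h.isFluxSolution hb).abs_flux_le h.isFluxPair h.isTailBounded_target hr2
  -- at the outer boundary `V` vanishes to first order relative to `q`
  have hend_r : A r + C = 0 := by
    obtain ⟨C₁, hC₁⟩ := hWH
    refine eq_zero_of_tendsto_right hr2.2 hlim_r
      (κ := fun ρ => |C₁| * jl⁻¹ * |ρ ^ (n - 1) * (q ρ * H ρ)|)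
      (((hp.integrableOn_sphereIntegral hn
        ((memLp_radialPart hf).integrable (by norm_num))).mono_set
        (Ioo_subset_Ioo_left hr2.1.le)).abs.const_mul _) ?_
    filter_upwards [hYeq] with ρ hYρ hmem
    have hρ : ρ ∈ Ioo 0 r := ⟨hr2.1.trans hmem.1, hmem.2⟩
    have hρ0 := hρ.1
    have hq := h.q_pos ρ ⟨hρ0.le, hρ.2⟩
    have hJρ := h.J_pos (ρ := ρ) ⟨hρ0.le, hρ.2⟩
    have h1 := hC₁ ρ ⟨hmem.1.le, hmem.2⟩
    rw [if_pos hρ.2] at h1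
    have h2 : V ρ * Y ρ = fluxWeight n q J ρ * (1 + deriv b ρ) * H ρ := by
      rw [← hYρ hρ, hV, fluxWeight]
      ring
    have h3 : (J ρ)⁻¹ ≤ jl⁻¹ := inv_anti₀ hjl (hjJ ρ ⟨hρ0.le, hρ.2⟩)
    have h4 : |ρ - r| = r - ρ := by rw [abs_sub_comm, abs_of_pos (sub_pos.2 hρ.2)]
    have h5 : 0 < r - ρ := sub_pos.2 hρ.2
    rw [h2, abs_mul _ (H ρ), h4, abs_mul (ρ ^ (n - 1)), abs_mul (q ρ), abs_of_pos hq, abs_of_pos (pow_pos hρ0 _)]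
    calc |fluxWeight n q J ρ * (1 + deriv b ρ)| * |H ρ|
        ≤ (|C₁| * (r - ρ) * (q ρ * (J ρ)⁻¹ * ρ ^ (n - 1))) * |H ρ| := by
          gcongr
          refine h1.trans ?_
          rw [fluxWeight, div_eq_mul_inv]
          gcongr
          exact le_abs_self _
      _ ≤ (|C₁| * (r - ρ) * (q ρ * jl⁻¹ * ρ ^ (n - 1))) * |H ρ| := by gcongr
      _ = _ := by ring
  -- at the origin the flux of the variation is smaller by a factor `ρ` than its divergence
  have hend_0 : C = 0 := by
    rcases Nat.eq_or_lt_of_le hn with h1 | h1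
    · subst h1
      obtain ⟨C₁, hC₁⟩ := h.exists_abs_surfaceFlux_le hb
      have hY0 : Tendsto Y (𝓝[>] 0) (𝓝 0) := by
        have h2 := intervalIntegral.continuousOn_primitive_interval'
          (hki (r / 2) hr2.1.le hr2.2) left_mem_uIcc
        rw [uIcc_of_le hr2.1.le] at h2
        have h3 := (h2 0 ⟨le_rfl, hr2.1.le⟩).mono (Ioo_subset_Icc_self (a := 0) (b := r / 2))
        rw [ContinuousWithinAt, nhdsWithin_Ioo_eq_nhdsGT hr2.1, intervalIntegral.integral_same] at h3
        exact h3
      refine tendsto_nhds_unique hlim_0 ?_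
      have h2 : Tendsto (fun t => C₁ * |Y t|) (𝓝[>] 0) (𝓝 0) := by
        simpa using hY0.abs.const_mul C₁
      refine squeeze_zero_norm' ?_ h2
      filter_upwards [Ioo_mem_nhdsGT hr] with t ht
      rw [norm_mul]
      exact mul_le_mul_of_nonneg_right (hC₁ t ht) (abs_nonneg _)
    · have hn1 : (0 : ℝ) < (n : ℝ) - 1 := sub_pos.2 (by exact_mod_cast h1)
      have hprod : Integrable (fun θ => (1 + deriv b ‖θ‖) * (∑ i, D θ i i - radialEntry D θ))
          (priorMeasure prior) :=
        (hp.memLp_one_add_deriv h hb).integrable_mul ((memLp_sum_diag hD).sub (memLp_radialEntry hD))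
      refine eq_zero_of_tendsto_left hr hlim_0 (κ := fun ρ => ((n : ℝ) - 1)⁻¹ * jl⁻¹ *
        |ρ ^ (n - 1) * (q ρ * sphereIntegral
          (fun θ => (1 + deriv b ‖θ‖) * (∑ i, D θ i i - radialEntry D θ)) ρ)|)
        ((hp.integrableOn_sphereIntegral hn hprod).abs.const_mul _) ?_
      filter_upwards [hYeq, hHeq, hp.ae_integrable_sphere hn (memLp_radialEntry hD),
        hp.ae_integrable_sphere hn (memLp_sum_diag hD)] with ρ hYρ hHρ he hd hρ
      have hρ0 := hρ.1
      have hq := h.q_pos ρ ⟨hρ0.le, hρ.2⟩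
      have hJρ := h.J_pos (ρ := ρ) ⟨hρ0.le, hρ.2⟩
      have h3 : (J ρ)⁻¹ ≤ jl⁻¹ := inv_anti₀ hjl (hjJ ρ ⟨hρ0.le, hρ.2⟩)
      have h4 : sphereIntegral (fun θ => (1 + deriv b ‖θ‖) * (∑ i, D θ i i - radialEntry D θ)) ρ =
          (1 + deriv b ρ) * (δ ρ - ε ρ) := by
        rw [sphereIntegral_mul_left (fun t => 1 + deriv b t) _ hρ0]
        congr 1
        exact integral_sub (hd hρ) (he hρ)
      have h5 : V ρ * Y ρ = ρ * (((n : ℝ) - 1)⁻¹ * (J ρ)⁻¹ * (ρ ^ (n - 1) * (q ρ *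
          ((1 + deriv b ρ) * (δ ρ - ε ρ))))) := by
        have h6 : H ρ = ((n : ℝ) - 1)⁻¹ * (ρ * (δ ρ - ε ρ)) := by
          rw [← hHρ hρ, inv_mul_cancel_left₀ hn1.ne']
        rw [← hYρ hρ, h6, hV]
        simp only [div_eq_mul_inv]
        ring
      have h7 : 0 < ((n : ℝ) - 1)⁻¹ := inv_pos.2 hn1
      rw [h4, h5, sub_zero, abs_mul, abs_mul (((n : ℝ) - 1)⁻¹ * (J ρ)⁻¹),
        abs_of_pos (mul_pos h7 (inv_pos.2 hJρ))]
      gcongr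
  rw [hGint, ← integral_Ioc_eq_integral_Ioo, ← intervalIntegral.integral_of_le hr.le]
  change A r = 0
  linarith

end FirstVariation

/-! ### The functional `Z` and its minimizer -/

section WeakJacobian

variable {n : ℕ} {Ω : Set (E n)} {f g : E n → E n} {A B : E n → Matrix (Fin n) (Fin n) ℝ}

theorem HasWeakJacobian.sub (hf : HasWeakJacobian Ω f A) (hg : HasWeakJacobian Ω g B) :
    HasWeakJacobian Ω (fun θ => f θ - g θ) (fun θ => A θ - B θ) where
  locallyIntegrable i := (hf.locallyIntegrable i).sub (hg.locallyIntegrable i)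
  locallyIntegrable_deriv i j :=
    (hf.locallyIntegrable_deriv i j).sub (hg.locallyIntegrable_deriv i j)
  integral_eq i j φ hφ hcs hsub := by
    have h1 : ∀ u : E n → ℝ, LocallyIntegrableOn u Ω →
        IntegrableOn (fun θ => u θ * pd φ j θ) Ω := fun u hu =>
      (integrable_mul_of_tsupport_subset hu (continuous_pd hφ j) (hasCompactSupport_pd hcs j)
        ((tsupport_pd_subset j).trans hsub)).integrableOn
    have h2 : ∀ u : E n → ℝ, LocallyIntegrableOn u Ω → IntegrableOn (fun θ => u θ * φ θ) Ω :=
      fun u hu => (integrable_mul_of_tsupport_subset hu hφ.continuous hcs hsub).integrableOn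
    have e1 : ∫ θ in Ω, (f θ i * pd φ j θ - g θ i * pd φ j θ) =
        (∫ θ in Ω, f θ i * pd φ j θ) - ∫ θ in Ω, g θ i * pd φ j θ :=
      integral_sub (h1 _ (hf.locallyIntegrable i)) (h1 _ (hg.locallyIntegrable i))
    have e2 : ∫ θ in Ω, (A θ i j * φ θ - B θ i j * φ θ) =
        (∫ θ in Ω, A θ i j * φ θ) - ∫ θ in Ω, B θ i j * φ θ :=
      integral_sub (h2 _ (hf.locallyIntegrable_deriv i j)) (h2 _ (hg.locallyIntegrable_deriv i j))
    simp only [PiLp.sub_apply, Matrix.sub_apply, sub_mul]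
    rw [e1, e2, hf.integral_eq i j φ hφ hcs hsub, hg.integral_eq i j φ hφ hcs hsub, neg_sub_neg,
      neg_sub]

theorem HasWeakJacobian.ae_eq (hΩ : IsOpen Ω) (hA : HasWeakJacobian Ω f A)
    (hB : HasWeakJacobian Ω f B) : ∀ᵐ θ ∂volume.restrict Ω, A θ = B θ := by
  have key : ∀ i j, ∀ᵐ θ, θ ∈ Ω → (A θ - B θ) i j = 0 := fun i j => by
    refine hΩ.ae_eq_zero_of_integral_contDiff_smul_eq_zero
      ((hA.sub hB).locallyIntegrable_deriv i j) fun φ hφ hcs hsub => ?_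
    have h1 := (hA.sub hB).integral_eq i j φ hφ hcs hsub
    simp only [sub_self, PiLp.zero_apply, zero_mul, integral_zero] at h1
    rw [← setIntegral_eq_integral_of_forall_compl_eq_zero (s := Ω) fun x hx => by
      rw [image_eq_zero_of_notMem_tsupport fun h => hx (hsub h), zero_smul]]
    simp only [smul_eq_mul, mul_comm (φ _)]
    linarith
  have key' : ∀ᵐ θ, ∀ i j, θ ∈ Ω → (A θ - B θ) i j = 0 :=
    ae_all_iff.2 fun i => ae_all_iff.2 fun j => key i j
  filter_upwards [ae_restrict_mem hΩ.measurableSet, ae_restrict_of_ae key'] with θ hθ hz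
  ext i j
  exact sub_eq_zero.1 (hz i j hθ)

theorem HasWeakJacobian.weakJacobian_ae_eq (hΩ : IsOpen Ω) (hA : HasWeakJacobian Ω f A) :
    ∀ᵐ θ ∂volume.restrict Ω, weakJacobian Ω f θ = A θ := by
  have hex : ∃ D, HasWeakJacobian Ω f D := ⟨A, hA⟩
  rw [weakJacobian, dif_pos hex]
  exact hex.choose_spec.ae_eq hΩ hA

end WeakJacobian

section Minimum

variable {n : ℕ} {r : ℝ} {q J b : ℝ → ℝ} {prior : E n → ℝ} {f g : E n → E n}
  {A B D : E n → Matrix (Fin n) (Fin n) ℝ}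

theorem crb_smul_one {J : ℝ → ℝ} {θ : E n} (hJ : J ‖θ‖ ≠ 0) (f : E n)
    (D : Matrix (Fin n) (Fin n) ℝ) :
    crb (J ‖θ‖ • (1 : Matrix (Fin n) (Fin n) ℝ)) f D = energyPairing J θ f f (1 + D) (1 + D) := by
  have hinv : (J ‖θ‖ • (1 : Matrix (Fin n) (Fin n) ℝ))⁻¹ = (J ‖θ‖)⁻¹ • 1 := by
    refine Matrix.inv_eq_right_inv ?_
    rw [smul_mul_smul_comm, mul_one, mul_inv_cancel₀ hJ, one_smul]
  rw [crb, hinv, energyPairing, mul_smul_comm, mul_one, smul_mul_assoc, Matrix.trace_smul,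
    ← sum_sq_eq_norm_sq]
  simp only [Matrix.trace, Matrix.diag, Matrix.mul_apply, Matrix.transpose_apply, smul_eq_mul,
    ← pow_two]
  ring

theorem energyPairing_self_nonneg {J : ℝ → ℝ} {θ : E n} (hJ : 0 < J ‖θ‖) (f : E n)
    (D : Matrix (Fin n) (Fin n) ℝ) : ‖f‖ ^ 2 ≤ energyPairing J θ f f D D := by
  rw [energyPairing, ← sum_sq_eq_norm_sq]
  simp only [← pow_two]
  have : 0 ≤ (∑ i, ∑ j, D i j ^ 2) / J ‖θ‖ := div_nonneg
    (Finset.sum_nonneg fun _ _ => Finset.sum_nonneg fun _ _ => sq_nonneg _) hJ.le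
  linarith

theorem energyPairing_eq_add (J : ℝ → ℝ) (θ f g : E n) (A B : Matrix (Fin n) (Fin n) ℝ) :
    energyPairing J θ f f (1 + A) (1 + A) = energyPairing J θ g g (1 + B) (1 + B) +
      2 * energyPairing J θ g (f - g) (1 + B) (A - B) +
        energyPairing J θ (f - g) (f - g) (A - B) (A - B) := by
  have e1 : ∀ i, f i * f i = g i * g i + 2 * (g i * (f i - g i)) + (f i - g i) * (f i - g i) :=
    fun i => by ring
  have e2 : ∀ i j, (1 + A) i j * (1 + A) i j = (1 + B) i j * (1 + B) i j +
      2 * ((1 + B) i j * (A i j - B i j)) + (A i j - B i j) * (A i j - B i j) := fun i j => by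
    simp only [Matrix.add_apply]; ring
  simp only [energyPairing, e1, e2, PiLp.sub_apply, Matrix.sub_apply, Finset.sum_add_distrib,
    ← Finset.mul_sum]
  ring

theorem energyPairing_radial_self (h : RadialCoefficients n r q J) {θ : E n}
    (hθ : θ ∈ Metric.ball (0 : E n) r) (hθ0 : θ ≠ 0) (h0 : b 0 = 0) :
    energyPairing J θ (radialField b θ) (radialField b θ) (1 + radialJacobian b θ)
      (1 + radialJacobian b θ) = b ‖θ‖ ^ 2 + gradientDensity n J b ‖θ‖ := by
  have hJ := h.J_pos (norm_mem_Ico hθ)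
  simp only [energyPairing, ← pow_two]
  rw [sum_sq_eq_norm_sq, norm_radialField h0, sq_abs, h.sum_sq_one_add_radialJacobian hθ hθ0,
    mul_div_cancel_left₀ _ hJ.ne']

variable {𝒳 : Type*} [MeasurableSpace 𝒳] {ν : Measure 𝒳} {lik : E n → 𝒳 → ℝ}

theorem RadialPrior.Z_eq (hp : RadialPrior r q prior) (h : RadialCoefficients n r q J)
    (hJ : ∀ θ ∈ Metric.ball (0 : E n) r, fisher ν lik θ = J ‖θ‖ • (1 : Matrix (Fin n) (Fin n) ℝ))
    (hf : MemLp f 2 (priorMeasure prior))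
    (hD : ∀ i j, MemLp (fun θ => D θ i j) 2 (priorMeasure prior))
    (hW : HasWeakJacobian (feasibleSet prior) f D) :
    Z ν prior lik f = ENNReal.ofReal (∫ θ in Metric.ball 0 r,
      prior θ * energyPairing J θ (f θ) (f θ) (1 + D θ) (1 + D θ)) := by
  have := hp.isProbabilityMeasure
  have hD' : ∀ i j, MemLp (fun θ => (1 + D θ) i j) 2 (priorMeasure prior) := fun i j =>
    (memLp_const ((1 : Matrix (Fin n) (Fin n) ℝ) i j)).add (hD i j)
  rw [hp.feasibleSet_eq] at hW
  rw [Z, hp.feasibleSet_eq, ofReal_integral_eq_lintegral_ofReal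
    (hp.integrableOn_energyPairing h hf.eval_piLp hf.eval_piLp hD' hD')]
  · refine lintegral_congr_ae ?_
    filter_upwards [ae_restrict_mem measurableSet_ball, hW.weakJacobian_ae_eq Metric.isOpen_ball]
      with θ hθ hw
    rw [hw, hJ θ hθ, crb_smul_one (h.J_pos (norm_mem_Ico hθ)).ne', mul_comm]
  · filter_upwards [ae_restrict_mem measurableSet_ball] with θ hθ
    exact mul_nonneg (hp.nonneg θ) ((sq_nonneg _).trans
      (energyPairing_self_nonneg (h.J_pos (norm_mem_Ico hθ)) _ _))

theorem RadialPrior.Z_radialField (hp : RadialPrior r q prior) (h : RadialCoefficients n r q J)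
    (hJ : ∀ θ ∈ Metric.ball (0 : E n) r, fisher ν lik θ = J ‖θ‖ • (1 : Matrix (Fin n) (Fin n) ℝ))
    (hb : IsRadialSolution n r q J b) :
    Z ν prior lik (radialField b) = ENNReal.ofReal (radialBound n r q J b) := by
  have hH := h.memH1_radialField hp hb
  have hA := hp.memLp_one_add_radialJacobian h hb
  rw [hp.Z_eq h hJ hH.1 (h.memLp_radialJacobian hp hb) (h.hasWeakJacobian_radialField hp hb)]
  congr 1
  have hint := hp.integrableOn_energyPairing h hH.1.eval_piLp hH.1.eval_piLp hA hA
  have hae : (fun θ => prior θ * energyPairing J θ (radialField b θ) (radialField b θ)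
      (1 + radialJacobian b θ) (1 + radialJacobian b θ)) =ᵐ[volume.restrict (Metric.ball 0 r)]
      fun θ => (fun ρ => q ρ * (b ρ ^ 2 + gradientDensity n J b ρ)) ‖θ‖ := by
    filter_upwards [ae_restrict_mem measurableSet_ball, ae_restrict_of_ae (ae_ne_zero h.one_le)]
      with θ hθ hθ0
    rw [energyPairing_radial_self h hθ hθ0 hb.at_zero, hp.eq_profile θ hθ]
  have hpolar := integral_ball_comp_norm h.one_le
    (k := fun ρ => q ρ * (b ρ ^ 2 + gradientDensity n J b ρ)) (hint.congr hae)
  rw [integral_congr_ae hae, hpolar, radialBound,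
    intervalIntegral.integral_of_le h.r_pos.le, integral_Ioc_eq_integral_Ioo]
  simp only [radialIntegrand_eq]

/-- The value of `Z` exceeds its value at the radial field by the energy of the difference. -/
theorem RadialPrior.exists_Z_eq_add (hp : RadialPrior r q prior) (h : RadialCoefficients n r q J)
    (hJ : ∀ θ ∈ Metric.ball (0 : E n) r, fisher ν lik θ = J ‖θ‖ • (1 : Matrix (Fin n) (Fin n) ℝ))
    (hb : IsRadialSolution n r q J b) (hf : MemH1 prior f) :
    ∃ e : E n → ℝ, IntegrableOn e (Metric.ball 0 r) ∧
      (∀ θ ∈ Metric.ball 0 r, prior θ * ‖f θ - radialField b θ‖ ^ 2 ≤ e θ) ∧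
      Z ν prior lik f = Z ν prior lik (radialField b) +
        ENNReal.ofReal (∫ θ in Metric.ball 0 r, e θ) := by
  have := hp.isProbabilityMeasure
  obtain ⟨hf2, D, hW, hD⟩ := hf
  have hH := h.memH1_radialField hp hb
  have hA := hp.memLp_one_add_radialJacobian h hb
  have hW0 := h.hasWeakJacobian_radialField hp hb
  have hfF : ∀ i, MemLp (fun θ => (f θ - radialField b θ) i) 2 (priorMeasure prior) :=
    (hf2.sub hH.1).eval_piLp
  have hDD : ∀ i j, MemLp (fun θ => (D θ - radialJacobian b θ) i j) 2 (priorMeasure prior) :=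
    fun i j => (hD i j).sub (h.memLp_radialJacobian hp hb i j)
  have i1 := hp.integrableOn_energyPairing h hH.1.eval_piLp hH.1.eval_piLp hA hA
  have i2 := hp.integrableOn_energyPairing h hH.1.eval_piLp hfF hA hDD
  have i3 := hp.integrableOn_energyPairing h hfF hfF hDD hDD
  have hvar := hp.integral_energyPairing_eq_zero h hb hfF hDD (by
    have := hW.sub hW0
    rwa [hp.feasibleSet_eq] at this)
  refine ⟨_, i3, fun θ hθ => mul_le_mul_of_nonneg_left
    (energyPairing_self_nonneg (h.J_pos (norm_mem_Ico hθ)) _ _) (hp.nonneg θ), ?_⟩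
  rw [hp.Z_eq h hJ hf2 hD hW, hp.Z_eq h hJ hH.1 (h.memLp_radialJacobian hp hb) hW0,
    ← ENNReal.ofReal_add]
  · congr 1
    have e : ∀ θ, prior θ * energyPairing J θ (f θ) (f θ) (1 + D θ) (1 + D θ) =
        prior θ * energyPairing J θ (radialField b θ) (radialField b θ) (1 + radialJacobian b θ)
          (1 + radialJacobian b θ) + 2 * (prior θ * energyPairing J θ (radialField b θ)
          (f θ - radialField b θ) (1 + radialJacobian b θ) (D θ - radialJacobian b θ)) +
        prior θ * energyPairing J θ (f θ - radialField b θ) (f θ - radialField b θ)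
          (D θ - radialJacobian b θ) (D θ - radialJacobian b θ) := fun θ => by
      rw [energyPairing_eq_add J θ (f θ) (radialField b θ) (D θ) (radialJacobian b θ)]
      ring
    simp only [e]
    have i12 := i1.fun_add (i2.const_mul 2)
    rw [integral_add i12 i3, integral_add i1 (i2.const_mul 2), integral_const_mul, hvar]
    ring
  all_goals
    refine setIntegral_nonneg measurableSet_ball fun θ hθ => mul_nonneg (hp.nonneg θ)
      ((sq_nonneg _).trans (energyPairing_self_nonneg (h.J_pos (norm_mem_Ico hθ)) _ _))

theorem RadialPrior.Z_radialField_eq_optimalBiasBound (hp : RadialPrior r q prior)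
    (h : RadialCoefficients n r q J)
    (hJ : ∀ θ ∈ Metric.ball (0 : E n) r, fisher ν lik θ = J ‖θ‖ • (1 : Matrix (Fin n) (Fin n) ℝ))
    (hb : IsRadialSolution n r q J b) :
    Z ν prior lik (radialField b) = optimalBiasBound ν prior lik := by
  refine le_antisymm (le_iInf₂ fun f hf => ?_) (iInf₂_le _ (h.memH1_radialField hp hb))
  obtain ⟨e, -, -, he⟩ := hp.exists_Z_eq_add h hJ hb hf
  rw [he]
  exact le_self_add

theorem RadialPrior.ae_eq_radialField (hp : RadialPrior r q prior)
    (h : RadialCoefficients n r q J)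
    (hJ : ∀ θ ∈ Metric.ball (0 : E n) r, fisher ν lik θ = J ‖θ‖ • (1 : Matrix (Fin n) (Fin n) ℝ))
    (hb : IsRadialSolution n r q J b) (hf : MemH1 prior f)
    (hZ : Z ν prior lik f = Z ν prior lik (radialField b)) :
    f =ᵐ[volume.restrict (Metric.ball 0 r)] radialField b := by
  obtain ⟨e, hei, hele, he⟩ := hp.exists_Z_eq_add h hJ hb hf
  have hfin : Z ν prior lik (radialField b) ≠ ⊤ := by
    rw [hp.Z_radialField h hJ hb]
    exact ENNReal.ofReal_ne_top
  have he0 : ∀ θ ∈ Metric.ball (0 : E n) r, 0 ≤ e θ := fun θ hθ =>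
    (mul_nonneg (hp.nonneg θ) (sq_nonneg _)).trans (hele θ hθ)
  have h1 : ENNReal.ofReal (∫ θ in Metric.ball 0 r, e θ) = 0 := by
    rw [hZ] at he
    refine (ENNReal.add_right_inj hfin).1 ?_
    rw [← he, add_zero]
  have h2 : ∫ θ in Metric.ball 0 r, e θ = 0 := le_antisymm (ENNReal.ofReal_eq_zero.1 h1)
    (setIntegral_nonneg measurableSet_ball he0)
  have h3 := (setIntegral_eq_zero_iff_of_nonneg_ae (by
    filter_upwards [ae_restrict_mem measurableSet_ball] with θ hθ using he0 θ hθ) hei).1 h2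
  filter_upwards [h3, ae_restrict_mem measurableSet_ball] with θ hθ hmem
  have h4 := hele θ hmem
  rw [hθ, Pi.zero_apply] at h4
  have h5 : ‖f θ - radialField b θ‖ ^ 2 ≤ 0 := by
    by_contra! hcon
    linarith [mul_pos (hp.pos hmem) hcon]
  have h6 : ‖f θ - radialField b θ‖ = 0 := by
    have := le_antisymm h5 (sq_nonneg _)
    exact pow_eq_zero_iff two_ne_zero |>.1 this
  exact sub_eq_zero.1 (norm_eq_zero.1 h6)

end Minimum

/-! ### The score and the information inequality -/

/-- Bessel's inequality for a square-integrable random variable `A` and an orthogonal family of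
centred random variables `T i` of variance `j`. -/
theorem sq_integral_add_sum_sq_div_le {Ω : Type*} [MeasurableSpace Ω] {P : Measure Ω}
    [IsProbabilityMeasure P] {n : ℕ} {A : Ω → ℝ} {T : Fin n → Ω → ℝ} {j : ℝ} (hj : 0 < j)
    (hA : MemLp A 2 P) (hT : ∀ i, MemLp (T i) 2 P) (hmean : ∀ i, ∫ x, T i x ∂P = 0)
    (hcov : ∀ i k, ∫ x, T i x * T k x ∂P = j * (1 : Matrix (Fin n) (Fin n) ℝ) i k) :
    (∫ x, A x ∂P) ^ 2 + (∑ i, (∫ x, A x * T i x ∂P) ^ 2) / j ≤ ∫ x, A x ^ 2 ∂P := by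
  set m := ∫ x, A x ∂P with hm
  set c : Fin n → ℝ := fun i => (∫ x, A x * T i x ∂P) / j with hc
  set U : Ω → ℝ := fun x => ∑ i, c i * T i x with hU
  have hUL : MemLp U 2 P := memLp_finsetSum _ fun i _ => (hT i).const_mul (c i)
  have iA := hA.integrable (by norm_num : (1 : ℝ≥0∞) ≤ 2)
  have iU := hUL.integrable (by norm_num : (1 : ℝ≥0∞) ≤ 2)
  have iT := fun i => (hT i).integrable (by norm_num : (1 : ℝ≥0∞) ≤ 2)
  have iAA : Integrable (fun x => A x ^ 2) P := hA.integrable_sq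
  have iUU : Integrable (fun x => U x ^ 2) P := hUL.integrable_sq
  have iAU : Integrable (fun x => A x * U x) P := hA.integrable_mul hUL
  have iAT : ∀ i, Integrable (fun x => A x * T i x) P := fun i => hA.integrable_mul (hT i)
  have iTT : ∀ i k, Integrable (fun x => T i x * T k x) P := fun i k => (hT i).integrable_mul (hT k)
  have eU : ∫ x, U x ∂P = 0 := by
    simp only [hU]
    rw [integral_finsetSum _ fun i _ => (iT i).const_mul _]
    simp [integral_const_mul, hmean]
  have eAU : ∫ x, A x * U x ∂P = j * ∑ i, c i ^ 2 := by
    have e : ∀ x, A x * U x = ∑ i, c i * (A x * T i x) := fun x => by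
      rw [hU, Finset.mul_sum]
      exact Finset.sum_congr rfl fun i _ => by ring
    simp only [e]
    rw [integral_finsetSum _ fun i _ => (iAT i).const_mul _, Finset.mul_sum]
    refine Finset.sum_congr rfl fun i _ => ?_
    rw [integral_const_mul, hc]
    field_simp
  have eUU : ∫ x, U x ^ 2 ∂P = j * ∑ i, c i ^ 2 := by
    have e : ∀ x, U x ^ 2 = ∑ i, ∑ k, c i * c k * (T i x * T k x) := fun x => by
      rw [hU, pow_two, Finset.sum_mul_sum]
      exact Finset.sum_congr rfl fun i _ => Finset.sum_congr rfl fun k _ => by ring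
    simp only [e]
    rw [integral_finsetSum _ fun i _ => integrable_finsetSum _ fun k _ => (iTT i k).const_mul _,
      Finset.mul_sum]
    refine Finset.sum_congr rfl fun i _ => ?_
    rw [integral_finsetSum _ fun k _ => (iTT i k).const_mul _]
    simp only [integral_const_mul, hcov, Matrix.one_apply, mul_ite, mul_one, mul_zero,
      Finset.sum_ite_eq, Finset.mem_univ, if_true]
    ring
  have h0 : 0 ≤ ∫ x, (A x - m - U x) ^ 2 ∂P := integral_nonneg fun x => sq_nonneg _
  have e : ∀ x, (A x - m - U x) ^ 2 =
      A x ^ 2 + U x ^ 2 - 2 * (A x * U x) - 2 * m * A x + 2 * m * U x + m ^ 2 := fun x => by ring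
  have i1 := iAA.fun_add iUU
  have i2 : Integrable (fun x => A x ^ 2 + U x ^ 2 - 2 * (A x * U x)) P :=
    i1.sub (iAU.const_mul 2)
  have i3 : Integrable (fun x => A x ^ 2 + U x ^ 2 - 2 * (A x * U x) - 2 * m * A x) P :=
    i2.sub (iA.const_mul (2 * m))
  have i4 := i3.fun_add (iU.const_mul (2 * m))
  simp only [e] at h0
  rw [integral_add i4 (integrable_const _), integral_add i3 (iU.const_mul _),
    integral_sub i2 (iA.const_mul _), integral_sub i1 (iAU.const_mul _), integral_add iAA iUU,
    integral_const_mul, integral_const_mul, integral_const_mul, eU, eAU, eUU, ← hm] at h0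
  simp only [integral_const, probReal_univ, one_smul] at h0
  have e2 : (∑ i, (∫ x, A x * T i x ∂P) ^ 2) / j = j * ∑ i, c i ^ 2 := by
    simp only [hc, div_pow, ← Finset.sum_div]
    field_simp
  rw [e2]
  nlinarith

section Score

variable {n : ℕ} {𝒳 : Type*} [MeasurableSpace 𝒳] {ν : Measure 𝒳} {prior : E n → ℝ}
  {lik : E n → 𝒳 → ℝ} {θ : E n}

/-- The score `∂ log p/∂θ_i`, with value `0` where the density vanishes. -/
noncomputable def score (lik : E n → 𝒳 → ℝ) (θ : E n) (i : Fin n) (x : 𝒳) : ℝ :=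
  pd (fun η => lik η x) i θ / lik θ x

/-- The distribution of the measurement under the parameter `θ`. -/
noncomputable def likMeasure (ν : Measure 𝒳) (lik : E n → 𝒳 → ℝ) (θ : E n) : Measure 𝒳 :=
  ν.withDensity fun x => ENNReal.ofReal (lik θ x)

namespace IsRegularSetting

theorem measurable_lik (hreg : IsRegularSetting ν prior lik) (θ : E n) : Measurable (lik θ) :=
  hreg.lik_measurable.comp measurable_prodMk_left

theorem hasFDerivAt_lik (hreg : IsRegularSetting ν prior lik) (hθ : θ ∈ feasibleSet prior) (x : 𝒳) :
    HasFDerivAt (fun η => lik η x) (fderiv ℝ (fun η => lik η x) θ) θ :=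
  (((hreg.lik_contDiffOn x).differentiableOn (by simp)).differentiableAt
    (hreg.isOpen_feasibleSet.mem_nhds hθ)).hasFDerivAt

theorem continuousOn_pd_lik (hreg : IsRegularSetting ν prior lik) (x : 𝒳) (i : Fin n) :
    ContinuousOn (fun θ => pd (fun η => lik η x) i θ) (feasibleSet prior) :=
  ((hreg.lik_contDiffOn x).continuousOn_fderiv_of_isOpen hreg.isOpen_feasibleSet
    (by simp)).clm_apply continuousOn_const

theorem measurable_pd_lik (hreg : IsRegularSetting ν prior lik) (hθ : θ ∈ feasibleSet prior)
    (i : Fin n) : Measurable fun x => pd (fun η => lik η x) i θ := by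
  set v : E n := EuclideanSpace.single i 1
  have hlim : ∀ x, Tendsto (fun k : ℕ => ((k : ℝ) + 1) *
      (lik (θ + ((k : ℝ) + 1)⁻¹ • v) x - lik θ x)) atTop (𝓝 (pd (fun η => lik η x) i θ)) := by
    intro x
    have h1 := (hreg.hasFDerivAt_lik hθ x).hasLineDerivAt v
    rw [HasLineDerivAt, hasDerivAt_iff_tendsto_slope_zero] at h1
    have h2 : Tendsto (fun k : ℕ => ((k : ℝ) + 1)⁻¹) atTop (𝓝[≠] 0) := by
      refine tendsto_nhdsWithin_iff.2 ⟨?_, Eventually.of_forall fun k => ?_⟩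
      · simpa using tendsto_one_div_add_atTop_nhds_zero_nat (𝕜 := ℝ)
      · exact inv_ne_zero (by positivity)
    refine (h1.comp h2).congr fun k => ?_
    simp
  refine measurable_of_tendsto_metrizable (fun k => ?_) (tendsto_pi_nhds.2 hlim)
  exact (((hreg.measurable_lik _).sub (hreg.measurable_lik _)).const_mul _)

/-- A zero of the density is a minimum with respect to the parameter. -/
theorem pd_lik_eq_zero (hreg : IsRegularSetting ν prior lik) (hθ : θ ∈ feasibleSet prior) {x : 𝒳}
    (hx : lik θ x = 0) (i : Fin n) : pd (fun η => lik η x) i θ = 0 := by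
  have hmin : IsLocalMin (fun η => lik η x) θ := by
    filter_upwards [hreg.isOpen_feasibleSet.mem_nhds hθ] with η hη
    rw [hx]
    exact hreg.lik_nonneg η hη x
  rw [pd, hmin.fderiv_eq_zero, zero_apply]

theorem score_mul_lik (hreg : IsRegularSetting ν prior lik) (hθ : θ ∈ feasibleSet prior)
    (i : Fin n) (x : 𝒳) : lik θ x * score lik θ i x = pd (fun η => lik η x) i θ := by
  by_cases hx : lik θ x = 0
  · rw [hx, zero_mul, hreg.pd_lik_eq_zero hθ hx]
  · rw [score, mul_div_cancel₀ _ hx]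

theorem pd_log_lik (hreg : IsRegularSetting ν prior lik) (hθ : θ ∈ feasibleSet prior)
    (i : Fin n) {x : 𝒳} (hx : lik θ x ≠ 0) :
    pd (fun η => Real.log (lik η x)) i θ = score lik θ i x := by
  rw [pd, ((hreg.hasFDerivAt_lik hθ x).log hx).fderiv, smul_apply, score, pd, smul_eq_mul,
    div_eq_inv_mul]

theorem fisherIntegrand_eq (hreg : IsRegularSetting ν prior lik) (hθ : θ ∈ feasibleSet prior)
    (i j : Fin n) (x : 𝒳) :
    pd (fun η => Real.log (lik η x)) i θ * pd (fun η => Real.log (lik η x)) j θ * lik θ x =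
      lik θ x * (score lik θ i x * score lik θ j x) := by
  by_cases hx : lik θ x = 0
  · simp [hx]
  · rw [hreg.pd_log_lik hθ i hx, hreg.pd_log_lik hθ j hx, mul_comm]

theorem measurable_score (hreg : IsRegularSetting ν prior lik) (hθ : θ ∈ feasibleSet prior)
    (i : Fin n) : Measurable (score lik θ i) :=
  (hreg.measurable_pd_lik hθ i).div (hreg.measurable_lik θ)

theorem isProbabilityMeasure_likMeasure (hreg : IsRegularSetting ν prior lik)
    (hθ : θ ∈ feasibleSet prior) : IsProbabilityMeasure (likMeasure ν lik θ) :=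
  ⟨by rw [likMeasure, withDensity_apply _ MeasurableSet.univ, Measure.restrict_univ,
    hreg.lik_lintegral θ hθ]⟩

theorem integrable_likMeasure_iff (hreg : IsRegularSetting ν prior lik)
    (hθ : θ ∈ feasibleSet prior) {g : 𝒳 → ℝ} : Integrable g (likMeasure ν lik θ) ↔
      Integrable (fun x => lik θ x * g x) ν := by
  rw [likMeasure, integrable_withDensity_iff_integrable_smul'
    (hreg.measurable_lik θ).ennreal_ofReal (by simp)]
  refine integrable_congr (Eventually.of_forall fun x => ?_)
  simp [ENNReal.toReal_ofReal (hreg.lik_nonneg θ hθ x)]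

theorem integral_likMeasure (hreg : IsRegularSetting ν prior lik)
    (hθ : θ ∈ feasibleSet prior) (g : 𝒳 → ℝ) :
    ∫ x, g x ∂(likMeasure ν lik θ) = ∫ x, lik θ x * g x ∂ν := by
  rw [likMeasure, integral_withDensity_eq_integral_toReal_smul
    (hreg.measurable_lik θ).ennreal_ofReal (by simp)]
  refine integral_congr_ae (Eventually.of_forall fun x => ?_)
  simp [ENNReal.toReal_ofReal (hreg.lik_nonneg θ hθ x)]

theorem memLp_score (hreg : IsRegularSetting ν prior lik) (hθ : θ ∈ feasibleSet prior)
    (i : Fin n) : MemLp (score lik θ i) 2 (likMeasure ν lik θ) := by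
  rw [memLp_two_iff_integrable_sq (hreg.measurable_score hθ i).aestronglyMeasurable,
    hreg.integrable_likMeasure_iff hθ]
  refine (hreg.fisher_integrable θ hθ i i).congr (Eventually.of_forall fun x => ?_)
  simp only [hreg.fisherIntegrand_eq hθ, pow_two]

theorem integral_score_mul_score (hreg : IsRegularSetting ν prior lik)
    (hθ : θ ∈ feasibleSet prior) (i j : Fin n) :
    ∫ x, score lik θ i x * score lik θ j x ∂(likMeasure ν lik θ) = fisher ν lik θ i j := by
  rw [hreg.integral_likMeasure hθ, fisher, Matrix.of_apply]
  simp only [hreg.fisherIntegrand_eq hθ]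

theorem integrable_pd_lik (hreg : IsRegularSetting ν prior lik) (hθ : θ ∈ feasibleSet prior)
    (i : Fin n) : Integrable (fun x => pd (fun η => lik η x) i θ) ν := by
  have := hreg.isProbabilityMeasure_likMeasure hθ
  have h1 := (hreg.integrable_likMeasure_iff hθ).1
    ((hreg.memLp_score hθ i).integrable (by norm_num))
  simpa only [hreg.score_mul_lik hθ] using h1

theorem integrable_lik (hreg : IsRegularSetting ν prior lik) (hθ : θ ∈ feasibleSet prior) :
    Integrable (lik θ) ν := by
  have := hreg.isProbabilityMeasure_likMeasure hθ
  have h1 := (hreg.integrable_likMeasure_iff hθ).1 (integrable_const (1 : ℝ))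
  simpa using h1

theorem integral_lik (hreg : IsRegularSetting ν prior lik) (hθ : θ ∈ feasibleSet prior) :
    ∫ x, lik θ x ∂ν = 1 := by
  have := hreg.isProbabilityMeasure_likMeasure hθ
  have h1 := hreg.integral_likMeasure hθ fun _ => 1
  simpa using h1.symm

/-- The score has mean zero, by differentiating the total mass of the density. -/
theorem integral_pd_lik (hreg : IsRegularSetting ν prior lik) (hθ : θ ∈ feasibleSet prior)
    (i : Fin n) : ∫ x, pd (fun η => lik η x) i θ ∂ν = 0 := by
  have h1 := hreg.exchange (fun _ => 1) measurable_const i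
    (fun θ hθ => by simpa using hreg.integrable_lik hθ)
    (fun θ hθ => by simpa using hreg.integrable_pd_lik hθ i) θ hθ
  simp only [one_mul] at h1
  have h2 : (fun η => ∫ x, lik η x ∂ν) =ᶠ[𝓝 θ] fun _ => (1 : ℝ) := by
    filter_upwards [hreg.isOpen_feasibleSet.mem_nhds hθ] with η hη using hreg.integral_lik hη
  exact h1.unique (((hasFDerivAt_const (1 : ℝ) θ).hasLineDerivAt _).congr_of_eventuallyEq h2)

end IsRegularSetting

end Score

/-! ### The bias of an estimator -/

section Functional

variable {n : ℕ}

theorem clm_eq_sum_proj (L : E n →L[ℝ] ℝ) :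
    L = ∑ i, L (EuclideanSpace.single i 1) • (EuclideanSpace.proj i : E n →L[ℝ] ℝ) := by
  ext v
  conv_lhs => rw [← (EuclideanSpace.basisFun (Fin n) ℝ).sum_repr v]
  simp [sum_apply, mul_comm]

theorem norm_clm_le_sum (L : E n →L[ℝ] ℝ) : ‖L‖ ≤ ∑ i, |L (EuclideanSpace.single i 1)| := by
  refine L.opNorm_le_bound (Finset.sum_nonneg fun _ _ => abs_nonneg _) fun v => ?_
  conv_lhs => rw [clm_eq_sum_proj L]
  simp only [sum_apply, smul_apply, PiLp.proj_apply, smul_eq_mul]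
  refine (norm_sum_le _ _).trans ?_
  rw [Finset.sum_mul]
  refine Finset.sum_le_sum fun i _ => ?_
  rw [norm_mul, Real.norm_eq_abs]
  exact mul_le_mul_of_nonneg_left (PiLp.norm_apply_le v i) (abs_nonneg _)

end Functional

section Estimator

variable {n : ℕ} {𝒳 : Type*} [MeasurableSpace 𝒳] {ν : Measure 𝒳} {prior : E n → ℝ}
  {lik : E n → 𝒳 → ℝ} {est : 𝒳 → E n} {θ : E n} {r : ℝ}

/-- The bias `E{est(x); θ} - θ` of an estimator. -/
noncomputable def estimatorBias (ν : Measure 𝒳) (lik : E n → 𝒳 → ℝ) (est : 𝒳 → E n) (θ : E n) :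
    E n :=
  WithLp.toLp 2 fun j => ∫ x, est x j * lik θ x ∂ν - θ j

/-- The Jacobian of the bias, obtained by differentiating under the integral sign. -/
noncomputable def biasJacobian (ν : Measure 𝒳) (lik : E n → 𝒳 → ℝ) (est : 𝒳 → E n) (θ : E n) :
    Matrix (Fin n) (Fin n) ℝ :=
  Matrix.of (fun j i => ∫ x, est x j * pd (fun η => lik η x) i θ ∂ν) - 1

namespace IsEstimator

theorem measurable_apply (hest : IsEstimator ν prior lik est) (j : Fin n) :
    Measurable fun x => est x j :=
  (by fun_prop : Measurable fun θ : E n => θ j).comp hest.measurable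

theorem exists_bound (hest : IsEstimator ν prior lik est) :
    ∃ g : 𝒳 → ℝ, Integrable g ν ∧ ∀ᵐ x ∂ν, ∀ θ ∈ feasibleSet prior, ∀ j,
      ‖est x j • fderiv ℝ (fun η => lik η x) θ‖ ≤ g x := by
  obtain ⟨g, hg, hle⟩ := hest.dominated
  refine ⟨fun x => n * g x, hg.const_mul _, ?_⟩
  filter_upwards [hle] with x hx θ hθ j
  refine (norm_clm_le_sum _).trans ?_
  have key : ∀ i, |(est x j • fderiv ℝ (fun η => lik η x) θ) (EuclideanSpace.single i 1)| ≤ g x := by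
    intro i
    refine le_trans ?_ (hx θ hθ)
    refine Real.le_sqrt_of_sq_le ?_
    rw [sq_abs, smul_apply, smul_eq_mul, mul_comm]
    exact (Finset.single_le_sum (f := fun j => (pd (fun η => lik η x) i θ * est x j) ^ 2)
      (fun _ _ => sq_nonneg _) (Finset.mem_univ j)).trans (Finset.single_le_sum
        (f := fun i => ∑ j, (pd (fun η => lik η x) i θ * est x j) ^ 2)
        (fun _ _ => Finset.sum_nonneg fun _ _ => sq_nonneg _) (Finset.mem_univ i))
  refine (Finset.sum_le_sum fun i _ => key i).trans ?_
  simp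

theorem hasFDerivAt_mul_lik (hreg : IsRegularSetting ν prior lik) (hθ : θ ∈ feasibleSet prior)
    (j : Fin n) (x : 𝒳) : HasFDerivAt (fun η => est x j * lik η x)
      (est x j • fderiv ℝ (fun η => lik η x) θ) θ :=
  (hreg.hasFDerivAt_lik hθ x).const_mul _

theorem measurable_mul_lik (hest : IsEstimator ν prior lik est)
    (hreg : IsRegularSetting ν prior lik) (θ : E n) (j : Fin n) :
    Measurable fun x => est x j * lik θ x :=
  (hest.measurable_apply j).mul (hreg.measurable_lik θ)

/-- By the mean value theorem, the estimator has finite expectation for every parameter as soon as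
it has for one. -/
theorem integrable_mul_lik (hest : IsEstimator ν prior lik est)
    (hreg : IsRegularSetting ν prior lik) (hconv : Convex ℝ (feasibleSet prior)) {θ₀ : E n}
    (hθ₀ : θ₀ ∈ feasibleSet prior) (j : Fin n) (h₀ : Integrable (fun x => est x j * lik θ₀ x) ν)
    (hθ : θ ∈ feasibleSet prior) : Integrable (fun x => est x j * lik θ x) ν := by
  obtain ⟨g, hg, hle⟩ := hest.exists_bound
  refine Integrable.mono' (h₀.norm.add (hg.mul_const ‖θ - θ₀‖))
    (hest.measurable_mul_lik hreg θ j).aestronglyMeasurable ?_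
  filter_upwards [hle] with x hx
  have h1 := hconv.norm_image_sub_le_of_norm_hasFDerivWithin_le (C := g x)
    (fun η hη => (hasFDerivAt_mul_lik (est := est) hreg hη j x).hasFDerivWithinAt)
    (fun η hη => hx η hη j) hθ₀ hθ
  have h2 := norm_le_norm_add_norm_sub' (est x j * lik θ x) (est x j * lik θ₀ x)
  simp only [Pi.add_apply]
  linarith

theorem aestronglyMeasurable_smul_fderiv (hest : IsEstimator ν prior lik est)
    (hreg : IsRegularSetting ν prior lik) (hθ : θ ∈ feasibleSet prior) (j : Fin n) :
    AEStronglyMeasurable (fun x => est x j • fderiv ℝ (fun η => lik η x) θ) ν := by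
  have e : (fun x => est x j • fderiv ℝ (fun η => lik η x) θ) = fun x => ∑ i,
      (est x j * pd (fun η => lik η x) i θ) • (EuclideanSpace.proj i : E n →L[ℝ] ℝ) := by
    funext x
    conv_lhs => rw [clm_eq_sum_proj (fderiv ℝ (fun η => lik η x) θ)]
    simp only [Finset.smul_sum, smul_smul, pd]
  rw [e]
  refine Finset.aestronglyMeasurable_fun_sum _ fun i _ => ?_
  exact ((hest.measurable_apply j).mul (hreg.measurable_pd_lik hθ i)).aestronglyMeasurable.smul_const
    _

theorem integrable_smul_fderiv (hest : IsEstimator ν prior lik est)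
    (hreg : IsRegularSetting ν prior lik) (hθ : θ ∈ feasibleSet prior) (j : Fin n) :
    Integrable (fun x => est x j • fderiv ℝ (fun η => lik η x) θ) ν := by
  obtain ⟨g, hg, hle⟩ := hest.exists_bound
  refine Integrable.mono' hg (hest.aestronglyMeasurable_smul_fderiv hreg hθ j) ?_
  filter_upwards [hle] with x hx using hx θ hθ j

theorem integral_smul_fderiv_apply (hest : IsEstimator ν prior lik est)
    (hreg : IsRegularSetting ν prior lik) (hθ : θ ∈ feasibleSet prior) (j i : Fin n) :
    (∫ x, est x j • fderiv ℝ (fun η => lik η x) θ ∂ν) (EuclideanSpace.single i 1) =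
      ∫ x, est x j * pd (fun η => lik η x) i θ ∂ν := by
  rw [ContinuousLinearMap.integral_apply (hest.integrable_smul_fderiv hreg hθ j)]
  rfl

theorem hasFDerivAt_mean (hest : IsEstimator ν prior lik est)
    (hreg : IsRegularSetting ν prior lik) (j : Fin n)
    (hint : ∀ θ ∈ feasibleSet prior, Integrable (fun x => est x j * lik θ x) ν)
    (hθ : θ ∈ feasibleSet prior) : HasFDerivAt (fun θ => ∫ x, est x j * lik θ x ∂ν)
      (∫ x, est x j • fderiv ℝ (fun η => lik η x) θ ∂ν) θ := by
  obtain ⟨g, hg, hle⟩ := hest.exists_bound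
  refine hasFDerivAt_integral_of_dominated_of_fderiv_le
    (F' := fun θ x => est x j • fderiv ℝ (fun η => lik η x) θ)
    (hreg.isOpen_feasibleSet.mem_nhds hθ)
    (Eventually.of_forall fun η => (hest.measurable_mul_lik hreg η j).aestronglyMeasurable)
    (hint θ hθ) (hest.aestronglyMeasurable_smul_fderiv hreg hθ j) ?_ hg
    (Eventually.of_forall fun x η hη => hasFDerivAt_mul_lik hreg hη j x)
  filter_upwards [hle] with x hx η hη using hx η hη j

theorem continuousOn_integral_mul_pd (hest : IsEstimator ν prior lik est)
    (hreg : IsRegularSetting ν prior lik) (j i : Fin n) : ContinuousOn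
      (fun θ => ∫ x, est x j * pd (fun η => lik η x) i θ ∂ν) (feasibleSet prior) := by
  obtain ⟨g, hg, hle⟩ := hest.exists_bound
  refine continuousOn_of_dominated (fun θ hθ => ((hest.measurable_apply j).mul
    (hreg.measurable_pd_lik hθ i)).aestronglyMeasurable) (fun θ hθ => ?_) hg
    (Eventually.of_forall fun x => continuousOn_const.mul (hreg.continuousOn_pd_lik x i))
  filter_upwards [hle] with x hx
  have h1 := (est x j • fderiv ℝ (fun η => lik η x) θ).le_opNorm (EuclideanSpace.single i 1)
  rw [PiLp.norm_single, norm_one, mul_one] at h1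
  exact h1.trans (hx θ hθ j)

theorem exists_norm_integral_smul_fderiv_le (hest : IsEstimator ν prior lik est) :
    ∃ C, ∀ θ ∈ feasibleSet prior, ∀ j,
      ‖∫ x, est x j • fderiv ℝ (fun η => lik η x) θ ∂ν‖ ≤ C := by
  obtain ⟨g, hg, hle⟩ := hest.exists_bound
  refine ⟨∫ x, g x ∂ν, fun θ hθ j => norm_integral_le_of_norm_le hg ?_⟩
  filter_upwards [hle] with x hx using hx θ hθ j

/-- The bias of an estimator with finite expectation belongs to the Sobolev space. -/
theorem bias_mem (hest : IsEstimator ν prior lik est)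
    (hreg : IsRegularSetting ν prior lik) (hball : feasibleSet prior = Metric.ball 0 r)
    (hac : priorMeasure prior ≪ volume.restrict (Metric.ball 0 r))
    [IsProbabilityMeasure (priorMeasure prior)]
    (hint : ∀ j, ∀ θ ∈ feasibleSet prior, Integrable (fun x => est x j * lik θ x) ν) :
    MemLp (estimatorBias ν lik est) 2 (priorMeasure prior) ∧
    HasWeakJacobian (feasibleSet prior) (estimatorBias ν lik est) (biasJacobian ν lik est) ∧
    ∀ i j, MemLp (fun θ => biasJacobian ν lik est θ i j) 2 (priorMeasure prior) := by
  obtain ⟨C, hC⟩ := hest.exists_norm_integral_smul_fderiv_le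
  have hderiv : ∀ j, ∀ θ ∈ feasibleSet prior, HasFDerivAt (fun θ => estimatorBias ν lik est θ j)
      (∫ x, est x j • fderiv ℝ (fun η => lik η x) θ ∂ν - (EuclideanSpace.proj j : E n →L[ℝ] ℝ)) θ :=
    fun j θ hθ => (hest.hasFDerivAt_mean hreg j (hint j) hθ).sub
      (EuclideanSpace.proj j : E n →L[ℝ] ℝ).hasFDerivAt
  have hcont : ∀ j, ContinuousOn (fun θ => estimatorBias ν lik est θ j) (feasibleSet prior) :=
    fun j θ hθ => (hderiv j θ hθ).continuousAt.continuousWithinAt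
  have happly : ∀ θ ∈ feasibleSet prior, ∀ i j,
      (∫ x, est x j • fderiv ℝ (fun η => lik η x) θ ∂ν - (EuclideanSpace.proj j : E n →L[ℝ] ℝ))
        (EuclideanSpace.single i 1) = biasJacobian ν lik est θ j i := fun θ hθ i j => by
    rw [sub_apply, hest.integral_smul_fderiv_apply hreg hθ, biasJacobian, Matrix.sub_apply,
      Matrix.of_apply, PiLp.proj_apply, PiLp.single_apply, Matrix.one_apply]
  have hJcont : ∀ j i, ContinuousOn (fun θ => biasJacobian ν lik est θ j i) (feasibleSet prior) :=
    fun j i => (hest.continuousOn_integral_mul_pd hreg j i).sub continuousOn_const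
  have hJloc : ∀ j i, LocallyIntegrableOn (fun θ => biasJacobian ν lik est θ j i)
      (feasibleSet prior) := fun j i =>
    (hJcont j i).locallyIntegrableOn hreg.isOpen_feasibleSet.measurableSet
  have hnorm : ∀ j, ∀ θ ∈ feasibleSet prior, ‖∫ x, est x j • fderiv ℝ (fun η => lik η x) θ ∂ν -
      (EuclideanSpace.proj j : E n →L[ℝ] ℝ)‖ ≤ C + 1 := fun j θ hθ => by
    refine (norm_sub_le _ _).trans (add_le_add (hC θ hθ j) ?_)
    refine ContinuousLinearMap.opNorm_le_bound _ zero_le_one fun v => ?_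
    rw [one_mul]
    exact PiLp.norm_apply_le v j
  have hae : ∀ {p : E n → Prop}, (∀ θ ∈ feasibleSet prior, p θ) →
      ∀ᵐ θ ∂(priorMeasure prior), p θ := fun {p} hp => by
    refine hac.ae_le ?_
    filter_upwards [ae_restrict_mem measurableSet_ball] with θ hθ
    exact hp θ (by rwa [hball])
  have hmeas : ∀ {g : E n → ℝ}, ContinuousOn g (feasibleSet prior) →
      AEStronglyMeasurable g (priorMeasure prior) := fun {g} hg => by
    rw [hball] at hg
    exact (hg.aestronglyMeasurable measurableSet_ball).mono_ac hac
  refine ⟨?_, ⟨fun i => (hcont i).locallyIntegrableOn hreg.isOpen_feasibleSet.measurableSet, hJloc,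
    fun j i φ hφ hcs hsub => ?_⟩, fun j i => ?_⟩
  · rw [memLp_piLp_iff]
    intro j
    refine MemLp.of_bound (hmeas (hcont j)) (|estimatorBias ν lik est 0 j| + (C + 1) * r)
      (hae fun θ hθ => ?_)
    have hr : ‖θ‖ ≤ r := by
      rw [hball] at hθ
      exact (mem_ball_zero_iff.1 hθ).le
    have h0 : (0 : E n) ∈ feasibleSet prior := by
      rw [hball] at hθ ⊢
      exact Metric.mem_ball_self ((norm_nonneg θ).trans_lt (mem_ball_zero_iff.1 hθ))
    have h1 := (show Convex ℝ (feasibleSet prior) by rw [hball]; exact convex_ball 0 r)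
      |>.norm_image_sub_le_of_norm_hasFDerivWithin_le
        (fun η hη => (hderiv j η hη).hasFDerivWithinAt) (hnorm j) h0 hθ
    have h2 := norm_le_norm_add_norm_sub' (estimatorBias ν lik est θ j)
      (estimatorBias ν lik est 0 j)
    rw [sub_zero] at h1
    have h3 : 0 ≤ C + 1 := (norm_nonneg _).trans (hnorm j θ hθ)
    have h4 : (C + 1) * ‖θ‖ ≤ (C + 1) * r := mul_le_mul_of_nonneg_left hr h3
    rw [Real.norm_eq_abs (estimatorBias ν lik est 0 j)] at h2
    linarith
  · have h1 := integral_mul_pd_of_hasFDerivAt hreg.isOpen_feasibleSet (hcont j)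
      (fun x hx _ => hderiv j x hx) i (((hJcont j i).congr fun θ hθ =>
        happly θ hθ i j).locallyIntegrableOn hreg.isOpen_feasibleSet.measurableSet) hφ hcs hsub
    rw [h1]
    congr 1
    refine setIntegral_congr_fun hreg.isOpen_feasibleSet.measurableSet fun θ hθ => ?_
    simp only [happly θ hθ i j]
  · refine MemLp.of_bound (hmeas (hJcont j i)) (C + 1) (hae fun θ hθ => ?_)
    rw [← happly θ hθ i j]
    refine (ContinuousLinearMap.le_opNorm _ _).trans ?_
    rw [PiLp.norm_single, norm_one, mul_one]
    exact hnorm j θ hθ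

end IsEstimator

end Estimator

/-! ### The mean-squared error -/

section MeanSquaredError

variable {n : ℕ} {𝒳 : Type*} [MeasurableSpace 𝒳] {ν : Measure 𝒳} {prior : E n → ℝ}
  {lik : E n → 𝒳 → ℝ} {est : 𝒳 → E n} {θ : E n} {r : ℝ} {q J : ℝ → ℝ}

namespace IsEstimator

theorem memLp_sub_apply (hest : IsEstimator ν prior lik est)
    (hreg : IsRegularSetting ν prior lik) (hθ : θ ∈ feasibleSet prior)
    (hint : Integrable (fun x => lik θ x * ‖est x - θ‖ ^ 2) ν) (j : Fin n) :
    MemLp (fun x => est x j - θ j) 2 (likMeasure ν lik θ) := by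
  have hm : AEStronglyMeasurable (fun x => est x - θ) (likMeasure ν lik θ) :=
    (hest.measurable.sub_const θ).aestronglyMeasurable
  have h1 : MemLp (fun x => est x - θ) 2 (likMeasure ν lik θ) := by
    rw [memLp_two_iff_integrable_sq_norm hm]
    exact (hreg.integrable_likMeasure_iff hθ).2 hint
  exact h1.eval_piLp j

theorem integrable_mul_lik_of_integrable_sq (hest : IsEstimator ν prior lik est)
    (hreg : IsRegularSetting ν prior lik) (hθ : θ ∈ feasibleSet prior)
    (hint : Integrable (fun x => lik θ x * ‖est x - θ‖ ^ 2) ν) (j : Fin n) :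
    Integrable (fun x => est x j * lik θ x) ν := by
  have := hreg.isProbabilityMeasure_likMeasure hθ
  have h1 := (hest.memLp_sub_apply hreg hθ hint j).integrable (by norm_num)
  have h2 := (hreg.integrable_likMeasure_iff hθ).1 (h1.add (integrable_const (θ j)))
  refine h2.congr (Eventually.of_forall fun x => ?_)
  simp only [Pi.add_apply, sub_add_cancel]
  ring

/-- The Cramér–Rao inequality for a biased estimator, when the Fisher information matrix is a
multiple of the identity. -/
theorem energyPairing_bias_le (hest : IsEstimator ν prior lik est)
    (hreg : IsRegularSetting ν prior lik) (hθ : θ ∈ feasibleSet prior) (hJ : 0 < J ‖θ‖)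
    (hfisher : fisher ν lik θ = J ‖θ‖ • (1 : Matrix (Fin n) (Fin n) ℝ))
    (hint : Integrable (fun x => lik θ x * ‖est x - θ‖ ^ 2) ν) :
    energyPairing J θ (estimatorBias ν lik est θ) (estimatorBias ν lik est θ)
      (1 + biasJacobian ν lik est θ) (1 + biasJacobian ν lik est θ) ≤
        ∫ x, lik θ x * ‖est x - θ‖ ^ 2 ∂ν := by
  have := hreg.isProbabilityMeasure_likMeasure hθ
  have hA := hest.memLp_sub_apply hreg hθ hint
  have hmean : ∀ i, ∫ x, score lik θ i x ∂(likMeasure ν lik θ) = 0 := fun i => by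
    rw [hreg.integral_likMeasure hθ]
    simp only [hreg.score_mul_lik hθ, hreg.integral_pd_lik hθ]
  have hcov : ∀ i k, ∫ x, score lik θ i x * score lik θ k x ∂(likMeasure ν lik θ) =
      J ‖θ‖ * (1 : Matrix (Fin n) (Fin n) ℝ) i k := fun i k => by
    rw [hreg.integral_score_mul_score hθ, hfisher, Matrix.smul_apply, smul_eq_mul]
  have hb : ∀ j, ∫ x, (est x j - θ j) ∂(likMeasure ν lik θ) = estimatorBias ν lik est θ j := by
    intro j
    have h1 := hest.integrable_mul_lik_of_integrable_sq hreg hθ hint j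
    rw [hreg.integral_likMeasure hθ]
    have e : ∀ x, lik θ x * (est x j - θ j) = est x j * lik θ x - θ j * lik θ x := fun x => by ring
    simp only [e]
    rw [integral_sub h1 ((hreg.integrable_lik hθ).const_mul _), integral_const_mul,
      hreg.integral_lik hθ, mul_one, estimatorBias]
  have hD : ∀ j i, ∫ x, (est x j - θ j) * score lik θ i x ∂(likMeasure ν lik θ) =
      (1 + biasJacobian ν lik est θ) j i := by
    intro j i
    have h1 : Integrable (fun x => est x j * pd (fun η => lik η x) i θ) ν := by
      have h2 := (hreg.integrable_likMeasure_iff hθ).1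
        (((hA j).integrable_mul (hreg.memLp_score hθ i)).add
          (((hreg.memLp_score hθ i).integrable (by norm_num)).const_mul (θ j)))
      refine h2.congr (Eventually.of_forall fun x => ?_)
      simp only [Pi.add_apply, Pi.mul_apply, ← hreg.score_mul_lik hθ]
      ring
    rw [hreg.integral_likMeasure hθ, biasJacobian, add_sub_cancel, Matrix.of_apply]
    have e : ∀ x, lik θ x * ((est x j - θ j) * score lik θ i x) =
        est x j * pd (fun η => lik η x) i θ - θ j * pd (fun η => lik η x) i θ := fun x => by
      rw [← hreg.score_mul_lik hθ]; ring
    simp only [e]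
    rw [integral_sub h1 ((hreg.integrable_pd_lik hθ i).const_mul _), integral_const_mul,
      hreg.integral_pd_lik hθ, mul_zero, sub_zero]
  have key := fun j => sq_integral_add_sum_sq_div_le hJ (hA j) (hreg.memLp_score hθ) hmean hcov
  simp only [hb, hD] at key
  have hsum : ∑ j, ∫ x, (est x j - θ j) ^ 2 ∂(likMeasure ν lik θ) =
      ∫ x, lik θ x * ‖est x - θ‖ ^ 2 ∂ν := by
    rw [← integral_finsetSum _ fun j _ => (hA j).integrable_sq, hreg.integral_likMeasure hθ]
    simp only [← sum_sq_eq_norm_sq, PiLp.sub_apply]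
  rw [← hsum, energyPairing]
  simp only [← pow_two]
  rw [Finset.sum_div, ← Finset.sum_add_distrib]
  exact Finset.sum_le_sum fun j _ => key j

theorem bayesMSE_eq [SFinite ν] (hest : IsEstimator ν prior lik est)
    (hreg : IsRegularSetting ν prior lik) : bayesMSE ν prior lik est =
      ∫⁻ θ in feasibleSet prior, ENNReal.ofReal (prior θ) *
        ∫⁻ x, ENNReal.ofReal (lik θ x * ‖est x - θ‖ ^ 2) ∂ν := by
  have hm : Measurable fun z : E n × 𝒳 =>
      ENNReal.ofReal (‖est z.2 - z.1‖ ^ 2 * (lik z.1 z.2 * prior z.1)) := by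
    refine Measurable.ennreal_ofReal ?_
    exact (((hest.measurable.comp measurable_snd).sub measurable_fst).norm.pow_const 2).mul
      (hreg.lik_measurable.mul (hreg.prior_measurable.comp measurable_fst))
  rw [bayesMSE, lintegral_prod _ hm.aemeasurable, ← lintegral_indicator
    hreg.isOpen_feasibleSet.measurableSet]
  refine lintegral_congr fun θ => ?_
  by_cases hθ : θ ∈ feasibleSet prior
  · rw [indicator_of_mem hθ, ← lintegral_const_mul' _ _ ENNReal.ofReal_ne_top]
    refine lintegral_congr fun x => ?_
    rw [← ENNReal.ofReal_mul (hreg.prior_nonneg θ)]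
    congr 1
    ring
  · have h0 : prior θ = 0 := le_antisymm (not_lt.1 hθ) (hreg.prior_nonneg θ)
    rw [indicator_of_notMem hθ]
    simp [h0]

/-- The mean-squared error of every estimator is bounded below by the optimal-bias bound: if it is
finite, then the bias of the estimator is an admissible competitor. -/
theorem optimalBiasBound_le_bayesMSE [SFinite ν] (hest : IsEstimator ν prior lik est)
    (hreg : IsRegularSetting ν prior lik) (hp : RadialPrior r q prior)
    (h : RadialCoefficients n r q J)
    (hJ : ∀ θ ∈ Metric.ball (0 : E n) r, fisher ν lik θ = J ‖θ‖ • (1 : Matrix (Fin n) (Fin n) ℝ)) :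
    optimalBiasBound ν prior lik ≤ bayesMSE ν prior lik est := by
  have hprob := hp.isProbabilityMeasure
  by_cases htop : bayesMSE ν prior lik est = ⊤
  · rw [htop]; exact le_top
  have hball := hp.feasibleSet_eq
  have hJ' : ∀ θ ∈ feasibleSet prior, 0 < J ‖θ‖ := fun θ hθ => h.J_pos (norm_mem_Ico (hball ▸ hθ))
  have hmeas : ∀ θ, AEStronglyMeasurable (fun x => lik θ x * ‖est x - θ‖ ^ 2) ν := fun θ =>
    ((hreg.measurable_lik θ).mul ((hest.measurable.sub_const θ).norm.pow_const
      2)).aestronglyMeasurable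
  have hnonneg : ∀ θ ∈ feasibleSet prior, ∀ x, 0 ≤ lik θ x * ‖est x - θ‖ ^ 2 := fun θ hθ x =>
    mul_nonneg (hreg.lik_nonneg θ hθ x) (sq_nonneg _)
  have hfin : ∀ θ ∈ feasibleSet prior,
      ∫⁻ x, ENNReal.ofReal (lik θ x * ‖est x - θ‖ ^ 2) ∂ν ≠ ⊤ →
      Integrable (fun x => lik θ x * ‖est x - θ‖ ^ 2) ν := fun θ hθ hne =>
    (lintegral_ofReal_ne_top_iff_integrable (hmeas θ)
      (Eventually.of_forall (hnonneg θ hθ))).1 hne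
  -- a parameter at which the estimator has finite mean-squared error
  obtain ⟨θ₀, hθ₀, hint₀⟩ : ∃ θ₀ ∈ feasibleSet prior,
      Integrable (fun x => lik θ₀ x * ‖est x - θ₀‖ ^ 2) ν := by
    by_contra! hcon
    refine htop ?_
    rw [hest.bayesMSE_eq hreg]
    have h1 : ∫⁻ θ in feasibleSet prior, ENNReal.ofReal (prior θ) * ⊤ = ⊤ := by
      have h2 : volume (feasibleSet prior) ≠ 0 := by
        rw [hball]
        exact (Metric.measure_ball_pos volume 0 h.r_pos).ne'
      rw [← top_le_iff]
      calc (⊤ : ℝ≥0∞) = ∫⁻ θ in feasibleSet prior, ⊤ := by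
            rw [lintegral_const, Measure.restrict_apply_univ, ENNReal.top_mul h2]
        _ ≤ _ := setLIntegral_mono' hreg.isOpen_feasibleSet.measurableSet fun θ hθ => by
            rw [ENNReal.mul_top (ENNReal.ofReal_pos.2 hθ).ne']
    rw [← h1]
    refine setLIntegral_congr_fun hreg.isOpen_feasibleSet.measurableSet fun θ hθ => ?_
    have h3 := not_imp_comm.1 (hfin θ hθ) (hcon θ hθ)
    simp only [h3]
  have hint : ∀ j, ∀ θ ∈ feasibleSet prior, Integrable (fun x => est x j * lik θ x) ν :=
    fun j θ hθ => hest.integrable_mul_lik hreg (by rw [hball]; exact convex_ball 0 r) hθ₀ j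
      (hest.integrable_mul_lik_of_integrable_sq hreg hθ₀ hint₀ j) hθ
  obtain ⟨hb, hW, hD⟩ := hest.bias_mem hreg hball hp.priorMeasure_absolutelyContinuous hint
  refine (iInf₂_le (estimatorBias ν lik est) ⟨hb, _, hW, hD⟩).trans ?_
  rw [Z, hest.bayesMSE_eq hreg]
  refine lintegral_mono_ae ?_
  filter_upwards [ae_restrict_mem hreg.isOpen_feasibleSet.measurableSet,
    hW.weakJacobian_ae_eq hreg.isOpen_feasibleSet] with θ hθ hw
  rw [hw, hJ θ (hball ▸ hθ), crb_smul_one (hJ' θ hθ).ne']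
  by_cases hne : ∫⁻ x, ENNReal.ofReal (lik θ x * ‖est x - θ‖ ^ 2) ∂ν = ⊤
  · rw [hne, ENNReal.mul_top (ENNReal.ofReal_pos.2 hθ).ne']
    exact le_top
  · have hi := hfin θ hθ hne
    rw [← ofReal_integral_eq_lintegral_ofReal hi (Eventually.of_forall (hnonneg θ hθ)),
      ← ENNReal.ofReal_mul (hreg.prior_nonneg θ), mul_comm]
    exact ENNReal.ofReal_le_ofReal (mul_le_mul_of_nonneg_left
      (hest.energyPairing_bias_le hreg hθ (hJ' θ hθ) (hJ θ (hball ▸ hθ)) hi) (hreg.prior_nonneg θ))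

end IsEstimator

end MeanSquaredError

end OptimalBias

theorem theorem3 {n : ℕ} (hn : 1 ≤ n) {𝒳 : Type*} [MeasurableSpace 𝒳] (ν : Measure 𝒳)
    [SigmaFinite ν] (prior : E n → ℝ) (lik : E n → 𝒳 → ℝ)
    (hreg : IsRegularSetting ν prior lik)
    (r : ℝ) (hr : 0 < r) (hball : feasibleSet prior = Metric.ball 0 r)
    (q J : ℝ → ℝ)
    (hq : ∀ θ ∈ feasibleSet prior, prior θ = q ‖θ‖)
    (hJ : ∀ θ ∈ feasibleSet prior, fisher ν lik θ = J ‖θ‖ • (1 : Matrix (Fin n) (Fin n) ℝ))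
    (hq_cont : ContinuousOn q (Ico 0 r)) (hJ_cont : ContinuousOn J (Ico 0 r))
    (hq_ac : LocallyAC q r) (hJ_ac : LocallyAC J r)
    (hJ_lower : ∃ c > 0, ∀ ρ ∈ Ico 0 r, c ≤ J ρ)
    (hq_edge : ∃ r₀ ∈ Ioo 0 r, ∃ K : ℝ, ∀ s t, r₀ ≤ s → s ≤ t → t < r → q t ≤ K * q s) :
    (∃ b : ℝ → ℝ, IsRadialSolution n r q J b) ∧
    ∀ b : ℝ → ℝ, IsRadialSolution n r q J b →
      MemH1 prior (radialField (n := n) b) ∧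
      Z ν prior lik (radialField b) = optimalBiasBound ν prior lik ∧
      (∀ f : E n → E n, MemH1 prior f → Z ν prior lik f = optimalBiasBound ν prior lik →
        f =ᵐ[volume.restrict (feasibleSet prior)] radialField b) ∧
      IntervalIntegrable (radialIntegrand n q J b) volume 0 r ∧
      optimalBiasBound ν prior lik = ENNReal.ofReal (radialBound n r q J b) ∧
      ∀ est : 𝒳 → E n, IsEstimator ν prior lik est →
        ENNReal.ofReal (radialBound n r q J b) ≤ bayesMSE ν prior lik est := by
  have hprior : RadialPrior r q prior :=
    { measurable := hreg.prior_measurable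
      nonneg := hreg.prior_nonneg
      lintegral_eq := hreg.prior_lintegral
      feasibleSet_eq := hball
      eq_profile := hball ▸ hq }
  -- a parameter of given norm transfers the bounds on `Θ` to the profiles
  have hpoint : ∀ ρ ∈ Ico 0 r, ∃ θ ∈ feasibleSet prior, ‖θ‖ = ρ := fun ρ hρ => by
    have hnorm : ‖(EuclideanSpace.single ⟨0, hn⟩ ρ : E n)‖ = ρ := by
      rw [PiLp.norm_single, Real.norm_of_nonneg hρ.1]
    refine ⟨EuclideanSpace.single ⟨0, hn⟩ ρ, ?_, hnorm⟩
    rw [hball, mem_ball_zero_iff, hnorm]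
    exact hρ.2
  have hcoef : RadialCoefficients n r q J :=
    { one_le := hn
      r_pos := hr
      q_cont := hq_cont
      J_cont := hJ_cont
      q_pos := fun ρ hρ => by
        obtain ⟨θ, hθ, rfl⟩ := hpoint ρ hρ
        exact hq θ hθ ▸ hθ
      J_lower := hJ_lower
      J_upper := by
        obtain ⟨K, hK⟩ := hreg.fisher_bounded
        refine ⟨K, fun ρ hρ => ?_⟩
        obtain ⟨θ, hθ, rfl⟩ := hpoint ρ hρ
        have h1 := hK θ hθ ⟨0, hn⟩ ⟨0, hn⟩
        rw [hJ θ hθ, Matrix.smul_apply, Matrix.one_apply_eq, smul_eq_mul, mul_one] at h1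
        exact (le_abs_self _).trans h1
      q_ac := hq_ac
      J_ac := hJ_ac
      q_edge := hq_edge }
  rw [hball] at hJ ⊢
  obtain ⟨u, W, hu⟩ := hcoef.exists_isFluxSolution
  refine ⟨⟨_, hcoef.isRadialSolution hu⟩, fun b hb => ?_⟩
  have hZ := hprior.Z_radialField_eq_optimalBiasBound hcoef hJ hb
  have hOBB : optimalBiasBound ν prior lik = ENNReal.ofReal (radialBound n r q J b) :=
    hZ.symm.trans (hprior.Z_radialField hcoef hJ hb)
  refine ⟨hcoef.memH1_radialField hprior hb, hZ,
    fun f hf hfZ => hprior.ae_eq_radialField hcoef hJ hb hf (hfZ.trans hZ.symm),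
    (intervalIntegrable_iff_integrableOn_Ioo_of_le hr.le).2 (hcoef.integrableOn_radialIntegrand hb),
    hOBB, fun est hest => ?_⟩
  rw [← hOBB]
  exact hest.optimalBiasBound_le_bayesMSE hreg hprior hcoef hJ
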